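/- Let $G=(V,E)$ be a nonempty finite simple graph without isolated vertices, with $n$ vertices, $m$ edges, clique number $\omega$, and degeneracy $d$ (the maximum, over all nonempty subgraphs, of the minimum degree). Let $\sigma := \binom n2 - m + 1$. A dual clique cover (DCC) representation of $G$ is a pair $D=(\mathcal C,\mathcal L)$, where $\mathcal C=\{C_\ell\}_{\ell\in I}$ is a finite family of cliques of $G$ such that every edge lies in some $C_\ell$, and $\mathcal L=\{L_v\}_{v\in V}$ is its incidence dual, that is, $L_v=\{\ell\in I : v\in C_\ell\}$ and $\bigcup_{v} L_v = I$. Its size is $\|D\|=\|\mathcal C\|+\|\mathcal L\|$, where $\|\mathcal C\|=\sum_\ell|C_\ell|$ and $\|\mathcal L\|=\sum_v|L_v|$. It is succinct if no two or more of the cliques of $\mathcal C$ have a union that is a clique of $G$, and $\|\mathcal C\|=O(m)$. Then $G$ admits a succinct DCC representation $D$ such that (i) $\|D\| = O(\min\{m,\omega\sigma\})$, and (ii) $D$ can be computed in $O(d^2\cdot\min\{m,\sigma\})$ time using $O(m)$ space. All implied constants are absolute. Computation is by one fixed program, working for all such graphs, on a random access machine with words of $O(\log n)$ bits: the input is given by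 the adjacency lists of $G$ (in any order, for any numbering of the vertices), the output consists of lists of the elements of the sets $C_\ell$ and $L_v$, time is the number of steps, and space is the number of words of memory, including those for input and output. -/

import Mathlib

namespace DualCliqueCover

/-! ### Graph parameters -/

section Parameters

variable {V : Type*}

/-- The number `m` of edges. -/
noncomputable def numEdges (G : SimpleGraph V) : ℕ := G.edgeSet.ncard

/-- The clique distance `σ = C(n,2) - m + 1` (one plus the number of non-edges).
The subtraction never truncates, because a simple graph has at most `C(n,2)` edges. -/
noncomputable def cliqueDist [Fintype V] (G : SimpleGraph V) : ℕ :=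
  (Fintype.card V).choose 2 - numEdges G + 1

/-- The degeneracy: the maximum, over all nonempty subgraphs `H`, of the minimum degree of `H`,
i.e. the largest `k` such that some nonempty subgraph has all its degrees at least `k`. -/
noncomputable def degeneracy (G : SimpleGraph V) : ℕ :=
  sSup {k : ℕ | ∃ H : G.Subgraph, H.verts.Nonempty ∧ ∀ v ∈ H.verts, k ≤ (H.neighborSet v).ncard}

end Parameters

/-! ### Dual clique cover representations -/

/-- A dual clique cover representation `(C, L)` of `G`: the family `C` (with index set
`Fin k`) consists of cliques covering all edges, and `L` is its incidence dual. -/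
structure DCC {V : Type*} (G : SimpleGraph V) where
  /-- the number of cliques -/
  k : ℕ
  /-- the cliques -/
  C : Fin k → Finset V
  /-- the incidence dual -/
  L : V → Finset (Fin k)
  isClique : ∀ i, G.IsClique (C i : Set V)
  covers : ∀ u v, G.Adj u v → ∃ i, u ∈ C i ∧ v ∈ C i
  mem_L : ∀ v i, i ∈ L v ↔ v ∈ C i
  union_L : ∀ i, ∃ v, i ∈ L v

namespace DCC

variable {V : Type*} {G : SimpleGraph V}

/-- The total size `‖C‖` of the clique cover. -/
def sizeC (D : DCC G) : ℕ := ∑ i, (D.C i).card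

/-- The total size `‖L‖` of the incidence dual. -/
def sizeL [Fintype V] (D : DCC G) : ℕ := ∑ v, (D.L v).card

/-- The size `‖C‖ + ‖L‖` of the representation. -/
def size [Fintype V] (D : DCC G) : ℕ := D.sizeC + D.sizeL

/-- No two or more of the cliques have a union that is a clique. -/
def CompositionMinimal (D : DCC G) : Prop :=
  ∀ S : Finset (Fin D.k), 2 ≤ S.card → ¬ G.IsClique (⋃ i ∈ S, (D.C i : Set V))

/-- `D` is succinct, where `K` is the constant in the bound `‖C‖ = O(m)`. -/
def Succinct (K : ℕ) (D : DCC G) : Prop :=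
  D.CompositionMinimal ∧ D.sizeC ≤ K * numEdges G

end DCC

/-! ### Random access machines -/

/-- The tests of the machine; the arguments are registers. -/
inductive Test where
  | eq (r s : ℕ)
  | lt (r s : ℕ)

/-- Programs of a random access machine. Numbers `r s t` name registers; a program is a finite
object, so it uses a constant number of registers. Apart from them there is a memory, indexed by
natural numbers, that is accessed by indirect addressing. -/
inductive Prog where
  /-- do nothing -/
  | skip
  /-- `r := c` for a constant `c` -/
  | const (r c : ℕ)
  /-- `r := s` -/
  | copy (r s : ℕ)
  /-- `r := s + t` -/
  | add (r s t : ℕ)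
  /-- `r := s - t` (truncated subtraction) -/
  | sub (r s t : ℕ)
  /-- `r := mem[s]` -/
  | load (r s : ℕ)
  /-- `mem[r] := s` -/
  | store (r s : ℕ)
  /-- sequential composition -/
  | seq (p q : Prog)
  /-- conditional -/
  | ite (b : Test) (p q : Prog)
  /-- loop -/
  | while (b : Test) (p : Prog)

/-- The contents of the registers and of the memory. -/
structure State where
  reg : ℕ → ℕ
  mem : ℕ → ℕ

/-- The truth value of a test. -/
def Test.holds : Test → State → Prop
  | .eq r s, σ => σ.reg r = σ.reg s
  | .lt r s, σ => σ.reg r < σ.reg s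

/-- The state after register `r` has received the value `x`. -/
def State.setReg (σ : State) (r x : ℕ) : State := { σ with reg := Function.update σ.reg r x }

/-- The state after the memory cell `a` has received the value `x`. -/
def State.setMem (σ : State) (a x : ℕ) : State := { σ with mem := Function.update σ.mem a x }

/-- `Exec S W p σ t τ`: started in the state `σ`, the program `p` halts in the state `τ` after
exactly `t` steps (every instruction and every evaluation of a test is one step), all memory
addresses that it reads or writes are smaller than `S`, and all values that it puts into
registers (hence also all values that it puts into memory) are smaller than `W`. -/
inductive Exec (S W : ℕ) : Prog → State → ℕ → State → Prop
  | skip (σ : State) : Exec S W .skip σ 1 σ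
  | const (σ : State) (r c : ℕ) (hW : c < W) : Exec S W (.const r c) σ 1 (σ.setReg r c)
  | copy (σ : State) (r s : ℕ) (hW : σ.reg s < W) :
      Exec S W (.copy r s) σ 1 (σ.setReg r (σ.reg s))
  | add (σ : State) (r s t : ℕ) (hW : σ.reg s + σ.reg t < W) :
      Exec S W (.add r s t) σ 1 (σ.setReg r (σ.reg s + σ.reg t))
  | sub (σ : State) (r s t : ℕ) (hW : σ.reg s - σ.reg t < W) :
      Exec S W (.sub r s t) σ 1 (σ.setReg r (σ.reg s - σ.reg t))
  | load (σ : State) (r s : ℕ) (hS : σ.reg s < S) (hW : σ.mem (σ.reg s) < W) :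
      Exec S W (.load r s) σ 1 (σ.setReg r (σ.mem (σ.reg s)))
  | store (σ : State) (r s : ℕ) (hS : σ.reg r < S) (hW : σ.reg s < W) :
      Exec S W (.store r s) σ 1 (σ.setMem (σ.reg r) (σ.reg s))
  | seq (p q : Prog) (σ τ υ : State) (t u : ℕ) (hp : Exec S W p σ t τ) (hq : Exec S W q τ u υ) :
      Exec S W (.seq p q) σ (t + u) υ
  | ite_true (b : Test) (p q : Prog) (σ τ : State) (t : ℕ) (hb : b.holds σ)
      (hp : Exec S W p σ t τ) : Exec S W (.ite b p q) σ (t + 1) τ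
  | ite_false (b : Test) (p q : Prog) (σ τ : State) (t : ℕ) (hb : ¬ b.holds σ)
      (hq : Exec S W q σ t τ) : Exec S W (.ite b p q) σ (t + 1) τ
  | while_false (b : Test) (p : Prog) (σ : State) (hb : ¬ b.holds σ) :
      Exec S W (.while b p) σ 1 σ
  | while_true (b : Test) (p : Prog) (σ τ υ : State) (t u : ℕ) (hb : b.holds σ)
      (hp : Exec S W p σ t τ) (hw : Exec S W (.while b p) τ u υ) :
      Exec S W (.while b p) σ (t + u + 1) υ

/-! ### Input and output -/

/-- A list of lists as a sequence of words: the number of lists, their lengths, and then their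
entries, one list after the other. -/
def encodeLists (A : List (List ℕ)) : List ℕ :=
  A.length :: (A.map List.length ++ A.flatten)

/-- The list `A` enumerates the finite set `s` in some order, without repetition. -/
def Enumerates {α : Type*} (A : List α) (s : Set α) : Prop :=
  A.Nodup ∧ ∀ x, x ∈ A ↔ x ∈ s

section InputOutput

variable {V : Type*} [Fintype V]

/-- The lists `A v`, in the order of the numbering `e` of the vertices. -/
def inOrder {α : Type*} (e : V ≃ Fin (Fintype.card V)) (A : V → List α) : List (List α) :=
  (List.finRange (Fintype.card V)).map fun i => A (e.symm i)

/-- The initial state for a graph given by its adjacency lists `N`, with the vertices numbered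
by `e`: the adjacency lists are in memory from address `0` on, and everything else is `0`. -/
def inputState (e : V ≃ Fin (Fintype.card V)) (N : V → List V) : State where
  reg _ := 0
  mem a := (encodeLists (inOrder e fun v => (N v).map fun w => (e w : ℕ))).getD a 0

/-- The state `τ` holds the representation `D`: from the address given by register `0` on, and
below `S`, the memory holds lists of the vertices of the cliques, and then, for each vertex, a list
of the cliques that contain it. -/
def Outputs {G : SimpleGraph V} (S : ℕ) (e : V ≃ Fin (Fintype.card V)) (τ : State)
    (D : DCC G) : Prop :=
  ∃ (c : Fin D.k → List V) (l : V → List (Fin D.k)),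
    (∀ i, Enumerates (c i) (D.C i : Set V)) ∧ (∀ v, Enumerates (l v) (D.L v : Set (Fin D.k))) ∧
    ∃ out : List ℕ,
      out = encodeLists ((List.finRange D.k).map fun i => (c i).map fun v => (e v : ℕ)) ++
        encodeLists (inOrder e fun v => (l v).map fun i => (i : ℕ)) ∧
      τ.reg 0 + out.length ≤ S ∧
      ∀ j, j < out.length → τ.mem (τ.reg 0 + j) = out.getD j 0

end InputOutput

end DualCliqueCover

/-!
The idea. Order the vertices so that every vertex has minimum degree in the graph induced by itself
and the vertices before it (a smallest-last order). Then no vertex has more than `d` earlier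
neighbours. Let `gap z` be the number of earlier vertices that are not adjacent to `z`. Counting the
pairs of vertices gives `σ = 1 + ∑ gap z` (`edgeCount_add_sum_gap`). If `z` is adjacent to all
earlier vertices, then minimality of its degree forces the vertices up to `z` to form a clique; so
the vertices without gap are an initial segment of the order, and a clique (`SmallestLast.gap_pos`).

A clique cover is represented by a labelling of the edges: the clique with label `c` consists of the
endpoints of the edges with label `c`. Every edge has one label, hence `‖𝓒‖ ≤ 2m`, whatever the
cover; and `‖𝓒‖ ≤ kω` if there are `k` labels. Since `‖𝓛‖ = ‖𝓒‖`, the bound on `‖D‖` follows from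
`k = O(σ)`.

The vertices without gap get a single label. For each later vertex `p`, the edges to its earlier
neighbours are labelled in rounds. A round takes a maximal clique `X` among the earlier neighbours
whose edge to `p` is not labelled yet. If there is an old clique whose union with `X ∪ {p}` is a
clique, then the edges between `p` and `X` get its label, otherwise a new one. In both cases no two
of the cliques have a union that is a clique (`IsCover.extend`, `IsCover.new`), and this passes to
more than two of them, because a union contains the unions of its pairs.

A neighbour `w` that is still unlabelled after `r` rounds has a non-neighbour in each of the `r`
disjoint sets `X` (`step_spec`). As the degree of `w` among the vertices up to `p` is at least the
degree of `p`, it has at most `gap p` non-neighbours there (`SmallestLast.card_nonNear_le`). So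
there are at most `gap p + 1 ≤ 2 * gap p` rounds for `p`, and of course at most as many as `p` has
earlier neighbours. In total there are at most `2 * ∑ gap p` rounds besides the initial label, so
`k ≤ 2σ`, and there are at most `2 * min m (∑ gap p)` rounds.

A round takes time `O(d²)`: all pairs of adjacent vertices in the closed earlier neighbourhood of
`p` can be found in the lists of earlier neighbours of its at most `d + 1` members (`scan_spec`).
For each vertex in it the neighbours in `X` are counted, then for each label the edges both of whose
endpoints are equal or adjacent to all of `X`; an old clique is compatible with `X ∪ {p}` if and
only if all of its edges are counted. The total is `O(m + d² * min m σ)`, and `m ≤ d² * σ`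
(`SmallestLast.edgeCount_le`). The order itself is found in time `O(m)`, with stacks of the vertices
of each degree (`order_spec`).

The algorithm is written in a small language with named variables and arrays, whose semantics counts
the iterations of loops. Compilation to the random access machine (`Com.compile_spec`) costs a
constant factor in time, and the 25 arrays have four times the length of the input.
-/

set_option linter.constructorNameAsVariable false
set_option linter.unusedSimpArgs false

namespace DualCliqueCover

/-! ### A structured language with named variables and arrays -/

/-- The variables of the structured language. Lasting roles are: `n` the number of vertices, `p` the
current position, `k` the number of labels; the others are scratch. -/
inductive Var where
  | n | i | j | je | o | f | c | cur | h | x | y | p | q | k | z | s | xn | sel | a | ie | w | u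
  deriving DecidableEq

/-- The arrays of the structured language. `inp` is the input, and `out` the output. `off`, `deg`,
`pos` and `ord` are indexed by vertices, respectively positions; `eo`, `el`, `nb` and `lab` are the
lists of earlier neighbours and the labels of the edges to them; `tot`, `mk`, `inX`, `g`, `cnt` and
`last` are counters and marks; the arrays `hd`, `nx`, `vl`, with or without a suffix, are linked
lists. -/
inductive Arr where
  | inp | off | deg | hd | nx | vl | pos | ord | eo | el | nb | lab | tot | mk | inX | g | cnt
  | hd2 | nx2 | vl2 | hd3 | nx3 | vl3 | last | out
  deriving DecidableEq

/-- The number of arrays. -/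
def numArr : ℕ := 25

theorem Var.ctorIdx_injective : Function.Injective Var.ctorIdx := fun a b h => by
  rw [← Var.ofNat_ctorIdx a, h, Var.ofNat_ctorIdx]

theorem Arr.ctorIdx_injective : Function.Injective Arr.ctorIdx := fun a b h => by
  rw [← Arr.ofNat_ctorIdx a, h, Arr.ofNat_ctorIdx]

theorem Arr.ctorIdx_lt (a : Arr) : a.ctorIdx < numArr := by cases a <;> decide

/-- The states of the structured language. The clock counts iterations of loops. Arrays are
unbounded here; `Ex.ok` and `wp` restrict the indices that a command uses. -/
structure HState where
  reg : Var → ℕ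
  arr : Arr → ℕ → ℕ
  clk : ℕ

namespace HState

/-- Assignment to a variable. -/
def set (σ : HState) (x : Var) (v : ℕ) : HState := { σ with reg := Function.update σ.reg x v }

/-- Assignment to an array entry. -/
def put (σ : HState) (a : Arr) (i v : ℕ) : HState :=
  { σ with arr := Function.update σ.arr a (Function.update (σ.arr a) i v) }

/-- Advance the clock. -/
def tick (σ : HState) : HState := { σ with clk := σ.clk + 1 }

@[simp] theorem reg_set (σ : HState) (x : Var) (v : ℕ) (y : Var) :
    (σ.set x v).reg y = if y = x then v else σ.reg y := by
  simp [set, Function.update_apply]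
@[simp] theorem arr_set (σ : HState) (x : Var) (v : ℕ) : (σ.set x v).arr = σ.arr := rfl
@[simp] theorem clk_set (σ : HState) (x : Var) (v : ℕ) : (σ.set x v).clk = σ.clk := rfl
@[simp] theorem reg_put (σ : HState) (a : Arr) (i v : ℕ) : (σ.put a i v).reg = σ.reg := rfl
@[simp] theorem arr_put (σ : HState) (a : Arr) (i v : ℕ) (b : Arr) :
    (σ.put a i v).arr b = if b = a then Function.update (σ.arr a) i v else σ.arr b := by
  simp only [put, Function.update_apply]
@[simp] theorem clk_put (σ : HState) (a : Arr) (i v : ℕ) : (σ.put a i v).clk = σ.clk := rfl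
@[simp] theorem reg_tick (σ : HState) : σ.tick.reg = σ.reg := rfl
@[simp] theorem arr_tick (σ : HState) : σ.tick.arr = σ.arr := rfl
@[simp] theorem clk_tick (σ : HState) : σ.tick.clk = σ.clk + 1 := rfl

end HState

/-- Expressions. -/
inductive Ex where
  | c (k : ℕ)
  | v (x : Var)
  | rd (a : Arr) (e : Ex)
  | plus (e f : Ex)
  | minus (e f : Ex)

/-- Tests. -/
inductive Bx where
  | lt (e f : Ex)
  | eq (e f : Ex)

/-- Commands. -/
inductive Com where
  | set (x : Var) (e : Ex)
  | put (a : Arr) (e f : Ex)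
  | seq (p q : Com)
  | ite (b : Bx) (p q : Com)
  | loop (b : Bx) (p : Com)
  | nop

/-- The value of an expression. -/
@[simp] def Ex.eval : Ex → HState → ℕ
  | c k, _ => k
  | v x, σ => σ.reg x
  | rd a e, σ => σ.arr a (e.eval σ)
  | plus e f, σ => e.eval σ + f.eval σ
  | minus e f, σ => e.eval σ - f.eval σ

/-- The truth value of a test. -/
@[simp] def Bx.holds : Bx → HState → Prop
  | lt e f, σ => e.eval σ < f.eval σ
  | eq e f, σ => e.eval σ = f.eval σ

/-- The expression reads arrays below index `M` only, and its intermediate values are below `W`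
as soon as the values in the state are. -/
@[simp] def Ex.ok (M W : ℕ) : Ex → HState → Prop
  | c k, _ => k < W
  | v _, _ => True
  | rd _ e, σ => e.ok M W σ ∧ e.eval σ < M
  | plus e f, σ => e.ok M W σ ∧ f.ok M W σ ∧ e.eval σ + f.eval σ < W
  | minus e f, σ => e.ok M W σ ∧ f.ok M W σ

/-- The two sides of the test satisfy `Ex.ok`. -/
@[simp] def Bx.ok (M W : ℕ) : Bx → HState → Prop
  | lt e f, σ => e.ok M W σ ∧ f.ok M W σ
  | eq e f, σ => e.ok M W σ ∧ f.ok M W σ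

/-- A weakest-precondition style semantics: `wp M W p Q σ` guarantees that `p`, started in `σ`,
halts in a state that satisfies `Q`, with array indices below `M` and values below `W`. Loops
come with an invariant `I` and a decreasing measure `μ`; the clock is advanced before each execution
of the body. -/
def wp (M W : ℕ) : Com → (HState → Prop) → HState → Prop
  | .set x e, Q, σ => e.ok M W σ ∧ Q (σ.set x (e.eval σ))
  | .put a e f, Q, σ => e.ok M W σ ∧ f.ok M W σ ∧ e.eval σ < M ∧ Q (σ.put a (e.eval σ) (f.eval σ))
  | .seq p q, Q, σ => wp M W p (fun τ => wp M W q Q τ) σ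
  | .ite b p q, Q, σ => b.ok M W σ ∧ (b.holds σ → wp M W p Q σ) ∧ (¬ b.holds σ → wp M W q Q σ)
  | .loop b p, Q, σ => ∃ (I : HState → Prop) (μ : HState → ℕ), I σ ∧ ∀ τ, I τ →
      b.ok M W τ ∧ (b.holds τ → wp M W p (fun υ => I υ ∧ μ υ < μ τ) τ.tick) ∧ (¬ b.holds τ → Q τ)
  | .nop, Q, σ => Q σ

section Rules

variable {M W : ℕ} {p q : Com} {Q : HState → Prop} {σ : HState}

theorem wp_set {x : Var} {e : Ex} :
    wp M W (.set x e) Q σ ↔ e.ok M W σ ∧ Q (σ.set x (e.eval σ)) := Iff.rfl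
theorem wp_put {a : Arr} {e f : Ex} : wp M W (.put a e f) Q σ ↔
    e.ok M W σ ∧ f.ok M W σ ∧ e.eval σ < M ∧ Q (σ.put a (e.eval σ) (f.eval σ)) := Iff.rfl
theorem wp_seq : wp M W (.seq p q) Q σ ↔ wp M W p (fun τ => wp M W q Q τ) σ := Iff.rfl
theorem wp_ite {b : Bx} : wp M W (.ite b p q) Q σ ↔
    b.ok M W σ ∧ (b.holds σ → wp M W p Q σ) ∧ (¬ b.holds σ → wp M W q Q σ) := Iff.rfl
theorem wp_nop : wp M W .nop Q σ ↔ Q σ := Iff.rfl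

end Rules

/-- The equations by which `simp` executes commands symbolically: the rules of `wp` other than the
one for loops, the semantics of expressions and tests, and the access to a modified state. -/
theorem wp_eqs :
    (∀ {M W x e Q σ}, wp M W (.set x e) Q σ ↔ e.ok M W σ ∧ Q (σ.set x (e.eval σ))) ∧
    (∀ {M W a e f Q σ}, wp M W (.put a e f) Q σ ↔
      e.ok M W σ ∧ f.ok M W σ ∧ e.eval σ < M ∧ Q (σ.put a (e.eval σ) (f.eval σ))) ∧
    (∀ {M W p q Q σ}, wp M W (.seq p q) Q σ ↔ wp M W p (fun τ => wp M W q Q τ) σ) ∧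
    (∀ {M W b p q Q σ}, wp M W (.ite b p q) Q σ ↔
      b.ok M W σ ∧ (b.holds σ → wp M W p Q σ) ∧ (¬ b.holds σ → wp M W q Q σ)) ∧
    (∀ {M W Q σ}, wp M W .nop Q σ ↔ Q σ) ∧
    (∀ {M W k σ}, (Ex.c k).ok M W σ ↔ k < W) ∧
    (∀ {M W x σ}, (Ex.v x).ok M W σ ↔ True) ∧
    (∀ {M W a e σ}, (Ex.rd a e).ok M W σ ↔ e.ok M W σ ∧ e.eval σ < M) ∧
    (∀ {M W e f σ}, (Ex.plus e f).ok M W σ ↔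
      e.ok M W σ ∧ f.ok M W σ ∧ e.eval σ + f.eval σ < W) ∧
    (∀ {M W e f σ}, (Ex.minus e f).ok M W σ ↔ e.ok M W σ ∧ f.ok M W σ) ∧
    (∀ {k σ}, (Ex.c k).eval σ = k) ∧
    (∀ {x σ}, (Ex.v x).eval σ = σ.reg x) ∧
    (∀ {a e σ}, (Ex.rd a e).eval σ = σ.arr a (e.eval σ)) ∧
    (∀ {e f σ}, (Ex.plus e f).eval σ = e.eval σ + f.eval σ) ∧
    (∀ {e f σ}, (Ex.minus e f).eval σ = e.eval σ - f.eval σ) ∧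
    (∀ {M W e f σ}, (Bx.lt e f).ok M W σ ↔ e.ok M W σ ∧ f.ok M W σ) ∧
    (∀ {M W e f σ}, (Bx.eq e f).ok M W σ ↔ e.ok M W σ ∧ f.ok M W σ) ∧
    (∀ {e f σ}, (Bx.lt e f).holds σ ↔ e.eval σ < f.eval σ) ∧
    (∀ {e f σ}, (Bx.eq e f).holds σ ↔ e.eval σ = f.eval σ) ∧
    (∀ {σ : HState} {x v y}, (σ.set x v).reg y = if y = x then v else σ.reg y) ∧
    (∀ {σ : HState} {x v}, (σ.set x v).arr = σ.arr) ∧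
    (∀ {σ : HState} {x v}, (σ.set x v).clk = σ.clk) ∧
    (∀ {σ : HState} {a i v}, (σ.put a i v).reg = σ.reg) ∧
    (∀ {σ : HState} {a i v b}, (σ.put a i v).arr b =
      if b = a then Function.update (σ.arr a) i v else σ.arr b) ∧
    (∀ {σ : HState} {a i v}, (σ.put a i v).clk = σ.clk) ∧
    (∀ {σ : HState}, σ.tick.reg = σ.reg) ∧
    (∀ {σ : HState}, σ.tick.arr = σ.arr) ∧
    ∀ {σ : HState}, σ.tick.clk = σ.clk + 1 := by
  refine ⟨?_, ?_, ?_, ?_, ?_, ?_, ?_, ?_, ?_, ?_, ?_, ?_, ?_, ?_, ?_, ?_, ?_, ?_, ?_, ?_, ?_, ?_,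
    ?_,
    ?_, ?_, ?_, ?_, ?_⟩ <;> intros <;> simp [wp_set, wp_put, wp_seq, wp_ite, wp_nop]

theorem wp_mono {M W : ℕ} {p : Com} {Q R : HState → Prop} {σ : HState} (h : wp M W p Q σ)
    (hQR : ∀ τ, Q τ → R τ) : wp M W p R σ := by
  induction p generalizing Q R σ with
  | set x e => exact ⟨h.1, hQR _ h.2⟩
  | put a e f => exact ⟨h.1, h.2.1, h.2.2.1, hQR _ h.2.2.2⟩
  | seq p q ihp ihq => exact ihp h fun τ hτ => ihq hτ hQR
  | ite b p q ihp ihq => exact ⟨h.1, fun hb => ihp (h.2.1 hb) hQR, fun hb => ihq (h.2.2 hb) hQR⟩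
  | loop b p ih =>
    obtain ⟨I, μ, h0, hI⟩ := h
    exact ⟨I, μ, h0, fun τ hτ => ⟨(hI τ hτ).1, (hI τ hτ).2.1, fun hb => hQR _ ((hI τ hτ).2.2 hb)⟩⟩
  | nop => exact hQR _ h

/-! ### Frames -/

/-- The variables that a command may change. -/
@[simp] def Com.vars : Com → List Var
  | set x _ => [x]
  | put _ _ _ => []
  | seq p q => p.vars ++ q.vars
  | ite _ p q => p.vars ++ q.vars
  | loop _ p => p.vars
  | nop => []

/-- The arrays that a command may change. -/
@[simp] def Com.arrs : Com → List Arr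
  | set _ _ => []
  | put a _ _ => [a]
  | seq p q => p.arrs ++ q.arrs
  | ite _ p q => p.arrs ++ q.arrs
  | loop _ p => p.arrs
  | nop => []

/-- `τ` differs from `σ` at most in what `p` may change. -/
structure Frame (p : Com) (σ τ : HState) : Prop where
  reg : ∀ x, x ∉ p.vars → τ.reg x = σ.reg x
  arr : ∀ a, a ∉ p.arrs → τ.arr a = σ.arr a

theorem Frame.refl (p : Com) (σ : HState) : Frame p σ σ := ⟨fun _ _ => rfl, fun _ _ => rfl⟩

/-- A command changes only what it mentions as a target, so that invariants need not list the
unchanged part of the state. -/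
theorem wp_frame {M W : ℕ} {p : Com} {Q : HState → Prop} {σ : HState} (h : wp M W p Q σ) :
    wp M W p (fun τ => Q τ ∧ Frame p σ τ) σ := by
  induction p generalizing Q σ with
  | set x e => exact ⟨h.1, h.2, fun y hy => by simp at hy ⊢; simp [hy], fun _ _ => rfl⟩
  | put a e f =>
    exact ⟨h.1, h.2.1, h.2.2.1, h.2.2.2, fun _ _ => rfl, fun b hb => by simp at hb ⊢; simp [hb]⟩
  | seq p q ihp ihq =>
    refine wp_mono (p := p) (ihp h) fun τ hτ => wp_mono (ihq hτ.1) fun υ hυ => ⟨hυ.1, ?_, ?_⟩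
    · intro y hy
      simp only [Com.vars, List.mem_append, not_or] at hy
      rw [hυ.2.reg y hy.2, hτ.2.reg y hy.1]
    · intro y hy
      simp only [Com.arrs, List.mem_append, not_or] at hy
      rw [hυ.2.arr y hy.2, hτ.2.arr y hy.1]
  | ite b p q ihp ihq =>
    refine ⟨h.1, fun hb => wp_mono (ihp (h.2.1 hb)) fun τ hτ => ⟨hτ.1, ?_, ?_⟩,
      fun hb => wp_mono (ihq (h.2.2 hb)) fun τ hτ => ⟨hτ.1, ?_, ?_⟩⟩
    · exact fun y hy => hτ.2.reg y fun h => hy (List.mem_append_left _ h)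
    · exact fun y hy => hτ.2.arr y fun h => hy (List.mem_append_left _ h)
    · exact fun y hy => hτ.2.reg y fun h => hy (List.mem_append_right _ h)
    · exact fun y hy => hτ.2.arr y fun h => hy (List.mem_append_right _ h)
  | loop b p ih =>
    obtain ⟨I, μ, h0, hI⟩ := h
    refine ⟨fun τ => I τ ∧ Frame (.loop b p) σ τ, μ, ⟨h0, Frame.refl _ _⟩, fun τ hτ =>
      ⟨(hI τ hτ.1).1, fun hb => wp_mono (ih ((hI τ hτ.1).2.1 hb)) fun υ hυ =>
        ⟨⟨hυ.1.1, ?_, ?_⟩, hυ.1.2⟩, fun hb => ⟨(hI τ hτ.1).2.2 hb, hτ.2⟩⟩⟩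
    · exact fun y hy => (hυ.2.reg y hy).trans (hτ.2.reg y hy)
    · exact fun y hy => (hυ.2.arr y hy).trans (hτ.2.arr y hy)
  | nop => exact ⟨h, Frame.refl _ _⟩

/-- The rule for loops, with the frame of the loop available in every iteration. -/
theorem wp_loop {M W : ℕ} {b : Bx} {p : Com} {Q : HState → Prop} {σ : HState}
    (I : HState → Prop) (μ : HState → ℕ) (h0 : I σ)
    (hok : ∀ τ, I τ → Frame p σ τ → b.ok M W τ)
    (hstep : ∀ τ, I τ → Frame p σ τ → b.holds τ →
      wp M W p (fun υ => I υ ∧ μ υ < μ τ) τ.tick)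
    (hpost : ∀ τ, I τ → Frame p σ τ → ¬ b.holds τ → Q τ) : wp M W (.loop b p) Q σ := by
  refine ⟨fun τ => I τ ∧ Frame p σ τ, μ, ⟨h0, Frame.refl _ _⟩, fun τ hτ =>
      ⟨hok τ hτ.1 hτ.2, fun hb => wp_mono (wp_frame (hstep τ hτ.1 hτ.2 hb)) fun υ hυ =>
        ⟨⟨hυ.1.1, ?_, ?_⟩, hυ.1.2⟩, fun hb => hpost τ hτ.1 hτ.2 hb⟩⟩
  · exact fun y hy => (hυ.2.reg y hy).trans (hτ.2.reg y hy)
  · exact fun y hy => (hυ.2.arr y hy).trans (hτ.2.arr y hy)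

/-- `for x < e do p`, where `x` has its initial value already. -/
def Com.upto (x : Var) (e : Ex) (p : Com) : Com :=
  .loop (.lt (.v x) e) (.seq p (.set x (.plus (.v x) (.c 1))))

/-- The rule for counting loops. The bound is evaluated anew in every iteration, so it must keep the
value `N`; the invariant `I` depends on the value of the counter. -/
theorem wp_upto {M W : ℕ} {x : Var} {e : Ex} {p : Com} {Q : HState → Prop} {σ : HState}
    (I : ℕ → HState → Prop) (N : ℕ) (hxp : x ∉ p.vars) (hN : N < W)
    (hle : σ.reg x ≤ N) (h0 : I (σ.reg x) σ)
    (hok : ∀ τ, Frame (.seq p (.set x (.plus (.v x) (.c 1)))) σ τ → τ.reg x ≤ N → I (τ.reg x) τ →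
      e.ok M W τ ∧ e.eval τ = N)
    (hstep : ∀ τ, Frame (.seq p (.set x (.plus (.v x) (.c 1)))) σ τ → σ.reg x ≤ τ.reg x →
      τ.reg x < N → I (τ.reg x) τ →
      wp M W p (fun υ => I (τ.reg x + 1) (υ.set x (τ.reg x + 1))) τ.tick)
    (hpost : ∀ τ, Frame (.seq p (.set x (.plus (.v x) (.c 1)))) σ τ → τ.reg x = N → I N τ → Q τ) :
    wp M W (Com.upto x e p) Q σ := by
  refine wp_loop (fun τ => σ.reg x ≤ τ.reg x ∧ τ.reg x ≤ N ∧ I (τ.reg x) τ) (fun τ => N - τ.reg x)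
    ⟨le_rfl, hle, h0⟩ ?_ ?_ ?_
  · intro τ h hf
    exact ⟨trivial, (hok τ hf h.2.1 h.2.2).1⟩
  · intro τ h hf hb
    have he := (hok τ hf h.2.1 h.2.2).2
    simp only [Bx.holds, Ex.eval, he] at hb
    refine wp_mono (p := p) (wp_frame (hstep τ hf h.1 hb h.2.2)) fun υ hυ => ?_
    have hx : υ.reg x = τ.reg x := hυ.2.reg x hxp
    simp only [wp, Ex.ok, Ex.eval, hx, HState.reg_set, if_true]
    exact ⟨⟨trivial, by omega, by omega⟩, ⟨by omega, by omega, hυ.1⟩, by omega⟩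
  · intro τ h hf hb
    have he := (hok τ hf h.2.1 h.2.2).2
    simp only [Bx.holds, Ex.eval, he] at hb
    have hx : τ.reg x = N := by omega
    exact hpost τ hf hx (hx ▸ h.2.2)

/-! ### Compilation -/

/-- Code that leaves the value of an expression in register `3 * t + 2`, using only registers
`3 * s + 2` with `t ≤ s`. Register `3 * i` holds the variable with index `i`, and register
`3 * i + 1` the address of the array with index `i`. -/
def Ex.compile : Ex → ℕ → Prog
  | c k, t => .const (3 * t + 2) k
  | v x, t => .copy (3 * t + 2) (3 * x.ctorIdx)
  | rd a e, t => .seq (e.compile t)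
      (.seq (.add (3 * t + 2) (3 * a.ctorIdx + 1) (3 * t + 2)) (.load (3 * t + 2) (3 * t + 2)))
  | plus e f, t => .seq (e.compile t) (.seq (f.compile (t + 1))
      (.add (3 * t + 2) (3 * t + 2) (3 * (t + 1) + 2)))
  | minus e f, t => .seq (e.compile t) (.seq (f.compile (t + 1))
      (.sub (3 * t + 2) (3 * t + 2) (3 * (t + 1) + 2)))

/-- The number of steps of `Ex.compile`. -/
def Ex.size : Ex → ℕ
  | c _ => 1
  | v _ => 1
  | rd _ e => e.size + 2
  | plus e f => e.size + (f.size + 1)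
  | minus e f => e.size + (f.size + 1)

/-- Code that evaluates the two sides of a test. -/
def Bx.compile : Bx → Prog
  | lt e f => .seq (e.compile 0) (f.compile 1)
  | eq e f => .seq (e.compile 0) (f.compile 1)

/-- The test of the machine, to be made after `Bx.compile`. -/
def Bx.test : Bx → Test
  | lt _ _ => .lt 2 5
  | eq _ _ => .eq 2 5

/-- The number of steps of `Bx.compile`. -/
def Bx.size : Bx → ℕ
  | lt e f => e.size + f.size
  | eq e f => e.size + f.size

/-- The machine code of a command. -/
def Com.compile : Com → Prog
  | set x e => .seq (e.compile 0) (.copy (3 * x.ctorIdx) 2)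
  | put a e f => .seq (e.compile 0) (.seq (f.compile 1)
      (.seq (.add 2 (3 * a.ctorIdx + 1) 2) (.store 2 5)))
  | seq p q => .seq p.compile q.compile
  | ite b p q => .seq b.compile (.ite b.test p.compile q.compile)
  | loop b p => .seq b.compile (.while b.test (.seq p.compile b.compile))
  | nop => .skip

/-- A bound on the number of steps per iteration of a loop. -/
def Com.size : Com → ℕ
  | set _ e => e.size + 1
  | put _ e f => e.size + f.size + 2
  | seq p q => p.size + q.size
  | ite b p q => b.size + 1 + p.size + q.size
  | loop b p => b.size + 1 + p.size
  | nop => 1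

/-- The machine state `l` represents `σ`, with arrays of capacity `M` and values below `W`. -/
structure Rel (M W : ℕ) (l : State) (σ : HState) : Prop where
  reg : ∀ x : Var, l.reg (3 * x.ctorIdx) = σ.reg x
  base : ∀ a : Arr, l.reg (3 * a.ctorIdx + 1) = a.ctorIdx * M
  mem : ∀ (a : Arr) (i : ℕ), i < M → l.mem (a.ctorIdx * M + i) = σ.arr a i
  reg_lt : ∀ x : Var, σ.reg x < W
  arr_lt : ∀ (a : Arr) (i : ℕ), i < M → σ.arr a i < W

section Soundness

variable {M W : ℕ}

theorem addr_lt (a : Arr) {i : ℕ} (hi : i < M) : a.ctorIdx * M + i < numArr * M := by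
  have h := a.ctorIdx_lt
  calc a.ctorIdx * M + i < a.ctorIdx * M + M := by omega
    _ = (a.ctorIdx + 1) * M := by ring
    _ ≤ numArr * M := Nat.mul_le_mul_right _ h

theorem addr_inj {a b : Arr} {i j : ℕ} (hi : i < M) (hj : j < M)
    (h : a.ctorIdx * M + i = b.ctorIdx * M + j) : a = b ∧ i = j := by
  have hM : 0 < M := by omega
  have h2 := congrArg (· % M) h
  simp only [Nat.mul_add_mod_self_right, Nat.mod_eq_of_lt hi, Nat.mod_eq_of_lt hj] at h2
  rw [← Arr.ctorIdx_injective.eq_iff]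
  refine ⟨?_, h2⟩
  subst h2
  exact Nat.eq_of_mul_eq_mul_right hM (by omega)

theorem Rel.setTemp {l : State} {σ : HState} (h : Rel M W l σ) (t v : ℕ) :
    Rel M W (l.setReg (3 * t + 2) v) σ where
  reg x := by
    rw [← h.reg x]; exact Function.update_of_ne (by omega) _ _
  base a := by
    rw [← h.base a]; exact Function.update_of_ne (by omega) _ _
  mem := h.mem
  reg_lt := h.reg_lt
  arr_lt := h.arr_lt

theorem Ex.compile_spec (hW : numArr * M ≤ W) (e : Ex) (t : ℕ) (l : State) (σ : HState)
    (hr : Rel M W l σ) (hok : e.ok M W σ) :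
    ∃ l', Exec (numArr * M) W (e.compile t) l e.size l' ∧ Rel M W l' σ ∧
      l'.reg (3 * t + 2) = e.eval σ ∧ (∀ s < t, l'.reg (3 * s + 2) = l.reg (3 * s + 2)) ∧
      e.eval σ < W := by
  induction e generalizing t l with
  | c k =>
    exact ⟨_, .const _ _ _ hok, hr.setTemp _ _, Function.update_self .., fun s hs =>
      Function.update_of_ne (by omega) _ _, hok⟩
  | v x =>
    have hx := hr.reg x
    have hl := hr.reg_lt x
    exact ⟨_, .copy _ _ _ (by omega), hr.setTemp _ _, by
      simp [State.setReg, hx], fun s hs => Function.update_of_ne (by omega) _ _, hl⟩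
  | rd a e ih =>
    obtain ⟨l₁, h₁, r₁, v₁, f₁, b₁⟩ := ih t l hr hok.1
    have ha := addr_lt a hok.2
    have e1 : l₁.reg (3 * a.ctorIdx + 1) + l₁.reg (3 * t + 2) = a.ctorIdx * M + e.eval σ := by
      rw [r₁.base, v₁]
    have h2 := Exec.add (S := numArr * M) (W := W) l₁ (3 * t + 2) (3 * a.ctorIdx + 1) (3 * t + 2)
      (by omega)
    set l₂ := l₁.setReg (3 * t + 2) (l₁.reg (3 * a.ctorIdx + 1) + l₁.reg (3 * t + 2)) with hl₂
    have r₂ : Rel M W l₂ σ := r₁.setTemp _ _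
    have v₂ : l₂.reg (3 * t + 2) = a.ctorIdx * M + e.eval σ := by
      rw [← e1]; exact Function.update_self ..
    have m₂ : l₂.mem (l₂.reg (3 * t + 2)) = σ.arr a (e.eval σ) := by
      rw [v₂]; exact r₂.mem a _ hok.2
    have hlt := r₂.arr_lt a _ hok.2
    have h3 := Exec.load (S := numArr * M) (W := W) l₂ (3 * t + 2) (3 * t + 2) (by omega) (by omega)
    refine ⟨_, .seq _ _ _ _ _ _ _ h₁ (.seq _ _ _ _ _ _ _ h2 h3), r₂.setTemp _ _, ?_, ?_, hlt⟩
    · rw [m₂]; exact Function.update_self ..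
    · intro s hs
      rw [← f₁ s hs]
      exact (Function.update_of_ne (by omega) _ _).trans (Function.update_of_ne (by omega) _ _)
  | plus e f ihe ihf =>
    obtain ⟨l₁, h₁, r₁, v₁, f₁, b₁⟩ := ihe t l hr hok.1
    obtain ⟨l₂, h₂, r₂, v₂, f₂, b₂⟩ := ihf (t + 1) l₁ r₁ hok.2.1
    have e1 := f₂ t (by omega)
    have hb : e.eval σ + f.eval σ < W := hok.2.2
    refine ⟨_,
      .seq _ _ _ _ _ _ _ h₁ (.seq _ _ _ _ _ _ _ h₂ (.add _ _ _ _ ?_)),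
      r₂.setTemp _ _, ?_, ?_, hb⟩
    · rw [e1, v₁, v₂]; exact hb
    · rw [e1, v₁, v₂]; exact Function.update_self ..
    · intro s hs
      rw [← f₁ s hs, ← f₂ s (by omega)]
      exact Function.update_of_ne (by omega) _ _
  | minus e f ihe ihf =>
    obtain ⟨l₁, h₁, r₁, v₁, f₁, b₁⟩ := ihe t l hr hok.1
    obtain ⟨l₂, h₂, r₂, v₂, f₂, b₂⟩ := ihf (t + 1) l₁ r₁ hok.2
    have e1 := f₂ t (by omega)
    have hb : e.eval σ - f.eval σ < W := by omega
    refine ⟨_,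
      .seq _ _ _ _ _ _ _ h₁ (.seq _ _ _ _ _ _ _ h₂ (.sub _ _ _ _ ?_)),
      r₂.setTemp _ _, ?_, ?_, hb⟩
    · rw [e1, v₁, v₂]; exact hb
    · rw [e1, v₁, v₂]; exact Function.update_self ..
    · intro s hs
      rw [← f₁ s hs, ← f₂ s (by omega)]
      exact Function.update_of_ne (by omega) _ _

theorem Bx.compile_spec (hW : numArr * M ≤ W) (b : Bx) (l : State) (σ : HState)
    (hr : Rel M W l σ) (hok : b.ok M W σ) :
    ∃ l', Exec (numArr * M) W b.compile l b.size l' ∧ Rel M W l' σ ∧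
      (b.test.holds l' ↔ b.holds σ) := by
  cases b with
  | lt e f =>
    obtain ⟨l₁, h₁, r₁, v₁, f₁, b₁⟩ := e.compile_spec hW 0 l σ hr hok.1
    obtain ⟨l₂, h₂, r₂, v₂, f₂, b₂⟩ := f.compile_spec hW 1 l₁ σ r₁ hok.2
    refine ⟨l₂, .seq _ _ _ _ _ _ _ h₁ h₂, r₂, ?_⟩
    have := f₂ 0 (by omega)
    simp only [Nat.mul_zero, Nat.zero_add, Nat.mul_one] at *
    simp only [Bx.test, Test.holds, Bx.holds, this, v₁, v₂]
  | eq e f =>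
    obtain ⟨l₁, h₁, r₁, v₁, f₁, b₁⟩ := e.compile_spec hW 0 l σ hr hok.1
    obtain ⟨l₂, h₂, r₂, v₂, f₂, b₂⟩ := f.compile_spec hW 1 l₁ σ r₁ hok.2
    refine ⟨l₂, .seq _ _ _ _ _ _ _ h₁ h₂, r₂, ?_⟩
    have := f₂ 0 (by omega)
    simp only [Nat.mul_zero, Nat.zero_add, Nat.mul_one] at *
    simp only [Bx.test, Test.holds, Bx.holds, this, v₁, v₂]

/-- Soundness of compilation. As loops are the only source of repetition, the number of steps is at
most the size of the command times the number of iterations plus one. -/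
theorem Com.compile_spec (hW : numArr * M ≤ W) (p : Com) (Q : HState → Prop) (l : State)
    (σ : HState) (hr : Rel M W l σ) (h : wp M W p Q σ) :
    ∃ t l' τ, Exec (numArr * M) W p.compile l t l' ∧ Rel M W l' τ ∧ Q τ ∧ σ.clk ≤ τ.clk ∧
      t + p.size * σ.clk ≤ p.size * (τ.clk + 1) := by
  induction p generalizing Q l σ with
  | set x e =>
    obtain ⟨l₁, h₁, r₁, v₁, -, b₁⟩ := e.compile_spec hW 0 l σ hr h.1
    simp only [Nat.mul_zero, Nat.zero_add] at v₁
    refine ⟨_, _, _, .seq _ _ _ _ _ _ _ h₁ (.copy _ _ _ (by omega)), ⟨?_, ?_, ?_, ?_, ?_⟩, h.2,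
      le_rfl, by simp only [Com.size, HState.clk_set]; linarith⟩
    · intro y
      rw [v₁]
      simp only [State.setReg, Function.update_apply, HState.reg_set]
      by_cases hy : y = x
      · simp [hy]
      · have : y.ctorIdx ≠ x.ctorIdx := fun h => hy (Var.ctorIdx_injective h)
        rw [if_neg (by omega), if_neg hy, r₁.reg]
    · intro a
      rw [← r₁.base a]
      exact Function.update_of_ne (by omega) _ _
    · exact r₁.mem
    · intro y
      have := r₁.reg_lt y
      simp only [HState.reg_set]
      split_ifs <;> omega
    · exact r₁.arr_lt
  | put a e f =>
    obtain ⟨ho, hof, hi, hQ⟩ := h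
    obtain ⟨l₁, h₁, r₁, v₁, -, b₁⟩ := e.compile_spec hW 0 l σ hr ho
    obtain ⟨l₂, h₂, r₂, v₂, f₂, b₂⟩ := f.compile_spec hW 1 l₁ σ r₁ hof
    have e2 := f₂ 0 (by omega)
    simp only [Nat.mul_zero, Nat.zero_add, Nat.mul_one] at v₁ v₂ e2
    have ha := addr_lt a hi
    have e3 : l₂.reg (3 * a.ctorIdx + 1) + l₂.reg 2 = a.ctorIdx * M + e.eval σ := by
      rw [r₂.base, e2, v₁]
    have h3 := Exec.add (S := numArr * M) (W := W) l₂ 2 (3 * a.ctorIdx + 1) 2 (by omega)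
    rw [e3] at h3
    set l₃ := l₂.setReg 2 (a.ctorIdx * M + e.eval σ) with hl₃
    have r₃ : Rel M W l₃ σ := r₂.setTemp 0 _
    have v₃ : l₃.reg 2 = a.ctorIdx * M + e.eval σ := by simp [hl₃, State.setReg]
    have w₃ : l₃.reg 5 = f.eval σ := by
      rw [← v₂]; simp [hl₃, State.setReg]
    have h4 := Exec.store (S := numArr * M) (W := W) l₃ 2 5 (by rw [v₃]; omega) (by rw [w₃]; omega)
    rw [v₃, w₃] at h4
    refine ⟨_, _, σ.put a (e.eval σ) (f.eval σ),
      .seq _ _ _ _ _ _ _ h₁ (.seq _ _ _ _ _ _ _ h₂ (.seq _ _ _ _ _ _ _ h3 h4)),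
      ⟨r₃.reg, r₃.base, ?_, r₃.reg_lt, ?_⟩, hQ, le_rfl,
      by simp only [Com.size, HState.clk_put]; linarith⟩
    · intro b j hj
      simp only [State.setMem, Function.update_apply, HState.arr_put]
      by_cases hba : b = a
      · subst hba
        by_cases hje : j = e.eval σ
        · simp [hje]
        · rw [if_neg (by omega), if_pos rfl, Function.update_of_ne hje, r₃.mem b j hj]
      · rw [if_neg fun h => hba (addr_inj hj hi h).1, if_neg hba, r₃.mem b j hj]
    · intro b j hj
      have h1 := r₃.arr_lt b j hj
      simp only [HState.arr_put]
      split_ifs with hba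
      · subst hba
        simp only [Function.update_apply]
        split_ifs <;> omega
      · exact h1
  | seq p q ihp ihq =>
    obtain ⟨t, l₁, σ₁, h₁, r₁, q₁, c₁, b₁⟩ := ihp _ l σ hr h
    obtain ⟨u, l₂, σ₂, h₂, r₂, q₂, c₂, b₂⟩ := ihq _ l₁ σ₁ r₁ q₁
    refine ⟨_, _, _, .seq _ _ _ _ _ _ _ h₁ h₂, r₂, q₂, c₁.trans c₂, ?_⟩
    simp only [Com.size]
    have := Nat.mul_le_mul_left p.size c₂
    have := Nat.mul_le_mul_left q.size c₁
    linarith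
  | ite b p q ihp ihq =>
    obtain ⟨l₀, h₀, r₀, b₀⟩ := b.compile_spec hW l σ hr h.1
    by_cases hb : b.holds σ
    · obtain ⟨t, l₁, σ₁, h₁, r₁, q₁, c₁, b₁⟩ := ihp _ l₀ σ r₀ (h.2.1 hb)
      refine ⟨_, _, _, .seq _ _ _ _ _ _ _ h₀ (.ite_true _ _ _ _ _ _ (b₀.2 hb) h₁), r₁, q₁, c₁, ?_⟩
      simp only [Com.size]
      have := Nat.mul_le_mul_left (b.size + 1) c₁
      have := Nat.mul_le_mul_left q.size c₁
      linarith
    · obtain ⟨t, l₁, σ₁, h₁, r₁, q₁, c₁, b₁⟩ := ihq _ l₀ σ r₀ (h.2.2 hb)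
      refine ⟨_, _, _, .seq _ _ _ _ _ _ _ h₀ (.ite_false _ _ _ _ _ _ (fun h => hb (b₀.1 h)) h₁),
        r₁, q₁, c₁, ?_⟩
      simp only [Com.size]
      have := Nat.mul_le_mul_left (b.size + 1) c₁
      have := Nat.mul_le_mul_left p.size c₁
      linarith
  | loop b p ih =>
    obtain ⟨I, μ, h0, hI⟩ := h
    obtain ⟨l₀, h₀, r₀, b₀⟩ := b.compile_spec hW l σ hr (hI σ h0).1
    -- The test is evaluated before the loop, and again at the end of each iteration.
    suffices H : ∀ m l σ, μ σ = m → I σ → Rel M W l σ → (b.test.holds l ↔ b.holds σ) →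
        ∃ t l' τ, Exec (numArr * M) W (.while b.test (.seq p.compile b.compile)) l t l' ∧
          Rel M W l' τ ∧ Q τ ∧ σ.clk ≤ τ.clk ∧
          t + (b.size + 1 + p.size) * σ.clk ≤ (b.size + 1 + p.size) * τ.clk + 1 by
      obtain ⟨t, l₁, σ₁, h₁, r₁, q₁, c₁, b₁⟩ := H _ l₀ σ rfl h0 r₀ b₀
      refine ⟨_, _, _, .seq _ _ _ _ _ _ _ h₀ h₁, r₁, q₁, c₁, ?_⟩
      simp only [Com.size]
      linarith
    -- Each iteration pays for its body and the next test with the tick of the clock at its start.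
    intro m
    induction m using Nat.strong_induction_on with
    | _ m ihm =>
    intro l σ hm hσ hr hb
    by_cases hbσ : b.holds σ
    · obtain ⟨t, l₁, σ₁, h₁, r₁, q₁, c₁, b₁⟩ := ih _ l σ.tick
        ⟨hr.reg, hr.base, hr.mem, hr.reg_lt, hr.arr_lt⟩ ((hI σ hσ).2.1 hbσ)
      obtain ⟨l₂, h₂, r₂, b₂⟩ := b.compile_spec hW l₁ σ₁ r₁ (hI σ₁ q₁.1).1
      obtain ⟨u, l₃, σ₃, h₃, r₃, q₃, c₃, b₃⟩ := ihm _ (hm ▸ q₁.2) l₂ σ₁ rfl q₁.1 r₂ b₂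
      simp only [HState.clk_tick] at c₁ b₁
      refine ⟨_, _, _, .while_true _ _ _ _ _ _ _ (hb.2 hbσ) (.seq _ _ _ _ _ _ _ h₁ h₂) h₃, r₃, q₃,
        by omega, ?_⟩
      have := Nat.mul_le_mul_left (b.size + 1) c₁
      linarith
    · exact ⟨1, l, σ, .while_false _ _ _ (fun h => hbσ (hb.1 h)), hr, (hI σ hσ).2.2 hbσ, le_rfl,
        by linarith⟩
  | nop => exact ⟨_, _, _, .skip _, hr, h, le_rfl, by simp only [Com.size]; linarith⟩

end Soundness

/-! ### Lists in arrays -/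

/-- The array `a` holds the list `l` from index `s` on. -/
def Seg (a : ℕ → ℕ) (s : ℕ) (l : List ℕ) : Prop := ∀ (j : ℕ) (h : j < l.length), a (s + j) = l[j]

theorem Seg.nil (a : ℕ → ℕ) (s : ℕ) : Seg a s [] := fun j h => absurd h (by simp)

theorem seg_cons {a : ℕ → ℕ} {s x : ℕ} {l : List ℕ} :
    Seg a s (x :: l) ↔ a s = x ∧ Seg a (s + 1) l := by
  constructor
  · intro h
    refine ⟨h 0 (by simp), fun j hj => ?_⟩
    have := h (j + 1) (by simpa using hj)
    rw [show s + 1 + j = s + (j + 1) by ring]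
    simpa using this
  · rintro ⟨h0, h⟩ (_ | j) hj
    · simpa using h0
    · have := h j (by simpa using hj)
      rw [show s + (j + 1) = s + 1 + j by ring]
      simpa using this

theorem seg_append {a : ℕ → ℕ} {s : ℕ} {l l' : List ℕ} :
    Seg a s (l ++ l') ↔ Seg a s l ∧ Seg a (s + l.length) l' := by
  induction l generalizing s with
  | nil => simp [Seg.nil]
  | cons x l ih =>
    rw [List.cons_append, seg_cons, seg_cons, ih, and_assoc, List.length_cons,
      show s + 1 + l.length = s + (l.length + 1) by ring]

theorem Seg.congr {a b : ℕ → ℕ} {s : ℕ} {l : List ℕ} (h : Seg a s l)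
    (hab : ∀ j < l.length, b (s + j) = a (s + j)) : Seg b s l :=
  fun j hj => (hab j hj).trans (h j hj)

/-- Writing outside of a segment. -/
theorem Seg.update {a : ℕ → ℕ} {s i v : ℕ} {l : List ℕ} (h : Seg a s l)
    (hi : i < s ∨ s + l.length ≤ i) : Seg (Function.update a i v) s l :=
  h.congr fun j hj => Function.update_of_ne (by omega) _ _

/-- Writing directly after a segment. -/
theorem Seg.push {a : ℕ → ℕ} {s i v : ℕ} {l : List ℕ} (h : Seg a s l) (hi : i = s + l.length) :
    Seg (Function.update a i v) s (l ++ [v]) := by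
  rw [seg_append, seg_cons]
  exact ⟨h.update (by omega), by rw [hi]; simp, Seg.nil _ _⟩

theorem Seg.flatten {a : ℕ → ℕ} {f : ℕ → List ℕ} {n s : ℕ}
    (h : Seg a s ((List.range n).map f).flatten) {i : ℕ} (hi : i < n) :
    Seg a (s + ∑ j ∈ Finset.range i, (f j).length) (f i) := by
  induction n with
  | zero => omega
  | succ n ih =>
    rw [List.range_succ, List.map_append, List.flatten_append, seg_append] at h
    rcases Nat.lt_succ_iff_lt_or_eq.1 hi with hi | rfl
    · exact ih h.1 hi
    · have h2 := h.2
      simp only [List.map_cons, List.map_nil, List.flatten_cons, List.flatten_nil,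
        List.append_nil, List.length_flatten, List.map_map] at h2
      convert h2 using 2
      rw [Finset.sum_range]
      simp [List.sum_range_succ, Finset.sum_range, ← List.sum_ofFn, List.ofFn_eq_map,
        List.map_map, Function.comp_def, ← List.map_coe_finRange_eq_range]

/-! ### Families of linked lists -/

/-- `h` is the head of a linked list with entries `l`, whose nodes are among `1, …, f`. The
successor of a node is given by `nx`, its entry by `vl`, and `0` stands for the empty list. -/
def Chain (nx vl : ℕ → ℕ) (f : ℕ) : ℕ → List ℕ → Prop
  | h, [] => h = 0
  | h, x :: l => 0 < h ∧ h ≤ f ∧ vl h = x ∧ Chain nx vl f (nx h) l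

theorem Chain.update {nx vl : ℕ → ℕ} {f h : ℕ} {l : List ℕ} (H : Chain nx vl f h l) (a b : ℕ) :
    Chain (Function.update nx (f + 1) a) (Function.update vl (f + 1) b) (f + 1) h l := by
  induction l generalizing h with
  | nil => exact H
  | cons x l ih =>
    obtain ⟨h0, hf, hv, hc⟩ := H
    refine ⟨h0, by omega, ?_, ?_⟩
    · rw [Function.update_of_ne (by omega), hv]
    · rw [Function.update_of_ne (by omega)]
      exact ih hc

/-- The linked lists with heads `hd k` have the entries `bk k`. -/
def Buckets (nx vl hd : ℕ → ℕ) (f : ℕ) (bk : ℕ → List ℕ) : Prop :=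
  ∀ k, Chain nx vl f (hd k) (bk k)

theorem Buckets.push {nx vl hd : ℕ → ℕ} {f : ℕ} {bk : ℕ → List ℕ} (H : Buckets nx vl hd f bk)
    (k x : ℕ) : Buckets (Function.update nx (f + 1) (hd k)) (Function.update vl (f + 1) x)
      (Function.update hd k (f + 1)) (f + 1) (Function.update bk k (x :: bk k)) := by
  intro k'
  by_cases hk : k' = k
  · subst hk
    simp only [Function.update_self]
    exact ⟨by omega, le_rfl, by simp, by simpa using (H k').update _ _⟩
  · simp only [Function.update_of_ne hk]
    exact (H k').update _ _

theorem Buckets.pop {nx vl hd : ℕ → ℕ} {f : ℕ} {bk : ℕ → List ℕ} (H : Buckets nx vl hd f bk)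
    {k x : ℕ} {l : List ℕ} (h : bk k = x :: l) :
    Buckets nx vl (Function.update hd k (nx (hd k))) f (Function.update bk k l) := by
  intro k'
  by_cases hk : k' = k
  · subst hk
    simp only [Function.update_self]
    have := H k'
    rw [h] at this
    exact this.2.2.2
  · simp only [Function.update_of_ne hk]
    exact H k'

theorem Buckets.eq_nil {nx vl hd : ℕ → ℕ} {f : ℕ} {bk : ℕ → List ℕ} (H : Buckets nx vl hd f bk)
    {k : ℕ} (h : hd k = 0) : bk k = [] := by
  have := H k
  cases hb : bk k with
  | nil => rfl
  | cons x l =>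
    rw [hb] at this
    exact absurd this.1 (by omega)

theorem Buckets.eq_cons {nx vl hd : ℕ → ℕ} {f : ℕ} {bk : ℕ → List ℕ} (H : Buckets nx vl hd f bk)
    {k : ℕ} (h : hd k ≠ 0) : hd k ≤ f ∧ ∃ l, bk k = vl (hd k) :: l := by
  have := H k
  cases hb : bk k with
  | nil =>
    rw [hb] at this
    exact absurd this h
  | cons x l =>
    rw [hb] at this
    exact ⟨this.2.1, l, by rw [this.2.2.1]⟩

theorem Buckets.nil (nx vl : ℕ → ℕ) (f : ℕ) : Buckets nx vl (fun _ => 0) f fun _ => [] :=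
  fun _ => rfl

/-- The total length of a family of lists after one of them has been changed. -/
theorem sum_length_update (bk : ℕ → List ℕ) {n k : ℕ} (hk : k < n) (l : List ℕ) :
    ∑ i ∈ Finset.range n, (Function.update bk k l i).length + (bk k).length =
      ∑ i ∈ Finset.range n, (bk i).length + l.length := by
  have hk' := Finset.mem_range.2 hk
  rw [← Finset.add_sum_erase _ _ hk', ← Finset.add_sum_erase _ (fun i => (bk i).length) hk',
    Function.update_self]
  have : ∑ i ∈ (Finset.range n).erase k, (Function.update bk k l i).length =
      ∑ i ∈ (Finset.range n).erase k, (bk i).length :=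
    Finset.sum_congr rfl fun i hi => by rw [Function.update_of_ne (Finset.ne_of_mem_erase hi)]
  omega

/-! ### The input -/

/-- `N` lists the neighbours of every vertex of the graph `H`, whose vertices that are not
isolated are among `0, …, n - 1`. -/
structure IsInput (n : ℕ) (H : SimpleGraph ℕ) (N : ℕ → List ℕ) : Prop where
  lt : ∀ {i j}, H.Adj i j → i < n
  nodup : ∀ i < n, (N i).Nodup
  mem : ∀ i < n, ∀ j, j ∈ N i ↔ H.Adj i j

/-- The address of the adjacency list of the vertex `i`. -/
def start (n : ℕ) (N : ℕ → List ℕ) (i : ℕ) : ℕ := 1 + n + ∑ j ∈ Finset.range i, (N j).length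

theorem start_succ (n : ℕ) (N : ℕ → List ℕ) (i : ℕ) :
    start n N (i + 1) = start n N i + (N i).length := by
  simp only [start, Finset.sum_range_succ]; ring

theorem start_mono (n : ℕ) (N : ℕ → List ℕ) : Monotone (start n N) :=
  monotone_nat_of_le_succ fun i => by rw [start_succ]; omega

theorem start_add_le {n : ℕ} (N : ℕ → List ℕ) {i k : ℕ} (hi : i < k) :
    start n N i + (N i).length ≤ start n N k := by
  rw [← start_succ]; exact start_mono n N hi

theorem IsInput.length_lt {n : ℕ} {H : SimpleGraph ℕ} {N : ℕ → List ℕ} (h : IsInput n H N)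
    {i : ℕ} (hi : i < n) : (N i).length < n := by
  have h1 : (N i).toFinset ⊆ (Finset.range n).erase i := fun j hj => by
    have := (h.mem i hi j).1 (List.mem_toFinset.1 hj)
    exact Finset.mem_erase.2 ⟨this.ne', Finset.mem_range.2 (h.lt this.symm)⟩
  have h2 := Finset.card_le_card h1
  rw [List.toFinset_card_of_nodup (h.nodup i hi), Finset.card_erase_of_mem (Finset.mem_range.2 hi),
    Finset.card_range] at h2
  omega

/-- The input array and the table of the addresses of the adjacency lists. -/
structure Base (n : ℕ) (N : ℕ → List ℕ) (σ : HState) : Prop where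
  reg_n : σ.reg .n = n
  len : ∀ i < n, σ.arr .inp (i + 1) = (N i).length
  seg : ∀ i < n, Seg (σ.arr .inp) (start n N i) (N i)
  off : ∀ i < n, σ.arr .off i = start n N i

theorem Base.congr {n : ℕ} {N : ℕ → List ℕ} {σ τ : HState} (h : Base n N σ)
    (h1 : τ.reg .n = σ.reg .n) (h2 : τ.arr .inp = σ.arr .inp) (h3 : τ.arr .off = σ.arr .off) :
    Base n N τ :=
  ⟨h1.trans h.reg_n, h2 ▸ h.len, h2 ▸ h.seg, h3 ▸ h.off⟩

theorem Base.frame {n : ℕ} {N : ℕ → List ℕ} {σ τ : HState} (h : Base n N σ) {p : Com}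
    (hf : Frame p σ τ) (h1 : .n ∉ p.vars) (h2 : .inp ∉ p.arrs) (h3 : .off ∉ p.arrs) :
    Base n N τ :=
  h.congr (hf.reg _ h1) (hf.arr _ h2) (hf.arr _ h3)

infixr:65 " ;; " => Com.seq

/-- Read the number of vertices, compute the addresses of the adjacency lists, and sort the
vertices by degree into buckets. -/
def setup : Com :=
  .set .n (.rd .inp (.c 0)) ;;
  .set .o (.plus (.v .n) (.c 1)) ;;
  .set .i (.c 0) ;; .set .f (.c 0) ;;
  .upto .i (.v .n) (
    .put .off (.v .i) (.v .o) ;;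
    .set .x (.rd .inp (.plus (.v .i) (.c 1))) ;;
    .put .deg (.v .i) (.v .x) ;;
    .set .o (.plus (.v .o) (.v .x)) ;;
    .set .f (.plus (.v .f) (.c 1)) ;;
    .put .vl (.v .f) (.v .i) ;;
    .put .nx (.v .f) (.rd .hd (.v .x)) ;;
    .put .hd (.v .x) (.v .f))

theorem setup_spec {n M W : ℕ} {H : SimpleGraph ℕ} {N : ℕ → List ℕ} (hin : IsInput n H N)
    (hM : 4 * start n N n ≤ M) (hW : 8 * M ≤ W) {σ : HState}
    (h0 : ∀ a, a ≠ .inp → σ.arr a = fun _ => 0) (hc : σ.clk = 0)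
    (hinp : Seg (σ.arr .inp) 0 (encodeLists ((List.range n).map N))) :
    wp M W setup (fun τ => Base n N τ ∧ τ.clk = n ∧ (∀ i < n, τ.arr .deg i = (N i).length) ∧
      τ.reg .f = n ∧ ∃ bk, Buckets (τ.arr .nx) (τ.arr .vl) (τ.arr .hd) n bk ∧
        (∀ i < n, i ∈ bk (N i).length) ∧ (∀ k, ∀ i ∈ bk k, i < n) ∧
        ∑ k ∈ Finset.range n, (bk k).length = n) σ := by
  simp only [encodeLists, seg_cons, seg_append, List.length_map, List.length_range] at hinp
  obtain ⟨hn, hlen, hseg⟩ := hinp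
  have hlen : ∀ i < n, σ.arr .inp (i + 1) = (N i).length := fun i hi => by
    have := hlen i (by simpa using hi)
    rw [add_comm]
    simpa using this
  have hseg : ∀ i < n, Seg (σ.arr .inp) (start n N i) (N i) := fun i hi => by
    have := hseg.flatten hi
    simpa [start] using this
  have hst : ∀ i, i ≤ n → start n N i ≤ start n N n := fun i hi => start_mono n N hi
  have hs0 : start n N 0 = 1 + n := by simp [start]
  have := hst 0 (Nat.zero_le _)
  simp only [setup, wp_eqs, reduceCtorEq, if_true, if_false, true_and, and_true, hn]
  refine ⟨⟨by omega, by omega⟩, ⟨by omega, by omega⟩, by omega, by omega, ?_⟩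
  refine wp_upto (fun i τ => τ.clk = i ∧ τ.reg .n = n ∧ τ.reg .o = start n N i ∧ τ.reg .f = i ∧
      (∀ j < i, τ.arr .off j = start n N j) ∧ (∀ j < i, τ.arr .deg j = (N j).length) ∧
      ∃ bk, Buckets (τ.arr .nx) (τ.arr .vl) (τ.arr .hd) i bk ∧
        (∀ j < i, j ∈ bk (N j).length) ∧ (∀ k, ∀ j ∈ bk k, j < i) ∧
        ∑ k ∈ Finset.range n, (bk k).length = i) n (by decide) (by omega) (by simp) ?_ ?_ ?_ ?_
  · simp [hc, hs0, h0, add_comm n 1]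
    exact ⟨fun _ => [], Buckets.nil _ _ _, by simp, by simp⟩
  · rintro τ - - ⟨-, h, -⟩
    exact ⟨trivial, h⟩
  · rintro τ hf - hi ⟨h1, h2, h3, h4, h5, h6, bk, h7, h8, h9, h10⟩
    have hinp : τ.arr .inp = σ.arr .inp := by rw [hf.arr _ (by decide)]; rfl
    have hl := hin.length_lt hi
    have hs := start_succ n N (τ.reg .i)
    have : start n N (τ.reg .i + 1) ≤ start n N n := hst _ hi
    simp only [wp_eqs, reduceCtorEq, if_true, if_false, true_and, and_true, h1, h2, h3, h4, hinp,
      hlen _ hi]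
    have e := sum_length_update bk hl (τ.reg .i :: bk (N (τ.reg .i)).length)
    rw [h10, List.length_cons] at e
    refine ⟨by omega, ⟨⟨by omega, by omega⟩, by omega⟩, by omega, by omega, ⟨by omega, by omega⟩,
      by omega, by omega, by omega, by omega, by omega, ?_, ?_, _, h7.push _ _, ?_, ?_, ?_⟩
    · intro j hj
      rcases Nat.lt_succ_iff_lt_or_eq.1 hj with hj | rfl
      · rw [Function.update_of_ne (by omega), h5 j hj]
      · simp
    · intro j hj
      rcases Nat.lt_succ_iff_lt_or_eq.1 hj with hj | rfl
      · rw [Function.update_of_ne (by omega), h6 j hj]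
      · simp
    · intro j hj
      rcases Nat.lt_succ_iff_lt_or_eq.1 hj with hj | rfl
      · have := h8 j hj
        simp only [Function.update_apply]
        split_ifs with h
        · exact List.mem_cons_of_mem _ (h ▸ this)
        · exact this
      · simp
    · intro k j hj
      simp only [Function.update_apply] at hj
      split_ifs at hj with h
      · rcases List.mem_cons.1 hj with rfl | hj
        · omega
        · have := h9 _ j hj; omega
      · have := h9 _ j hj; omega
    · omega
  · rintro τ hf - ⟨h1, h2, h3, h4, h5, h6, h7⟩
    have hinp : τ.arr .inp = σ.arr .inp := by rw [hf.arr _ (by decide)]; rfl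
    exact ⟨⟨h2, by rwa [hinp], by rwa [hinp], h5⟩, h1, h6, h4, h7⟩

/-! ### Smallest-last orders -/

open Classical in
/-- The number of neighbours of `i` in `s`. -/
noncomputable def degIn (H : SimpleGraph ℕ) (s : Finset ℕ) (i : ℕ) : ℕ :=
  (s.filter fun j => H.Adj i j).card

open Classical in
theorem degIn_erase (H : SimpleGraph ℕ) {s : Finset ℕ} {x : ℕ} (hx : x ∈ s) (i : ℕ) :
    degIn H s i = degIn H (s.erase x) i + if H.Adj i x then 1 else 0 := by
  unfold degIn
  rw [Finset.filter_erase]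
  split_ifs with h
  · rw [Finset.card_erase_add_one (Finset.mem_filter.2 ⟨hx, h⟩)]
  · rw [Finset.erase_eq_of_notMem (by simp [h]), add_zero]

theorem degIn_lt (H : SimpleGraph ℕ) {n i : ℕ} {s : Finset ℕ} (hs : s ⊆ Finset.range n)
    (hi : i < n) : degIn H s i < n := by
  classical
  have h1 : s.filter (fun j => H.Adj i j) ⊆ (Finset.range n).erase i := fun j hj => by
    have := Finset.mem_filter.1 hj
    exact Finset.mem_erase.2 ⟨this.2.ne', hs this.1⟩
  have h2 := Finset.card_le_card h1
  rw [Finset.card_erase_of_mem (Finset.mem_range.2 hi), Finset.card_range] at h2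
  unfold degIn
  omega

/-- The vertices below `n` whose entry of `pos` is at most `c`. -/
def below (n : ℕ) (pos : ℕ → ℕ) (c : ℕ) : Finset ℕ := (Finset.range n).filter fun i => pos i ≤ c

theorem mem_below {n c i : ℕ} {pos : ℕ → ℕ} : i ∈ below n pos c ↔ i < n ∧ pos i ≤ c := by
  simp [below]

theorem below_update {n c d x p : ℕ} {pos : ℕ → ℕ} (hx : pos x ≤ p) (hc : c ≤ p) (hd : d = p) :
    below n (Function.update pos x c) d = below n pos p := by
  subst hd
  ext i
  rw [mem_below, mem_below, Function.update_apply]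
  split_ifs with h
  · subst h; exact and_congr_right fun _ => iff_of_true hc hx
  · rfl

theorem below_update_zero {n c x : ℕ} {pos : ℕ → ℕ} (hc : 0 < c) :
    below n (Function.update pos x c) 0 = (below n pos 0).erase x := by
  ext i
  rw [mem_below, Finset.mem_erase, mem_below, Function.update_apply]
  split_ifs with h
  · subst h; constructor
    · intro h; omega
    · intro h; exact absurd rfl h.1
  · exact ⟨fun H => ⟨h, H⟩, fun H => H.2⟩

/-- The vertices at the positions `c, …, n - 1` of a smallest-last order have been determined:
`ord` lists them, `pos` gives the positions plus one, and `0` for the other vertices, and every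
determined vertex has minimum degree among the vertices that do not come after it. -/
structure IsOrder (n : ℕ) (H : SimpleGraph ℕ) (pos ord : ℕ → ℕ) (c : ℕ) : Prop where
  card : (below n pos 0).card = c
  ord_pos : ∀ i < n, pos i ≠ 0 → c < pos i ∧ pos i ≤ n ∧ ord (pos i - 1) = i
  pos_ord : ∀ p, c ≤ p → p < n → ord p < n ∧ pos (ord p) = p + 1
  min : ∀ p, c ≤ p → p < n → ∀ y ∈ below n pos (p + 1),
    degIn H (below n pos (p + 1)) (ord p) ≤ degIn H (below n pos (p + 1)) y

/-- A vertex of minimum degree among the remaining ones is put at the last free position. -/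
theorem IsOrder.remove {n : ℕ} {H : SimpleGraph ℕ} {pos ord : ℕ → ℕ} {c x : ℕ}
    (h : IsOrder n H pos ord c) (hx : x < n) (hp : pos x = 0)
    (hmin : ∀ y ∈ below n pos 0, degIn H (below n pos 0) x ≤ degIn H (below n pos 0) y) :
    IsOrder n H (Function.update pos x c) (Function.update ord (c - 1) x) (c - 1) := by
  have hx0 : x ∈ below n pos 0 := mem_below.2 ⟨hx, hp.le⟩
  have hc : 0 < c := by rw [← h.card]; exact Finset.card_pos.2 ⟨x, hx0⟩
  have hcn : c ≤ n := by
    rw [← h.card]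
    exact (Finset.card_le_card (Finset.filter_subset _ _)).trans (by simp)
  refine ⟨?_, ?_, ?_, ?_⟩
  · rw [below_update_zero hc, Finset.card_erase_of_mem hx0, h.card]
  · intro i hi
    by_cases hix : i = x
    · subst hix
      simp only [Function.update_self]
      exact fun _ => ⟨by omega, hcn, trivial⟩
    · rw [Function.update_of_ne hix]
      intro h0
      have := h.ord_pos i hi h0
      exact ⟨by omega, this.2.1, by rw [Function.update_of_ne (by omega)]; exact this.2.2⟩
  · intro p hcp hpn
    by_cases hpc : p = c - 1
    · subst hpc
      simp only [Function.update_self]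
      exact ⟨hx, by omega⟩
    · rw [Function.update_of_ne hpc]
      have := h.pos_ord p (by omega) hpn
      refine ⟨this.1, ?_⟩
      rw [Function.update_of_ne (by rintro h; rw [h] at this; omega)]
      exact this.2
  · intro p hcp hpn
    -- The set of the vertices that do not come after position `p` is the same as before.
    rw [below_update (by omega) (by omega) rfl]
    by_cases hpc : p = c - 1
    · subst hpc
      have : below n pos (c - 1 + 1) = below n pos 0 := by
        ext i
        rw [mem_below, mem_below]
        refine and_congr_right fun hi => ⟨fun hle => ?_, fun hle => by omega⟩
        by_contra hne
        have := h.ord_pos i hi (by omega)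
        omega
      rw [this]
      simpa using hmin
    · rw [Function.update_of_ne hpc]
      exact h.min p (by omega) hpn

/-- Repeatedly remove a vertex of minimum degree. There is a stack for every degree; a vertex is
pushed onto the stack of its new degree whenever its degree changes, and entries that are out of
date are discarded when they are met. -/
def order : Com :=
  .set .c (.v .n) ;; .set .cur (.c 0) ;;
  .loop (.lt (.c 0) (.v .c)) (
    .set .h (.rd .hd (.v .cur)) ;;
    .ite (.eq (.v .h) (.c 0)) (.set .cur (.plus (.v .cur) (.c 1))) (
      .put .hd (.v .cur) (.rd .nx (.v .h)) ;;
      .set .x (.rd .vl (.v .h)) ;;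
      .ite (.eq (.rd .pos (.v .x)) (.c 0)) (
        .ite (.eq (.rd .deg (.v .x)) (.v .cur)) (
          .put .pos (.v .x) (.v .c) ;;
          .set .c (.minus (.v .c) (.c 1)) ;;
          .put .ord (.v .c) (.v .x) ;;
          .set .cur (.minus (.v .cur) (.c 1)) ;;
          .set .j (.rd .off (.v .x)) ;;
          .set .je (.plus (.v .j) (.rd .inp (.plus (.v .x) (.c 1)))) ;;
          .upto .j (.v .je) (
            .set .y (.rd .inp (.v .j)) ;;
            .ite (.eq (.rd .pos (.v .y)) (.c 0)) (
              .put .deg (.v .y) (.minus (.rd .deg (.v .y)) (.c 1)) ;;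
              .set .z (.rd .deg (.v .y)) ;;
              .set .f (.plus (.v .f) (.c 1)) ;;
              .put .vl (.v .f) (.v .y) ;;
              .put .nx (.v .f) (.rd .hd (.v .z)) ;;
              .put .hd (.v .z) (.v .f)) .nop)) .nop) .nop))

/-- The invariant of `order`. The last bounds are the amortized analysis: an unremoved vertex still
pays for the stack entries that its removal will create, and `cur` can only rise up to `n`. -/
structure OrderInv (n : ℕ) (H : SimpleGraph ℕ) (N : ℕ → List ℕ) (τ : HState)
    (bk : ℕ → List ℕ) : Prop where
  isOrder : IsOrder n H (τ.arr .pos) (τ.arr .ord) (τ.reg .c)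
  buckets : Buckets (τ.arr .nx) (τ.arr .vl) (τ.arr .hd) (τ.reg .f) bk
  bucket_lt : ∀ k, ∀ i ∈ bk k, i < n
  deg : ∀ i ∈ below n (τ.arr .pos) 0, τ.arr .deg i = degIn H (below n (τ.arr .pos) 0) i ∧
    τ.reg .cur ≤ τ.arr .deg i ∧ i ∈ bk (τ.arr .deg i)
  cur_le : τ.reg .cur ≤ n
  nodes : τ.reg .f + ∑ i ∈ below n (τ.arr .pos) 0, (N i).length ≤
    n + ∑ i ∈ Finset.range n, (N i).length
  time : τ.clk + ∑ k ∈ Finset.range n, (bk k).length +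
    ∑ i ∈ below n (τ.arr .pos) 0, (2 * (N i).length + 1) + (n - τ.reg .cur) ≤
      4 * n + 2 * ∑ i ∈ Finset.range n, (N i).length

/-- `order` computes a smallest-last order, in linear time. -/
theorem order_spec {n M W : ℕ} {H : SimpleGraph ℕ} {N : ℕ → List ℕ} (hin : IsInput n H N)
    (hM : 4 * start n N n ≤ M) (hW : 8 * M ≤ W) {σ : HState} (hb : Base n N σ)
    (hc : σ.clk = n) (hdeg : ∀ i < n, σ.arr .deg i = (N i).length) (hf : σ.reg .f = n)
    {bk : ℕ → List ℕ} (hbk : Buckets (σ.arr .nx) (σ.arr .vl) (σ.arr .hd) n bk)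
    (hmem : ∀ i < n, i ∈ bk (N i).length) (hlt : ∀ k, ∀ i ∈ bk k, i < n)
    (hsum : ∑ k ∈ Finset.range n, (bk k).length = n) (hpos : ∀ i, σ.arr .pos i = 0) :
    wp M W order (fun τ => IsOrder n H (τ.arr .pos) (τ.arr .ord) 0 ∧
      τ.clk ≤ 4 * n + 2 * ∑ i ∈ Finset.range n, (N i).length) σ := by
  classical
  have hstn : start n N n = 1 + n + ∑ i ∈ Finset.range n, (N i).length := rfl
  set vol := ∑ i ∈ Finset.range n, (N i).length with hvol
  simp only [order, wp_eqs, reduceCtorEq, if_true, if_false, true_and, and_true]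
  have hbel : below n (σ.arr .pos) 0 = Finset.range n := by
    ext i; simp [mem_below, hpos]
  refine ⟨by omega, wp_loop (fun τ => ∃ bk, OrderInv n H N τ bk)
    (fun τ => 4 * n + 2 * vol - τ.clk) ⟨bk, ?_, ?_, hlt, ?_, ?_, ?_, ?_⟩ ?_ ?_ ?_⟩
  · simp only [wp_eqs, reduceCtorEq, if_true, if_false, true_and, and_true, hb.reg_n]
    refine ⟨by simp [hbel], fun i _ h => absurd (hpos i) h, fun p hp hp' => by omega,
      fun p hp hp' => by omega⟩
  · simpa [hf] using hbk
  · simp only [wp_eqs, reduceCtorEq, if_true, if_false, true_and, and_true, hbel]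
    intro i hi
    have hi := Finset.mem_range.1 hi
    have : degIn H (Finset.range n) i = (N i).length := by
      rw [degIn, ← List.toFinset_card_of_nodup (hin.nodup i hi)]
      congr 1
      ext j
      simp only [Finset.mem_filter, Finset.mem_range, List.mem_toFinset, hin.mem i hi]
      exact ⟨fun h => h.2, fun h => ⟨hin.lt h.symm, h⟩⟩
    rw [hdeg i hi, this]
    exact ⟨rfl, by omega, hmem i hi⟩
  · simp
  · simp [hbel, hf, hvol]
  · simp only [wp_eqs, reduceCtorEq, if_true, if_false, true_and, and_true, hbel,
      Finset.sum_add_distrib, ← Finset.mul_sum, hsum, hc, ← hvol]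
    simp
    omega
  · rintro τ - -
    simp only [Bx.ok, Ex.ok, and_true]
    omega
  · rintro τ ⟨bk, hI⟩ hfr hcτ
    have hB : Base n N τ := hb.congr (by rw [hfr.reg _ (by decide)]; simp)
      (by rw [hfr.arr _ (by decide)]; simp) (by rw [hfr.arr _ (by decide)]; simp)
    obtain ⟨h1, h2, h3, h4, h5, h6, h7⟩ := hI
    simp only [Bx.holds, Ex.eval] at hcτ
    set pos := τ.arr .pos with hposd
    set A := below n pos 0 with hA
    have hAn : A ⊆ Finset.range n := Finset.filter_subset _ _
    have hdl : ∀ i ∈ A, τ.arr .deg i < n := fun i hi => by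
      rw [(h4 i hi).1]; exact degIn_lt H hAn (mem_below.1 hi).1
    have hcn : τ.reg .c ≤ n := by
      rw [← h1.card]; exact (Finset.card_le_card hAn).trans (by simp)
    have hcur : τ.reg .cur < n := by
      obtain ⟨i, hi⟩ := Finset.card_pos.1 (h1.card ▸ hcτ)
      have := h4 i hi
      have := hdl i hi
      omega
    simp only [wp_eqs, reduceCtorEq, if_true, if_false, true_and, and_true]
    refine ⟨by omega, ⟨by omega, fun hh => ?_, fun hh => ?_⟩⟩
    -- The stack is empty: no remaining vertex has degree `cur`, so `cur` can be increased.
    · have hnil := h2.eq_nil hh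
      refine ⟨by omega, ⟨bk, ?_, ?_, h3, ?_, ?_, ?_, ?_⟩, ?_⟩
      · simpa using h1
      · simpa using h2
      · simp only [wp_eqs, reduceCtorEq, if_true, if_false, true_and, and_true, ← hposd, ← hA]
        intro i hi
        have := h4 i hi
        refine ⟨this.1, ?_, this.2.2⟩
        have : τ.arr .deg i ≠ τ.reg .cur := fun h => by rw [h, hnil] at this; simp at this
        omega
      · simpa using hcur
      · simpa using h6
      · simp only [wp_eqs, reduceCtorEq, if_true, if_false, true_and, and_true, ← hposd, ← hA]
        omega
      · omega
    · obtain ⟨hhf, l, hl⟩ := h2.eq_cons hh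
      set h := τ.arr .hd (τ.reg .cur) with hh'
      set x := τ.arr .vl h with hx
      have hxn : x < n := h3 (τ.reg .cur) x (by rw [hl]; simp)
      have hb2 := h2.pop hl
      have hsum2 := sum_length_update bk hcur l
      rw [hl, List.length_cons] at hsum2
      have h32 : ∀ k, ∀ i ∈ Function.update bk (τ.reg .cur) l k, i < n := by
        intro k i hi
        rw [Function.update_apply] at hi
        split_ifs at hi
        · exact h3 (τ.reg .cur) i (by rw [hl]; exact List.mem_cons_of_mem _ hi)
        · exact h3 k i hi
      have hmem2 : ∀ i ∈ A, (i ≠ x ∨ τ.arr .deg i ≠ τ.reg .cur) →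
          i ∈ Function.update bk (τ.reg .cur) l (τ.arr .deg i) := by
        intro i hi hor
        have := (h4 i hi).2.2
        rw [Function.update_apply]
        split_ifs with he
        · rw [he, hl] at this
          rcases List.mem_cons.1 this with h | h
          · rcases hor with h' | h'
            · exact absurd h h'
            · exact absurd he h'
          · exact h
        · exact this
      -- The entry is out of date: discarding it pays for the iteration.
      have hskip : (pos x ≠ 0 ∨ τ.arr .deg x ≠ τ.reg .cur) → ∀ υ : HState,
          υ.arr .pos = pos → υ.arr .ord = τ.arr .ord → υ.arr .deg = τ.arr .deg →
          υ.arr .nx = τ.arr .nx → υ.arr .vl = τ.arr .vl →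
          υ.arr .hd = Function.update (τ.arr .hd) (τ.reg .cur) (τ.arr .nx h) →
          υ.reg .c = τ.reg .c → υ.reg .f = τ.reg .f → υ.reg .cur = τ.reg .cur →
          υ.clk = τ.clk + 1 → OrderInv n H N υ (Function.update bk (τ.reg .cur) l) := by
        intro hor υ e1 e2 e3 e4 e5 e6 e7 e8 e9 e10
        refine ⟨by rw [e1, e2, e7]; exact h1, by rw [e4, e5, e6, e8]; exact hb2, h32, ?_,
          by rw [e9]; exact h5, by rw [e1, e8]; exact h6, ?_⟩
        · rw [e1, e3, e9]
          intro i hi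
          refine ⟨(h4 i hi).1, (h4 i hi).2.1, hmem2 i hi ?_⟩
          by_cases hix : i = x
          · subst hix
            rcases hor with hor | hor
            · exact absurd (Nat.le_zero.1 (mem_below.1 hi).2) hor
            · exact Or.inr hor
          · exact Or.inl hix
        · rw [e1, ← hA, e9, e10]
          omega
      refine ⟨by omega, by omega, by omega, ⟨by omega, by omega⟩, fun hpx => ?_, fun hpx => ?_⟩
      swap
      · refine ⟨⟨_, hskip (Or.inl hpx) _ ?_ ?_ ?_ ?_ ?_ ?_ ?_ ?_ ?_ ?_⟩, ?_⟩ <;>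
          (try simp only [wp_eqs, reduceCtorEq, if_true, if_false, true_and, and_true]) <;> omega
      refine ⟨by omega, fun hdx => ?_, fun hdx => ?_⟩
      swap
      · refine ⟨⟨_, hskip (Or.inr hdx) _ ?_ ?_ ?_ ?_ ?_ ?_ ?_ ?_ ?_ ?_⟩, ?_⟩ <;>
          (try simp only [wp_eqs, reduceCtorEq, if_true, if_false, true_and, and_true]) <;> omega
      -- `x` has degree `cur`, which is minimum; it is removed, and its neighbours are updated.
      have hxA : x ∈ A := mem_below.2 ⟨hxn, hpx.le⟩
      have hoff := hB.off x hxn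
      have hlen := hB.len x hxn
      have hsx := start_add_le (n := n) N hxn
      have hord := h1.remove hxn hpx fun y hy => by
        rw [← (h4 x hxA).1, ← (h4 y hy).1, hdx]; exact (h4 y hy).2.1
      set A' := A.erase x with hA'
      have hbel' : below n (Function.update pos x (τ.reg .c)) 0 = A' := below_update_zero hcτ
      have hsA := fun g : ℕ → ℕ => Finset.add_sum_erase A g hxA
      have hdA : ∀ i, degIn H A i = degIn H A' i + if H.Adj i x then 1 else 0 :=
        fun i => degIn_erase H hxA i
      refine ⟨by omega, by omega, by omega, by omega, by omega, ⟨⟨⟨by omega, by omega⟩, by omega⟩,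
        by omega⟩, ?_⟩
      -- The entry of `deg` still counts `x` for those neighbours that have not been visited. There
      -- is one more stack entry for each visited neighbour, and one less for `x`.
      refine wp_upto (fun j υ => ∃ t bk', j = start n N x + t ∧ t ≤ (N x).length ∧
          υ.arr .pos = Function.update pos x (τ.reg .c) ∧
          υ.arr .ord = Function.update (τ.arr .ord) (τ.reg .c - 1) x ∧
          υ.reg .c = τ.reg .c - 1 ∧ υ.reg .cur = τ.reg .cur - 1 ∧
          υ.clk = τ.clk + 1 + t ∧ υ.reg .f ≤ τ.reg .f + t ∧
          Buckets (υ.arr .nx) (υ.arr .vl) (υ.arr .hd) (υ.reg .f) bk' ∧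
          (∀ k, ∀ i ∈ bk' k, i < n) ∧
          (∑ k ∈ Finset.range n, (bk' k).length + 1 ≤ ∑ k ∈ Finset.range n, (bk k).length + t) ∧
          ∀ i ∈ A', υ.arr .deg i < n ∧
            υ.arr .deg i = degIn H A' i + (if i ∈ (N x).drop t then 1 else 0) ∧
            i ∈ bk' (υ.arr .deg i)) (start n N x + (N x).length) (by decide) (by omega)
          ?_ ?_ ?_ ?_ ?_
      · simp only [wp_eqs, reduceCtorEq, if_true, if_false, true_and, and_true, hoff]; omega
      · simp only [wp_eqs, reduceCtorEq, if_true, if_false, true_and, and_true, hoff]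
        refine ⟨0, _, by omega, by omega, rfl, rfl, by omega, hb2, h32,
          by omega, fun i hi => ?_⟩
        have hiA := Finset.mem_of_mem_erase hi
        refine ⟨hdl i hiA, ?_, hmem2 i hiA (Or.inl (Finset.ne_of_mem_erase hi))⟩
        rw [(h4 i hiA).1, hdA, List.drop_zero]
        congr 1
        simp only [hin.mem x hxn, H.adj_comm]
      · rintro υ hfu - -
        simp only [wp_eqs, reduceCtorEq, if_true, if_false, true_and, and_true]
        rw [hfu.reg _ (by decide)]
        simp only [wp_eqs, reduceCtorEq, if_true, if_false, true_and, and_true, hoff, hlen,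
          true_and]
      · rintro υ hfu hj1 hj2 ⟨t, bk', e0, e1, e2, e3, e4, e5, e6, e7, e8, e9, e10, e11⟩
        have hinp : υ.arr .inp = τ.arr .inp := by rw [hfu.arr _ (by decide)]; simp
        have ht : t < (N x).length := by omega
        have hy := hB.seg x hxn t ht
        set y := (N x)[t] with hyd
        have hyx : H.Adj x y := (hin.mem x hxn y).1 (List.getElem_mem ht)
        have hyn : y < n := hin.lt hyx.symm
        have hdrop : (N x).drop t = y :: (N x).drop (t + 1) := List.drop_eq_getElem_cons ht
        have hnot : y ∉ (N x).drop (t + 1) := by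
          have := (hin.nodup x hxn).sublist (List.drop_sublist t (N x))
          rw [hdrop] at this
          exact (List.nodup_cons.1 this).1
        have hfle : τ.reg .f + (N x).length ≤ n + vol := by
          have := hsA fun i => (N i).length
          omega
        simp only [wp_eqs, reduceCtorEq, if_true, if_false, true_and, and_true, hinp, e0, hy]
        refine ⟨by omega, ⟨by omega, by omega⟩, fun hpy => ?_, fun hpy => ?_⟩
        · have hyA : y ∈ A' := by rw [← hbel', ← e2]; exact mem_below.2 ⟨hyn, hpy.le⟩
          obtain ⟨d1, d2, d3⟩ := e11 y hyA
          rw [hdrop, if_pos List.mem_cons_self] at d2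
          have e := sum_length_update bk' (n := n) (k := υ.arr .deg y - 1) (by omega)
            (y :: bk' (υ.arr .deg y - 1))
          rw [List.length_cons] at e
          simp only [Function.update_self]
          refine ⟨⟨by omega, by omega⟩, by omega, by omega, by omega, by omega, by omega, by omega,
            by omega, t + 1, _, by omega, by omega, e2, e3, e4, e5, by omega, by omega,
            e8.push _ _, ?_, by omega, ?_⟩
          · intro k i hi
            rw [Function.update_apply] at hi
            split_ifs at hi with hk
            · rcases List.mem_cons.1 hi with rfl | hi
              · exact hyn
              · exact e9 _ i hi
            · exact e9 _ i hi
          · intro i hi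
            by_cases hiy : i = y
            · subst hiy
              simp only [Function.update_self, if_neg hnot]
              exact ⟨by omega, by omega, List.mem_cons_self⟩
            · obtain ⟨f1, f2, f3⟩ := e11 i hi
              simp only [Function.update_of_ne hiy]
              refine ⟨f1, ?_, ?_⟩
              · rw [f2, hdrop]
                simp only [List.mem_cons, hiy, false_or]
              · rw [Function.update_apply]
                split_ifs with hk
                · exact List.mem_cons_of_mem _ (hk ▸ f3)
                · exact f3
        · refine ⟨t + 1, bk', by omega, by omega, e2, e3, e4, e5, by omega, by omega, e8, e9,
            by omega, fun i hi => ?_⟩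
          obtain ⟨f1, f2, f3⟩ := e11 i hi
          refine ⟨f1, ?_, f3⟩
          have hiy : i ≠ y := fun h => by
            rw [h, ← hbel', ← e2] at hi
            exact hpy (Nat.le_zero.1 (mem_below.1 hi).2)
          rw [f2, hdrop]
          simp only [List.mem_cons, hiy, false_or]
      -- Degrees decrease by at most one, so no remaining vertex has degree below `cur - 1`.
      · rintro υ hfu - ⟨t, bk', e0, e1, e2, e3, e4, e5, e6, e7, e8, e9, e10, e11⟩
        obtain rfl : t = (N x).length := by omega
        have s1 := hsA fun i => (N i).length
        have s2 := hsA fun i => 2 * (N i).length + 1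
        rw [← hA'] at s1 s2
        have htime : υ.clk + ∑ k ∈ Finset.range n, (bk' k).length +
            ∑ i ∈ A', (2 * (N i).length + 1) + (n - (τ.reg .cur - 1)) ≤ 4 * n + 2 * vol := by
          omega
        refine ⟨⟨bk', ?_, e8, e9, ?_, by omega, ?_, ?_⟩, ?_⟩
        · rw [e2, e3, e4]; exact hord
        · rw [e2, hbel', e5]
          intro i hi
          obtain ⟨f1, f2, f3⟩ := e11 i hi
          simp only [List.drop_length, List.not_mem_nil, if_false, add_zero] at f2
          refine ⟨f2, ?_, f3⟩
          have hiA := Finset.mem_of_mem_erase hi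
          have g1 := h4 i hiA
          have g2 := hdA i
          split_ifs at g2 <;> omega
        · rw [e2, hbel']; omega
        · rw [e2, hbel', e5]; exact htime
        · omega
  · rintro τ ⟨bk, hI⟩ hfr hcτ
    simp only [Bx.holds, Ex.eval, Nat.not_lt, Nat.le_zero] at hcτ
    refine ⟨hcτ ▸ hI.isOrder, ?_⟩
    have := hI.time
    omega

/-! ### The graph in smallest-last order -/

/-- The graph on positions: the position `p` stands for the vertex `ord p`. -/
def posGraph (n : ℕ) (H : SimpleGraph ℕ) (ord : ℕ → ℕ) : SimpleGraph ℕ where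
  Adj p q := p < n ∧ q < n ∧ H.Adj (ord p) (ord q)
  symm := ⟨fun _ _ h => ⟨h.2.1, h.1, h.2.2.symm⟩⟩
  loopless := ⟨fun _ h => h.2.2.ne rfl⟩

/-- Equal or adjacent. -/
def Near (P : SimpleGraph ℕ) (y z : ℕ) : Prop := y = z ∨ P.Adj y z

theorem Near.symm {P : SimpleGraph ℕ} {y z : ℕ} (h : Near P y z) : Near P z y :=
  h.imp Eq.symm SimpleGraph.Adj.symm

theorem Near.refl (P : SimpleGraph ℕ) (y : ℕ) : Near P y y := Or.inl rfl

open Classical in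
/-- The neighbours of `z` before `k`, in increasing order. -/
noncomputable def earlier (P : SimpleGraph ℕ) (k z : ℕ) : List ℕ :=
  (List.range k).filter fun y => P.Adj y z

/-- The earlier neighbours of `z`, in increasing order, and then `z` itself. -/
noncomputable def nbr (P : SimpleGraph ℕ) (z : ℕ) : List ℕ := earlier P z z ++ [z]

theorem mem_earlier {P : SimpleGraph ℕ} {k y z : ℕ} : y ∈ earlier P k z ↔ y < k ∧ P.Adj y z := by
  simp [earlier]

theorem mem_nbr {P : SimpleGraph ℕ} {y z : ℕ} : y ∈ nbr P z ↔ y ≤ z ∧ Near P y z := by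
  simp only [nbr, List.mem_append, mem_earlier, List.mem_singleton, Near]
  constructor
  · rintro (h | h)
    · exact ⟨h.1.le, Or.inr h.2⟩
    · exact ⟨h.le, Or.inl h⟩
  · rintro ⟨h1, h | h⟩
    · exact Or.inr h
    · exact Or.inl ⟨lt_of_le_of_ne h1 h.ne, h⟩

theorem nodup_earlier (P : SimpleGraph ℕ) (k z : ℕ) : (earlier P k z).Nodup :=
  List.nodup_range.filter _

theorem nodup_nbr (P : SimpleGraph ℕ) (z : ℕ) : (nbr P z).Nodup := by
  rw [nbr, List.nodup_append]
  refine ⟨nodup_earlier P z z, List.nodup_singleton z, fun a ha b hb => ?_⟩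
  have := (mem_earlier.1 ha).1
  have := List.mem_singleton.1 hb
  omega

open Classical in
theorem earlier_succ (P : SimpleGraph ℕ) (k z : ℕ) :
    earlier P (k + 1) z = earlier P k z ++ if P.Adj k z then [k] else [] := by
  simp only [earlier, List.range_succ, List.filter_append, List.filter_cons, List.filter_nil,
    decide_eq_true_eq]

theorem IsOrder.ord_injOn {n : ℕ} {H : SimpleGraph ℕ} {pos ord : ℕ → ℕ}
    (h : IsOrder n H pos ord 0) {p q : ℕ} (hp : p < n) (hq : q < n) (hpq : ord p = ord q) :
    p = q := by
  have h1 := (h.pos_ord p (Nat.zero_le _) hp).2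
  have h2 := (h.pos_ord q (Nat.zero_le _) hq).2
  rw [hpq] at h1
  omega

/-- The address of the list of the earlier neighbours of `z`. The list is put where the adjacency
list of the same vertex is in the input; the shift by `ord z` makes room for `z` itself at its end.
-/
def nbrStart (n : ℕ) (N : ℕ → List ℕ) (ord : ℕ → ℕ) (z : ℕ) : ℕ := start n N (ord z) + ord z

theorem nbrStart_ne {n : ℕ} {H : SimpleGraph ℕ} {pos ord : ℕ → ℕ} {N : ℕ → List ℕ}
    (h : IsOrder n H pos ord 0) {y z i j : ℕ} (hy : y < n) (hz : z < n) (hyz : y ≠ z)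
    (hi : i ≤ (N (ord y)).length) (hj : j ≤ (N (ord z)).length) :
    nbrStart n N ord y + i ≠ nbrStart n N ord z + j := by
  unfold nbrStart
  rcases lt_trichotomy (ord y) (ord z) with hlt | heq | hlt
  · have := start_add_le (n := n) N hlt
    omega
  · exact absurd (h.ord_injOn hy hz heq) hyz
  · have := start_add_le (n := n) N hlt
    omega

theorem length_earlier_le {n : ℕ} {H : SimpleGraph ℕ} {pos ord : ℕ → ℕ} {N : ℕ → List ℕ}
    (hin : IsInput n H N) (h : IsOrder n H pos ord 0) (k z : ℕ) (hz : z < n) :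
    (earlier (posGraph n H ord) k z).length ≤ (N (ord z)).length := by
  have hn := (h.pos_ord z (Nat.zero_le _) hz).1
  rw [← List.length_map (f := ord), ← List.toFinset_card_of_nodup (hin.nodup _ hn),
    ← List.toFinset_card_of_nodup]
  · refine Finset.card_le_card fun x hx => ?_
    simp only [List.mem_toFinset, List.mem_map, mem_earlier] at hx ⊢
    obtain ⟨y, ⟨-, -, -, hadj⟩, rfl⟩ := hx
    exact (hin.mem _ hn _).2 hadj.symm
  · refine List.Nodup.map_on (fun a ha b hb hab => ?_) (nodup_earlier _ _ _)
    exact h.ord_injOn (mem_earlier.1 ha).2.1 (mem_earlier.1 hb).2.1 hab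

theorem IsOrder.ord_pos_of_lt {n : ℕ} {H : SimpleGraph ℕ} {pos ord : ℕ → ℕ}
    (h : IsOrder n H pos ord 0) {i : ℕ} (hi : i < n) :
    0 < pos i ∧ pos i - 1 < n ∧ ord (pos i - 1) = i := by
  have h0 : pos i ≠ 0 := fun h0 => by
    have : i ∈ below n pos 0 := mem_below.2 ⟨hi, h0.le⟩
    rw [Finset.card_eq_zero.1 h.card] at this
    simp at this
  have := h.ord_pos i hi h0
  exact ⟨by omega, by omega, this.2.2⟩

theorem IsOrder.sum_ord {n : ℕ} {H : SimpleGraph ℕ} {pos ord : ℕ → ℕ}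
    (h : IsOrder n H pos ord 0) (g : ℕ → ℕ) :
    ∑ p ∈ Finset.range n, g (ord p) = ∑ i ∈ Finset.range n, g i := by
  refine Finset.sum_nbij ord ?_ ?_ ?_ fun _ _ => rfl
  · intro p hp
    exact Finset.mem_range.2 (h.pos_ord p (Nat.zero_le _) (Finset.mem_range.1 hp)).1
  · intro p hp q hq
    exact h.ord_injOn (by simpa using hp) (by simpa using hq)
  · intro i hi
    have := h.ord_pos_of_lt (i := i) (by simpa using hi)
    exact ⟨pos i - 1, by simpa using this.2.1, this.2.2⟩

/-- The lists of earlier neighbours, in position space: `nb` holds `nbr P z` from the index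
`eo z` on, and `el z` is the number of earlier neighbours of `z`. An index of `nb` is the slot of an
edge; by `inj` no two lists share a slot. -/
structure Layout (n M : ℕ) (P : SimpleGraph ℕ) (τ : HState) : Prop where
  reg_n : τ.reg .n = n
  el : ∀ z < n, τ.arr .el z + 1 = (nbr P z).length
  el_top : ∀ z, n ≤ z → τ.arr .el z = 0
  seg : ∀ z < n, Seg (τ.arr .nb) (τ.arr .eo z) (nbr P z)
  inj : ∀ y < n, ∀ z < n, ∀ i ≤ τ.arr .el y, ∀ j ≤ τ.arr .el z,
    τ.arr .eo y + i = τ.arr .eo z + j → y = z ∧ i = j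
  lt : ∀ z < n, τ.arr .eo z + τ.arr .el z < M

/-- Compute the lists of earlier neighbours. Going through the positions `p` in order, `p` is
appended to the lists of its later neighbours, so the lists come out sorted. -/
def nbrLists : Com :=
  .set .p (.c 0) ;;
  .upto .p (.v .n) (
    .put .eo (.v .p) (.plus (.rd .off (.rd .ord (.v .p))) (.rd .ord (.v .p)))) ;;
  .set .p (.c 0) ;;
  .upto .p (.v .n) (
    .set .x (.rd .ord (.v .p)) ;;
    .put .nb (.plus (.rd .eo (.v .p)) (.rd .el (.v .p))) (.v .p) ;;
    .set .j (.rd .off (.v .x)) ;;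
    .set .je (.plus (.v .j) (.rd .inp (.plus (.v .x) (.c 1)))) ;;
    .upto .j (.v .je) (
      .set .q (.minus (.rd .pos (.rd .inp (.v .j))) (.c 1)) ;;
      .ite (.lt (.v .p) (.v .q)) (
        .put .nb (.plus (.rd .eo (.v .q)) (.rd .el (.v .q))) (.v .p) ;;
        .put .el (.v .q) (.plus (.rd .el (.v .q)) (.c 1))) .nop))

theorem nbrLists_spec {n M W : ℕ} {H : SimpleGraph ℕ} {N : ℕ → List ℕ} {pos ord : ℕ → ℕ}
    (hin : IsInput n H N) (hM : 4 * start n N n ≤ M) (hW : 8 * M ≤ W) {σ : HState}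
    (hb : Base n N σ) (hpos : σ.arr .pos = pos) (hordσ : σ.arr .ord = ord)
    (ho : IsOrder n H pos ord 0) (hel : ∀ z, σ.arr .el z = 0) :
    wp M W nbrLists (fun τ => Layout n M (posGraph n H ord) τ ∧
      τ.clk = σ.clk + 2 * n + ∑ i ∈ Finset.range n, (N i).length) σ := by
  classical
  set P := posGraph n H ord with hP
  have hstn : start n N n = 1 + n + ∑ i ∈ Finset.range n, (N i).length := rfl
  have hso : ∀ p < n, start n N (ord p) + (N (ord p)).length ≤ start n N n := fun p hp =>
    start_add_le N (ho.pos_ord p (Nat.zero_le _) hp).1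
  have hns : ∀ p < n, nbrStart n N ord p + (N (ord p)).length ≤ start n N n + n := fun p hp => by
    have := hso p hp
    have := (ho.pos_ord p (Nat.zero_le _) hp).1
    unfold nbrStart
    omega
  have hle : ∀ k z, z < n → (earlier P k z).length ≤ (N (ord z)).length :=
    length_earlier_le hin ho
  simp only [nbrLists, wp_eqs, reduceCtorEq, if_true, if_false, true_and, and_true]
  refine ⟨by omega, ?_⟩
  refine wp_upto (fun p τ => τ.clk = σ.clk + p ∧ ∀ q < p, τ.arr .eo q = nbrStart n N ord q) n
    (by decide) (by omega) (by simp) (by simp) ?_ ?_ ?_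
  · rintro τ hf - -
    refine ⟨trivial, ?_⟩
    simp only [Ex.eval]
    rw [hf.reg _ (by decide)]
    simp [hb.reg_n]
  · rintro τ hf - hp ⟨h1, h2⟩
    have hB : Base n N τ := hb.congr (by rw [hf.reg _ (by decide)]; simp)
      (by rw [hf.arr _ (by decide)]; simp) (by rw [hf.arr _ (by decide)]; simp)
    have e1 : τ.arr .ord = ord := by rw [hf.arr _ (by decide)]; exact hordσ
    have hon := (ho.pos_ord _ (Nat.zero_le _) hp).1
    have := hso _ hp
    simp only [wp_eqs, reduceCtorEq, if_true, if_false, true_and, and_true, e1, hB.off _ hon]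
    refine ⟨by omega, by omega, by omega, ?_⟩
    intro q hq
    rcases Nat.lt_succ_iff_lt_or_eq.1 hq with hq | rfl
    · rw [Function.update_of_ne (by omega), h2 q hq]
    · simp [nbrStart]
  rintro σ₁ hf₁ - ⟨hclk₁, heo₁⟩
  have hB₁ : Base n N σ₁ := hb.congr (by rw [hf₁.reg _ (by decide)]; simp)
      (by rw [hf₁.arr _ (by decide)]; simp) (by rw [hf₁.arr _ (by decide)]; simp)
  have hpos₁ : σ₁.arr .pos = pos := by rw [hf₁.arr _ (by decide)]; exact hpos
  have hord₁ : σ₁.arr .ord = ord := by rw [hf₁.arr _ (by decide)]; exact hordσ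
  have hel₁ : ∀ z, σ₁.arr .el z = 0 := by rw [hf₁.arr _ (by decide)]; exact hel
  clear hf₁ hpos hordσ hel hb
  refine ⟨by omega, ?_⟩
  refine wp_upto (fun p τ => τ.clk = σ₁.clk + p + ∑ q ∈ Finset.range p, (N (ord q)).length ∧
      (∀ q, n ≤ q → τ.arr .el q = 0) ∧
      (∀ q < n, q < p → τ.arr .el q + 1 = (nbr P q).length ∧
        Seg (τ.arr .nb) (nbrStart n N ord q) (nbr P q)) ∧
      ∀ q < n, p ≤ q → τ.arr .el q = (earlier P p q).length ∧
        Seg (τ.arr .nb) (nbrStart n N ord q) (earlier P p q)) n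
    (by decide) (by omega) (by simp) ?_ ?_ ?_ ?_
  · simp only [wp_eqs, reduceCtorEq, if_true, if_false, true_and, and_true]
    refine ⟨by simp, fun q _ => hel₁ q, fun q _ h => absurd h (by omega), fun q _ _ => ?_⟩
    simp [hel₁, earlier, Seg.nil]
  · rintro τ hf - -
    refine ⟨trivial, ?_⟩
    simp only [Ex.eval]
    rw [hf.reg _ (by decide)]
    simp [hB₁.reg_n]
  · rintro τ hf - hp ⟨h1, h2, h3, h4⟩
    have hB : Base n N τ := hB₁.congr (by rw [hf.reg _ (by decide)]; simp)
      (by rw [hf.arr _ (by decide)]; simp) (by rw [hf.arr _ (by decide)]; simp)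
    have hord : τ.arr .ord = ord := by rw [hf.arr _ (by decide)]; exact hord₁
    have hposτ : τ.arr .pos = pos := by rw [hf.arr _ (by decide)]; exact hpos₁
    have heo : ∀ q < n, τ.arr .eo q = nbrStart n N ord q := by
      rw [hf.arr _ (by decide)]; exact heo₁
    clear hf
    set p := τ.reg .p with hpd
    have hxn := (ho.pos_ord p (Nat.zero_le _) hp).1
    set x := ord p with hx
    have hsx : start n N x + (N x).length ≤ start n N n := hso _ hp
    have hnx : nbrStart n N ord p + (N x).length ≤ start n N n + n := hns _ hp
    have hoff := hB.off x hxn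
    have hlen := hB.len x hxn
    have h4p := h4 p hp le_rfl
    have hlp : (earlier P p p).length ≤ (N x).length := hle p p hp
    simp only [wp_eqs, reduceCtorEq, if_true, if_false, true_and, and_true, ← hpd, hord, ← hx,
      heo p hp, h4p.1, hoff, hlen]
    refine ⟨by omega, ⟨by omega, by omega, by omega⟩, by omega, by omega,
      ⟨⟨⟨by omega, by omega⟩, by omega⟩, by omega⟩, ?_⟩
    refine wp_upto (fun j υ => ∃ t, j = start n N x + t ∧ t ≤ (N x).length ∧
        υ.clk = τ.clk + 1 + t ∧ (∀ q, n ≤ q → υ.arr .el q = 0) ∧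
        (∀ q < n, q ≤ p → υ.arr .el q + 1 = (nbr P q).length ∧
          Seg (υ.arr .nb) (nbrStart n N ord q) (nbr P q)) ∧
        ∀ q < n, p < q → υ.arr .el q =
            (earlier P p q ++ if ord q ∈ (N x).take t then [p] else []).length ∧
          Seg (υ.arr .nb) (nbrStart n N ord q)
            (earlier P p q ++ if ord q ∈ (N x).take t then [p] else []))
      (start n N x + (N x).length) (by decide) (by omega) ?_ ?_ ?_ ?_ ?_
    · simp only [wp_eqs, reduceCtorEq, if_true, if_false, true_and, and_true]; omega
    · simp only [wp_eqs, reduceCtorEq, if_true, if_false, true_and, and_true]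
      refine ⟨0, by omega, by omega, by omega, h2, ?_, ?_⟩
      · intro q hq hqp
        rcases Nat.lt_or_eq_of_le hqp with hqp | rfl
        · refine ⟨(h3 q hq hqp).1, (h3 q hq hqp).2.congr fun j hj => Function.update_of_ne ?_ _ _⟩
          have := hle q q hq
          simp only [nbr, List.length_append, List.length_singleton] at hj
          exact nbrStart_ne ho hq hp (by omega) (by omega) (by omega)
        · exact ⟨by rw [h4p.1]; simp [nbr], h4p.2.push rfl⟩
      · intro q hq hqp
        simp only [List.take_zero, List.not_mem_nil, if_false, List.append_nil]
        refine ⟨(h4 q hq hqp.le).1, (h4 q hq hqp.le).2.congr fun j hj =>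
          Function.update_of_ne ?_ _ _⟩
        have := hle p q hq
        exact nbrStart_ne ho hq hp (by omega) (by omega) (by omega)
    · rintro υ hf - -
      refine ⟨trivial, ?_⟩
      simp only [Ex.eval]
      rw [hf.reg _ (by decide)]
      simp
    · rintro υ hf hj1 hj2 ⟨t, e0, e1, e2, e3, e4, e5⟩
      have hinp : υ.arr .inp = τ.arr .inp := by rw [hf.arr _ (by decide)]; simp
      have hpυ : υ.arr .pos = pos := by rw [hf.arr _ (by decide)]; simpa using hposτ
      have heoυ : ∀ q < n, υ.arr .eo q = nbrStart n N ord q := by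
        rw [hf.arr _ (by decide)]; simpa using heo
      have hpp : υ.reg .p = p := by rw [hf.reg _ (by decide)]; simp [hpd]
      clear hf
      have ht : t < (N x).length := by omega
      have hy := hB.seg x hxn t ht
      set y := (N x)[t] with hyd
      have hyx : H.Adj x y := (hin.mem x hxn y).1 (List.getElem_mem ht)
      have hyn : y < n := hin.lt hyx.symm
      obtain ⟨k1, k2, k3⟩ := ho.ord_pos_of_lt hyn
      have htake : (N x).take (t + 1) = (N x).take t ++ [y] := by
        rw [List.take_succ_eq_append_getElem ht]
      simp only [wp_eqs, reduceCtorEq, if_true, if_false, true_and, and_true, hinp, e0, hy, hpυ,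
        hpp]
      set q := pos y - 1 with hq
      have hnq := hns q k2
      refine ⟨⟨⟨by omega, by omega⟩, by omega⟩, fun hpq => ?_, fun hpq => ?_⟩
      · have hynot : ord q ∉ (N x).take t := by
          rw [k3]
          intro hmem
          have hnd := (hin.nodup x hxn).sublist (List.take_sublist (t + 1) (N x))
          rw [htake] at hnd
          exact (List.nodup_append.1 hnd).2.2 y hmem y (by simp) rfl
        have f := e5 q k2 hpq
        rw [if_neg hynot, List.append_nil] at f
        have hPq : P.Adj p q := ⟨hp, k2, by rw [k3]; exact hyx⟩
        have hlq := hle (p + 1) q k2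
        rw [earlier_succ, if_pos hPq, List.length_append, List.length_singleton] at hlq
        simp only [heoυ q k2, f.1]
        refine ⟨by omega, by omega, by omega, by omega, t + 1, by omega, by omega, by omega, ?_, ?_,
          ?_⟩
        · intro r hr
          rw [Function.update_of_ne (by omega)]
          exact e3 r hr
        · intro r hr hrp
          rw [Function.update_of_ne (by omega)]
          refine ⟨(e4 r hr hrp).1, (e4 r hr hrp).2.congr fun j hj =>
            Function.update_of_ne ?_ _ _⟩
          have := hle r r hr
          simp only [nbr, List.length_append, List.length_singleton] at hj
          exact nbrStart_ne ho hr k2 (by omega) (by omega) (by omega)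
        · intro r hr hrp
          by_cases hrq : r = q
          · subst hrq
            rw [Function.update_self, if_pos (by rw [htake, k3]; simp)]
            exact ⟨by simp, f.2.push rfl⟩
          · rw [Function.update_of_ne hrq, htake]
            have hne : ord r ≠ y := fun h => hrq (ho.ord_injOn hr k2 (h.trans k3.symm))
            simp only [List.mem_append, List.mem_singleton, hne, or_false]
            refine ⟨(e5 r hr hrp).1, (e5 r hr hrp).2.congr fun j hj =>
              Function.update_of_ne ?_ _ _⟩
            have h5 : (earlier P p r ++ if ord r ∈ (N x).take t then [p] else []).length ≤
                (N (ord r)).length := by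
              split_ifs with hin'
              · have := hle (p + 1) r hr
                rwa [earlier_succ, if_pos ⟨hp, hr,
                  (hin.mem x hxn _).1 (List.mem_of_mem_take hin')⟩] at this
              · simpa using hle p r hr
            exact nbrStart_ne ho hr k2 (by omega) (by omega) (by omega)
      · refine ⟨t + 1, by omega, by omega, by omega, e3, e4, fun r hr hrp => ?_⟩
        have hne : ord r ≠ y := fun h => by
          have := ho.ord_injOn hr k2 (h.trans k3.symm)
          omega
        rw [htake]
        simp only [List.mem_append, List.mem_singleton, hne, or_false]
        exact e5 r hr hrp
    · rintro υ hf - ⟨t, e0, e1, e2, e3, e4, e5⟩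
      obtain rfl : t = (N x).length := by omega
      refine ⟨?_, e3, fun q hq hqp => e4 q hq (by omega), fun q hq hqp => ?_⟩
      · rw [Finset.sum_range_succ, ← hx]; omega
      · have := e5 q hq hqp
        rw [List.take_length] at this
        rw [earlier_succ]
        have hiff : P.Adj p q ↔ ord q ∈ N x := by
          rw [hin.mem x hxn]
          exact ⟨fun h => h.2.2, fun h => ⟨hp, hq, h⟩⟩
        simp only [hiff]
        exact this
  · rintro τ hf - ⟨h1, h2, h3, h4⟩
    have heo : ∀ q < n, τ.arr .eo q = nbrStart n N ord q := by
      rw [hf.arr _ (by decide)]; exact heo₁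
    have hl : ∀ q < n, τ.arr .el q ≤ (N (ord q)).length := fun q hq => by
      have := (h3 q hq hq).1
      have := hle q q hq
      simp only [nbr, List.length_append, List.length_singleton] at *
      omega
    refine ⟨⟨?_, fun z hz => (h3 z hz hz).1, h2, fun z hz => ?_, ?_, ?_⟩, ?_⟩
    · rw [hf.reg _ (by decide)]; simp [hB₁.reg_n]
    · rw [heo z hz]; exact (h3 z hz hz).2
    · intro y hy z hz i hi j hj
      rw [heo y hy, heo z hz]
      have := hl y hy
      have := hl z hz
      by_cases hyz : y = z
      · subst hyz
        exact fun h => ⟨rfl, by omega⟩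
      · exact fun h => absurd h (nbrStart_ne ho hy hz hyz (by omega) (by omega))
    · intro z hz
      rw [heo z hz]
      have := hl z hz
      have := hns z hz
      omega
    · rw [h1, hclk₁, ho.sum_ord fun i => (N i).length]; ring

/-! ### Clique covers as edge labellings -/

/-- The vertex `x` is an endpoint of an edge with label `c`. An edge is a pair `y < z`, its label
is `lam y z`, and `0` means that there is no label (or no edge). -/
def Inc (lam : ℕ → ℕ → ℕ) (c x : ℕ) : Prop := ∃ y, lam x y = c ∨ lam y x = c

/-- The edges with labels `1, …, k` are covered by `k` cliques, namely the sets of the endpoints of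
the edges with a given label, and no two of these cliques have a union that is a clique. -/
structure IsCover (P : SimpleGraph ℕ) (lam : ℕ → ℕ → ℕ) (k : ℕ) : Prop where
  supp : ∀ {y z}, lam y z ≠ 0 → y < z ∧ P.Adj y z
  le : ∀ y z, lam y z ≤ k
  used : ∀ c, c ≠ 0 → c ≤ k → ∃ y z, lam y z = c
  clique : ∀ c, c ≠ 0 → ∀ x y, Inc lam c x → Inc lam c y → Near P x y
  sep : ∀ b c, b ≠ 0 → b ≤ k → c ≠ 0 → c ≤ k → b ≠ c →
    ∃ x y, Inc lam b x ∧ Inc lam c y ∧ ¬ Near P x y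

/-- Label the edges between `p` and `X` with `c`, where `X` lies before `p`. -/
def relabel (lam : ℕ → ℕ → ℕ) (p : ℕ) (X : Finset ℕ) (c : ℕ) (y z : ℕ) : ℕ :=
  if z = p ∧ y ∈ X then c else lam y z

section Relabel

variable {P : SimpleGraph ℕ} {lam : ℕ → ℕ → ℕ} {k p c : ℕ} {X : Finset ℕ}

theorem relabel_of_mem {x : ℕ} (hx : x ∈ X) : relabel lam p X c x p = c := if_pos ⟨rfl, hx⟩

theorem relabel_of_ne {y z : ℕ} (h : lam y z ≠ 0) (hX : ∀ x ∈ X, lam x p = 0) :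
    relabel lam p X c y z = lam y z := by
  refine if_neg ?_
  rintro ⟨rfl, hy⟩
  exact h (hX y hy)

theorem Inc.relabel {b x : ℕ} (hb : b ≠ 0) (hX : ∀ x ∈ X, lam x p = 0) (h : Inc lam b x) :
    Inc (relabel lam p X c) b x := by
  obtain ⟨y, h | h⟩ := h
  · exact ⟨y, Or.inl (by rw [relabel_of_ne (h ▸ hb) hX, h])⟩
  · exact ⟨y, Or.inr (by rw [relabel_of_ne (h ▸ hb) hX, h])⟩

theorem Inc.of_relabel {b x : ℕ} (h : Inc (DualCliqueCover.relabel lam p X c) b x) :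
    Inc lam b x ∨ b = c ∧ (x ∈ X ∨ x = p) := by
  obtain ⟨y, h | h⟩ := h <;> unfold DualCliqueCover.relabel at h <;> split_ifs at h with hc
  · exact Or.inr ⟨h.symm, Or.inl hc.2⟩
  · exact Or.inl ⟨y, Or.inl h⟩
  · exact Or.inr ⟨h.symm, Or.inr hc.1⟩
  · exact Or.inl ⟨y, Or.inr h⟩

/-- Adding the clique `X ∪ {p}` to a clique that is compatible with it. The cliques only grow, so
pairs of cliques remain separated. -/
theorem IsCover.extend (h : IsCover P lam k)
    (hX : ∀ x ∈ X, x < p ∧ P.Adj x p ∧ lam x p = 0) (hXX : ∀ x ∈ X, ∀ y ∈ X, Near P x y)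
    (hc0 : c ≠ 0) (hck : c ≤ k) (hp : ∀ x, Inc lam c x → Near P x p)
    (hcX : ∀ x, Inc lam c x → ∀ y ∈ X, Near P x y) : IsCover P (relabel lam p X c) k := by
  have hX0 : ∀ x ∈ X, lam x p = 0 := fun x hx => (hX x hx).2.2
  refine ⟨fun {y z} hyz => ?_, fun y z => ?_, fun b hb hbk => ?_, fun b hb x y hx hy => ?_,
    fun b d hb hbk hd hdk hbd => ?_⟩
  · unfold relabel at hyz
    split_ifs at hyz with hcc
    · obtain ⟨rfl, hy⟩ := hcc
      exact ⟨(hX y hy).1, (hX y hy).2.1⟩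
    · exact h.supp hyz
  · unfold relabel
    split_ifs
    · exact hck
    · exact h.le y z
  · obtain ⟨y, z, hyz⟩ := h.used b hb hbk
    exact ⟨y, z, by rw [relabel_of_ne (hyz ▸ hb) hX0, hyz]⟩
  · have hXp : ∀ x ∈ X, Near P x p := fun x hx => Or.inr (hX x hx).2.1
    rcases hx.of_relabel with gx | ⟨rfl, gx | rfl⟩ <;> rcases hy.of_relabel with gy | ⟨hbc, gy | gy⟩
    · exact h.clique b hb x y gx gy
    · subst hbc; exact hcX x gx y gy
    · subst hbc; subst gy; exact hp x gx
    · exact (hcX y gy x gx).symm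
    · exact hXX x gx y gy
    · subst gy; exact hXp x gx
    · exact (hp y gy).symm
    · exact (hXp y gy).symm
    · subst gy; exact Near.refl _ _
  · obtain ⟨x, y, hx, hy, hxy⟩ := h.sep b d hb hbk hd hdk hbd
    exact ⟨x, y, hx.relabel hb hX0, hy.relabel hd hX0, hxy⟩

/-- Adding the clique `X ∪ {p}` as a new one, if it is compatible with no old one. -/
theorem IsCover.new (h : IsCover P lam k) (hne : X.Nonempty)
    (hX : ∀ x ∈ X, x < p ∧ P.Adj x p ∧ lam x p = 0) (hXX : ∀ x ∈ X, ∀ y ∈ X, Near P x y)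
    (hno : ∀ b, b ≠ 0 → b ≤ k → ∃ x, Inc lam b x ∧ (¬ Near P x p ∨ ∃ y ∈ X, ¬ Near P x y)) :
    IsCover P (relabel lam p X (k + 1)) (k + 1) := by
  have hX0 : ∀ x ∈ X, lam x p = 0 := fun x hx => (hX x hx).2.2
  obtain ⟨x₀, hx₀⟩ := hne
  have hincp : Inc (relabel lam p X (k + 1)) (k + 1) p := ⟨x₀, Or.inr (relabel_of_mem hx₀)⟩
  have hincX : ∀ x ∈ X, Inc (relabel lam p X (k + 1)) (k + 1) x := fun x hx =>
    ⟨p, Or.inl (relabel_of_mem hx)⟩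
  have hnot : ∀ x, ¬ Inc lam (k + 1) x := by
    rintro x ⟨y, h' | h'⟩
    · have := h.le x y; omega
    · have := h.le y x; omega
  have hsep : ∀ b, b ≠ 0 → b ≤ k → ∃ x y, Inc (relabel lam p X (k + 1)) b x ∧
      Inc (relabel lam p X (k + 1)) (k + 1) y ∧ ¬ Near P x y := by
    intro b hb hbk
    obtain ⟨x, hx, hx' | ⟨y, hy, hxy⟩⟩ := hno b hb hbk
    · exact ⟨x, p, hx.relabel hb hX0, hincp, hx'⟩
    · exact ⟨x, y, hx.relabel hb hX0, hincX y hy, hxy⟩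
  refine ⟨fun {y z} hyz => ?_, fun y z => ?_, fun b hb hbk => ?_, fun b hb x y hx hy => ?_,
    fun b d hb hbk hd hdk hbd => ?_⟩
  · unfold relabel at hyz
    split_ifs at hyz with hcc
    · obtain ⟨rfl, hy⟩ := hcc
      exact ⟨(hX y hy).1, (hX y hy).2.1⟩
    · exact h.supp hyz
  · unfold relabel
    split_ifs
    · exact le_rfl
    · exact (h.le y z).trans (by omega)
  · rcases Nat.lt_or_eq_of_le hbk with hbk | rfl
    · obtain ⟨y, z, hyz⟩ := h.used b hb (by omega)
      exact ⟨y, z, by rw [relabel_of_ne (hyz ▸ hb) hX0, hyz]⟩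
    · exact ⟨x₀, p, relabel_of_mem hx₀⟩
  · have hXp : ∀ x ∈ X, Near P x p := fun x hx => Or.inr (hX x hx).2.1
    rcases hx.of_relabel with gx | ⟨rfl, gx | rfl⟩ <;> rcases hy.of_relabel with gy | ⟨hbc, gy | gy⟩
    · exact h.clique b hb x y gx gy
    · subst hbc; exact absurd gx (hnot x)
    · subst hbc; exact absurd gx (hnot x)
    · exact absurd gy (hnot y)
    · exact hXX x gx y gy
    · subst gy; exact hXp x gx
    · exact absurd gy (hnot y)
    · exact (hXp y gy).symm
    · subst gy; exact Near.refl _ _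
  · rcases Nat.lt_or_eq_of_le hbk with hbk | rfl
    · rcases Nat.lt_or_eq_of_le hdk with hdk | rfl
      · obtain ⟨x, y, hx, hy, hxy⟩ := h.sep b d hb (by omega) hd (by omega) hbd
        exact ⟨x, y, hx.relabel hb hX0, hy.relabel hd hX0, hxy⟩
      · exact hsep b hb (by omega)
    · obtain ⟨x, y, hx, hy, hxy⟩ := hsep d hd (by omega)
      exact ⟨y, x, hy, hx, fun h => hxy h.symm⟩

end Relabel

/-- The pairs of positions whose edge has the label `c`. -/
def labelled (n : ℕ) (lam : ℕ → ℕ → ℕ) (c : ℕ) : Finset (ℕ × ℕ) :=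
  (Finset.range n ×ˢ Finset.range n).filter fun e => lam e.1 e.2 = c

theorem mem_labelled {n : ℕ} {lam : ℕ → ℕ → ℕ} {c : ℕ} {e : ℕ × ℕ} :
    e ∈ labelled n lam c ↔ e.1 < n ∧ e.2 < n ∧ lam e.1 e.2 = c := by
  simp [labelled, and_assoc]

/-- `relabel` adds `|X|` edges to the label `c`, and takes none from another label, because the
edges between `p` and `X` had no label before. -/
theorem card_labelled_relabel {n p c d : ℕ} {lam : ℕ → ℕ → ℕ} {X : Finset ℕ} (hp : p < n)
    (hX : ∀ x ∈ X, x < n ∧ lam x p = 0) (hd : d ≠ 0) :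
    (labelled n (relabel lam p X c) d).card =
      (labelled n lam d).card + if d = c then X.card else 0 := by
  split_ifs with hdc
  · subst hdc
    have hdisj : Disjoint (labelled n lam d) (X ×ˢ {p}) := by
      rw [Finset.disjoint_left]
      rintro ⟨y, z⟩ h1 h2
      simp only [Finset.mem_product, Finset.mem_singleton] at h2
      obtain ⟨h2, rfl⟩ := h2
      exact hd ((mem_labelled.1 h1).2.2.symm.trans (hX y h2).2)
    have : labelled n (relabel lam p X d) d = labelled n lam d ∪ X ×ˢ {p} := by
      ext ⟨y, z⟩
      simp only [Finset.mem_union, mem_labelled, Finset.mem_product, Finset.mem_singleton, relabel]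
      split_ifs with h
      · obtain ⟨rfl, h⟩ := h
        exact ⟨fun _ => Or.inr ⟨h, rfl⟩, fun _ => ⟨(hX y h).1, hp, rfl⟩⟩
      · exact ⟨Or.inl, fun h' => h'.resolve_right fun h'' => h ⟨h''.2, h''.1⟩⟩
    rw [this, Finset.card_union_of_disjoint hdisj, Finset.card_product, Finset.card_singleton,
      mul_one]
  · rw [add_zero]
    congr 1
    ext ⟨y, z⟩
    simp only [mem_labelled, relabel]
    split_ifs with h
    · obtain ⟨rfl, h⟩ := h
      have := (hX y h).2
      exact and_congr_right fun _ => and_congr_right fun _ =>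
        ⟨fun e => absurd e.symm hdc, fun e => absurd (e.symm.trans this) hd⟩
    · rfl

/-- The number of edges. -/
noncomputable def edgeCount (n : ℕ) (P : SimpleGraph ℕ) : ℕ :=
  ∑ z ∈ Finset.range n, (earlier P z z).length

/-- There are at most as many labels as edges. -/
theorem IsCover.le_edgeCount {n : ℕ} {P : SimpleGraph ℕ} {lam : ℕ → ℕ → ℕ} {k : ℕ}
    (h : IsCover P lam k) (hn : ∀ y z, P.Adj y z → y < n) : k ≤ edgeCount n P := by
  let S : Finset (Σ _ : ℕ, ℕ) := (Finset.range n).sigma fun z => (earlier P z z).toFinset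
  have hS : S.card = edgeCount n P := by
    rw [Finset.card_sigma]
    exact Finset.sum_congr rfl fun z _ => List.toFinset_card_of_nodup (nodup_earlier P z z)
  have : Finset.Icc 1 k ⊆ S.image fun e => lam e.2 e.1 := by
    intro c hc
    have hc := Finset.mem_Icc.1 hc
    obtain ⟨y, z, hyz⟩ := h.used c (by omega) hc.2
    have hs := h.supp (y := y) (z := z) (by omega)
    refine Finset.mem_image.2 ⟨⟨z, y⟩, ?_, hyz⟩
    simp only [S, Finset.mem_sigma, Finset.mem_range, List.mem_toFinset, mem_earlier]
    exact ⟨hn z y hs.2.symm, hs⟩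
  have h1 := Finset.card_le_card this
  rw [Nat.card_Icc] at h1
  have h2 := Finset.card_image_le (s := S) (f := fun e => lam e.2 e.1)
  omega

/-! ### Scanning the edges among the closed earlier neighbourhood of a position -/

open Classical in
/-- The pairs `y ≤ z`, equal or adjacent, in the closed earlier neighbourhood of `p`, in the order
in which they are met in the lists `nbr P z`. -/
noncomputable def scanPairs (P : SimpleGraph ℕ) (p : ℕ) : List (ℕ × ℕ) :=
  (nbr P p).flatMap fun z => ((nbr P z).filter (· ∈ nbr P p)).map fun y => (y, z)

theorem mem_scanPairs {P : SimpleGraph ℕ} {p y z : ℕ} :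
    (y, z) ∈ scanPairs P p ↔ z ∈ nbr P p ∧ y ∈ nbr P p ∧ y ≤ z ∧ Near P y z := by
  simp only [scanPairs, List.mem_flatMap, List.mem_map, List.mem_filter, decide_eq_true_eq,
    Prod.mk.injEq]
  constructor
  · rintro ⟨z', hz', y', ⟨h1, h2⟩, rfl, rfl⟩
    exact ⟨hz', h2, mem_nbr.1 h1⟩
  · rintro ⟨h1, h2, h3⟩
    exact ⟨z, h1, y, ⟨mem_nbr.2 h3, h2⟩, rfl, rfl⟩

theorem nodup_scanPairs (P : SimpleGraph ℕ) (p : ℕ) : (scanPairs P p).Nodup := by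
  rw [scanPairs, List.nodup_flatMap]
  refine ⟨fun z _ => ((nodup_nbr P z).filter _).map fun a b h => (Prod.mk.inj h).1, ?_⟩
  refine (nodup_nbr P p).imp fun {z z'} hne => ?_
  rw [Function.onFun, List.disjoint_left]
  rintro ⟨y, w⟩ h1 h2
  simp only [List.mem_map, Prod.mk.injEq] at h1 h2
  obtain ⟨_, _, _, rfl⟩ := h1
  obtain ⟨_, _, _, rfl⟩ := h2
  exact hne rfl

theorem length_scanPairs_le {n p : ℕ} (P : SimpleGraph ℕ) (hp : p < n) :
    (scanPairs P p).length ≤ edgeCount n P + n := by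
  have h1 : (scanPairs P p).length ≤ ((nbr P p).map fun z => (nbr P z).length).sum := by
    rw [scanPairs, List.length_flatMap]
    refine List.sum_le_sum fun z _ => ?_
    rw [List.length_map]
    exact List.length_filter_le _ _
  rw [← List.sum_toFinset _ (nodup_nbr P p)] at h1
  have h2 : (nbr P p).toFinset ⊆ Finset.range n := fun z hz => by
    have := (mem_nbr.1 (List.mem_toFinset.1 hz)).1
    exact Finset.mem_range.2 (by omega)
  refine h1.trans ((Finset.sum_le_sum_of_subset h2).trans ?_)
  simp only [nbr, List.length_append, List.length_singleton, Finset.sum_add_distrib]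
  simp [edgeCount]

/-- Execute `body` for all pairs in `scanPairs P p`, where the array `mk` marks the closed earlier
neighbourhood of `p`. The variables `y` and `z` hold the pair, and `a` the index of its slot. -/
def scan (body : Com) : Com :=
  .set .j (.rd .eo (.v .p)) ;;
  .set .je (.plus (.v .j) (.plus (.rd .el (.v .p)) (.c 1))) ;;
  .upto .j (.v .je) (
    .set .z (.rd .nb (.v .j)) ;;
    .set .a (.rd .eo (.v .z)) ;;
    .set .ie (.plus (.v .a) (.plus (.rd .el (.v .z)) (.c 1))) ;;
    .upto .a (.v .ie) (
      .set .y (.rd .nb (.v .a)) ;;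
      .ite (.eq (.rd .mk (.v .y)) (.c 0)) .nop body))

/-- The rule for `scan`: the invariant `I` depends on the list of the pairs that have been met. The
body has no loop. With at most `D` earlier neighbours of each position, each of the lists has length
at most `D + 1`; this is where the factor `d` of a round comes from. -/
theorem scan_spec {n M W D p : ℕ} {P : SimpleGraph ℕ} {σ : HState} {body : Com}
    (hM : 4 * (1 + n + edgeCount n P) ≤ M) (hW : 8 * M ≤ W) (hL : Layout n M P σ) (hp : p < n)
    (hpσ : σ.reg .p = p) (hmk : ∀ y, σ.arr .mk y ≠ 0 ↔ y ∈ nbr P p)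
    (hD : ∀ z < n, σ.arr .el z ≤ D)
    (hv : ∀ x ∈ [Var.p, .j, .je, .z, .a, .ie, .y], x ∉ body.vars)
    (ha : ∀ b ∈ [Arr.nb, .eo, .el, .mk], b ∉ body.arrs)
    (I : List (ℕ × ℕ) → HState → Prop)
    (hset : ∀ l τ, ∀ x ∈ [Var.j, .je, .z, .a, .ie, .y], ∀ v, I l τ → I l (τ.set x v))
    (htick : ∀ l τ, I l τ → I l τ.tick) (h0 : I [] σ)
    (hstep : ∀ l y z i τ, l ++ [(y, z)] <+: scanPairs P p → z < n →
      ∀ hi : i < (nbr P z).length, (nbr P z)[i] = y → Frame (scan body) σ τ → τ.reg .y = y →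
      τ.reg .z = z → τ.reg .a = σ.arr .eo z + i → I l τ →
      wp M W body (fun υ => I (l ++ [(y, z)]) υ ∧ υ.clk = τ.clk) τ) :
    wp M W (scan body) (fun τ => I (scanPairs P p) τ ∧
      τ.clk ≤ σ.clk + (σ.arr .el p + 1) * (D + 2)) σ := by
  classical
  have hlenp := hL.el p hp
  have hltp := hL.lt p hp
  simp only [scan, wp_eqs, reduceCtorEq, if_true, if_false, true_and, and_true, hpσ]
  refine ⟨by omega, by omega, ?_⟩
  set f : ℕ → List (ℕ × ℕ) := fun z => ((nbr P z).filter (· ∈ nbr P p)).map fun y => (y, z) with hf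
  have hscan : scanPairs P p = (nbr P p).flatMap f := rfl
  refine wp_upto (fun j τ => ∃ t, j = σ.arr .eo p + t ∧ t ≤ (nbr P p).length ∧
    I (((nbr P p).take t).flatMap f) τ ∧ τ.clk ≤ σ.clk + t * (D + 2))
    (σ.arr .eo p + (nbr P p).length) ?_ (by omega) ?_ ?_ ?_ ?_ ?_
  · have h1 := hv .j (by decide)
    simpa [Com.upto] using h1
  · simp
  · simp only [wp_eqs, reduceCtorEq, if_true, if_false, true_and, and_true]
    exact ⟨0, by omega, by omega, hset _ _ _ (by decide) _ (hset _ _ _ (by decide) _ h0), by omega⟩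
  · rintro τ hfr - -
    refine ⟨trivial, ?_⟩
    simp only [Ex.eval]
    rw [hfr.reg _ (by have h1 := hv .je (by decide); simpa [Com.upto] using h1)]
    simp
    omega
  · rintro τ hfr hj1 hj2 ⟨t, e0, e1, e2, e3⟩
    have hnb : τ.arr .nb = σ.arr .nb := by
      rw [hfr.arr _ (by have h1 := ha .nb (by decide); simpa [Com.upto] using h1)]; simp
    have heo : τ.arr .eo = σ.arr .eo := by
      rw [hfr.arr _ (by have h1 := ha .eo (by decide); simpa [Com.upto] using h1)]; simp
    have hel : τ.arr .el = σ.arr .el := by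
      rw [hfr.arr _ (by have h1 := ha .el (by decide); simpa [Com.upto] using h1)]; simp
    have ht : t < (nbr P p).length := by omega
    have hzt := hL.seg p hp t ht
    set z := (nbr P p)[t] with hz
    have hzp : z ∈ nbr P p := List.getElem_mem ht
    have hzn : z < n := by have := (mem_nbr.1 hzp).1; omega
    have hlenz := hL.el z hzn
    have hltz := hL.lt z hzn
    have hDz := hD z hzn
    simp only [wp_eqs, reduceCtorEq, if_true, if_false, true_and, and_true, hnb, heo, hel, e0, hzt]
    refine ⟨by omega, by omega, by omega, ?_⟩
    set prev := ((nbr P p).take t).flatMap f with hprev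
    have htake : ((nbr P p).take (t + 1)).flatMap f = prev ++ f z := by
      rw [List.take_succ_eq_append_getElem ht, List.flatMap_append]
      simp [hprev, hz]
    have hpre : prev ++ f z <+: scanPairs P p := by
      rw [← htake, hscan]
      conv_rhs => rw [← List.take_append_drop (t + 1) (nbr P p), List.flatMap_append]
      exact List.prefix_append _ _
    refine wp_upto (fun a υ => ∃ s, a = σ.arr .eo z + s ∧ s ≤ (nbr P z).length ∧
      I (prev ++ (((nbr P z).take s).filter (· ∈ nbr P p)).map fun y => (y, z)) υ ∧
      υ.clk ≤ τ.clk + 1 + s) (σ.arr .eo z + (nbr P z).length) ?_ (by omega) ?_ ?_ ?_ ?_ ?_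
    · have h1 := hv .a (by decide)
      simpa using h1
    · simp
    · simp only [wp_eqs, reduceCtorEq, if_true, if_false, true_and, and_true]
      refine ⟨0, by omega, by omega, ?_, by omega⟩
      simp only [List.take_zero, List.filter_nil, List.map_nil, List.append_nil]
      exact hset _ _ _ (by decide) _ (hset _ _ _ (by decide) _ (hset _ _ _ (by decide) _
        (htick _ _ e2)))
    · rintro υ hfu - -
      refine ⟨trivial, ?_⟩
      simp only [Ex.eval]
      rw [hfu.reg _ (by have h1 := hv .ie (by decide); simpa using h1)]
      simp
      omega
    · rintro υ hfu ha1 ha2 ⟨s, u0, u1, u2, u3⟩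
      have hnbu : υ.arr .nb = σ.arr .nb := by
        rw [hfu.arr _ (by have h1 := ha .nb (by decide); simpa using h1)]; simpa using hnb
      have hmku : υ.arr .mk = σ.arr .mk := by
        rw [hfu.arr _ (by have h1 := ha .mk (by decide); simpa using h1)]
        simp only [wp_eqs, reduceCtorEq, if_true, if_false, true_and, and_true]
        rw [hfr.arr _ (by have h1 := ha .mk (by decide); simpa [Com.upto] using h1)]
        simp
      have hzu : υ.reg .z = z := by
        rw [hfu.reg _ (by have h1 := hv .z (by decide); simpa using h1)]
        simp only [wp_eqs, reduceCtorEq, if_true, if_false, true_and, and_true]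
      have hs : s < (nbr P z).length := by omega
      have hys := hL.seg z hzn s hs
      set y := (nbr P z)[s] with hy
      have hyz := mem_nbr.1 (List.getElem_mem hs)
      have hfilt : ((nbr P z).take (s + 1)).filter (· ∈ nbr P p) =
          ((nbr P z).take s).filter (· ∈ nbr P p) ++ if y ∈ nbr P p then [y] else [] := by
        rw [List.take_succ_eq_append_getElem hs, List.filter_append, ← hy]
        simp [List.filter_cons]
      simp only [wp_eqs, reduceCtorEq, if_true, if_false, true_and, and_true, hnbu, u0, hys, hmku]
      refine ⟨by omega, by omega, fun hm => ?_, fun hm => ?_⟩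
      · have hyp : y ∉ nbr P p := fun h => (hmk y).2 h hm
        refine ⟨s + 1, by omega, by omega, ?_, by omega⟩
        rw [hfilt, if_neg hyp, List.append_nil]
        exact hset _ _ _ (by decide) _ (hset _ _ _ (by decide) _ (htick _ _ u2))
      · have hyp : y ∈ nbr P p := (hmk y).1 hm
        have hpre' : (prev ++ (((nbr P z).take s).filter (· ∈ nbr P p)).map fun y => (y, z)) ++
            [(y, z)] <+: scanPairs P p := by
          refine List.IsPrefix.trans ?_ hpre
          rw [List.append_assoc, List.prefix_append_right_inj]
          have : (((nbr P z).take (s + 1)).filter (· ∈ nbr P p)).map (fun y => (y, z)) <+: f z := by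
            rw [hf]
            exact ((List.take_prefix _ _).filter _).map _
          rwa [hfilt, if_pos hyp, List.map_append] at this
        refine wp_mono (hstep _ y z s _ hpre' hzn hs rfl ⟨fun x hx => ?_, fun b hb => ?_⟩ ?_ ?_ ?_
          (hset _ _ _ (by decide) _ (htick _ _ u2))) ?_
        · simp only [scan, Com.upto, Com.vars, List.mem_append, List.mem_singleton,
            List.not_mem_nil, not_or, not_false_eq_true, and_true, true_and] at hx
          simp only [wp_eqs, reduceCtorEq, if_true, if_false, true_and, and_true, hx]
          rw [hfu.reg x (by simp [hx])]
          simp only [wp_eqs, reduceCtorEq, if_true, if_false, true_and, and_true, hx]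
          rw [hfr.reg x (by simp [Com.upto, hx])]
          simp [hx]
        · simp only [scan, Com.upto, Com.arrs, List.mem_append, List.mem_singleton,
            List.not_mem_nil, not_or, not_false_eq_true, and_true, true_and, or_false,
            false_or] at hb
          simp only [wp_eqs, reduceCtorEq, if_true, if_false, true_and, and_true]
          rw [hfu.arr b (by simp [hb])]
          simp only [wp_eqs, reduceCtorEq, if_true, if_false, true_and, and_true]
          rw [hfr.arr b (by simp [Com.upto, hb])]
          simp
        · simp
        · simpa using hzu
        · simp; omega
        · rintro ω ⟨hI, hclk⟩
          refine ⟨s + 1, by omega, by omega, ?_, ?_⟩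
          · rw [hfilt, if_pos hyp, List.map_append, ← List.append_assoc]
            exact hset _ _ _ (by decide) _ hI
          · simp only [wp_eqs, reduceCtorEq, if_true, if_false, true_and, and_true] at hclk ⊢
            omega
    · rintro υ hfu - ⟨s, u0, u1, u2, u3⟩
      obtain rfl : s = (nbr P z).length := by omega
      rw [List.take_length] at u2
      refine ⟨t + 1, by omega, by omega, ?_, ?_⟩
      · rw [htake]
        exact hset _ _ _ (by decide) _ u2
      · have : (t + 1) * (D + 2) = t * (D + 2) + (D + 2) := by ring
        omega
  · rintro τ hfr - ⟨t, e0, e1, e2, e3⟩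
    obtain rfl : t = (nbr P p).length := by omega
    rw [List.take_length] at e2
    exact ⟨e2, by rw [hlenp]; exact e3⟩

/-! ### A greedy clique among the unlabelled edges at a position -/

theorem nbr_sorted (P : SimpleGraph ℕ) (z : ℕ) : (nbr P z).Pairwise (· < ·) := by
  rw [nbr, List.pairwise_append]
  refine ⟨List.pairwise_lt_range.filter _, List.pairwise_singleton _ _, fun a ha b hb => ?_⟩
  rw [List.mem_singleton.1 hb]
  exact (mem_earlier.1 ha).1

theorem take_nbr (P : SimpleGraph ℕ) (z : ℕ) {t : ℕ} (ht : t + 1 = (nbr P z).length) :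
    (nbr P z).take t = earlier P z z := by
  simp only [nbr, List.length_append, List.length_singleton, Nat.add_right_cancel_iff] at ht
  simp [nbr, ht]

/-- Let `X` be a maximal clique among the earlier neighbours of `p` whose edge to `p` is not
labelled yet, found by trying them in order. Since the later vertex of an edge knows the earlier
one, a new vertex is compared with `X` by counting its earlier neighbours in `X`. -/
def buildX : Com :=
  .set .xn (.c 0) ;;
  .set .j (.rd .eo (.v .p)) ;;
  .set .je (.plus (.v .j) (.rd .el (.v .p))) ;;
  .upto .j (.v .je) (
    .set .z (.rd .nb (.v .j)) ;;
    .ite (.eq (.rd .lab (.v .j)) (.c 0)) (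
      .set .s (.c 0) ;;
      .set .a (.rd .eo (.v .z)) ;;
      .set .ie (.plus (.v .a) (.rd .el (.v .z))) ;;
      .upto .a (.v .ie) (
        .set .s (.plus (.v .s) (.rd .inX (.rd .nb (.v .a))))) ;;
      .ite (.eq (.v .s) (.v .xn)) (
        .put .inX (.v .z) (.c 1) ;;
        .set .xn (.plus (.v .xn) (.c 1))) .nop) .nop)

theorem buildX_spec {n M W D p : ℕ} {P : SimpleGraph ℕ} {σ : HState} {lam : ℕ → ℕ → ℕ}
    (hM : 4 * (1 + n) ≤ M) (hW : 8 * M ≤ W) (hL : Layout n M P σ) (hp : p < n)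
    (hpσ : σ.reg .p = p) (hD : ∀ z < n, σ.arr .el z ≤ D)
    (hlab : Seg (σ.arr .lab) (σ.arr .eo p) ((nbr P p).map fun y => lam y p))
    (hX0 : ∀ x, σ.arr .inX x = 0) :
    wp M W buildX (fun τ => ∃ X : Finset ℕ, (∀ x ∈ X, x ∈ earlier P p p ∧ lam x p = 0) ∧
      (∀ x ∈ X, ∀ y ∈ X, Near P x y) ∧
      (∀ w ∈ earlier P p p, lam w p = 0 → w ∉ X → ∃ x ∈ X, ¬ Near P x w) ∧
      (∀ x, τ.arr .inX x = if x ∈ X then 1 else 0) ∧ τ.reg .xn = X.card ∧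
      τ.clk ≤ σ.clk + σ.arr .el p * (D + 1)) σ := by
  classical
  have hlenp := hL.el p hp
  have hltp := hL.lt p hp
  simp only [buildX, wp_eqs, reduceCtorEq, if_true, if_false, true_and, and_true, hpσ]
  refine ⟨by omega, by omega, by omega, ?_⟩
  refine wp_upto (fun j τ => ∃ t, j = σ.arr .eo p + t ∧ t ≤ σ.arr .el p ∧ ∃ X : Finset ℕ,
      (∀ x ∈ X, x ∈ (nbr P p).take t ∧ lam x p = 0) ∧
      (∀ x ∈ X, ∀ y ∈ X, Near P x y) ∧
      (∀ w ∈ (nbr P p).take t, lam w p = 0 → w ∉ X → ∃ x ∈ X, ¬ Near P x w) ∧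
      (∀ x, τ.arr .inX x = if x ∈ X then 1 else 0) ∧ τ.reg .xn = X.card ∧
      τ.clk ≤ σ.clk + t * (D + 1)) (σ.arr .eo p + σ.arr .el p) (by decide) (by omega) ?_ ?_ ?_ ?_ ?_
  · simp
  · simp only [wp_eqs, reduceCtorEq, if_true, if_false, true_and, and_true]
    exact ⟨0, by omega, by omega, ∅, by simp [hX0]⟩
  · rintro τ hf - -
    refine ⟨trivial, ?_⟩
    simp only [Ex.eval]
    rw [hf.reg _ (by decide)]
    simp
  · rintro τ hf hj1 hj2 ⟨t, e0, e1, X, x1, x2, x3, x4, x5, x6⟩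
    have hnb : τ.arr .nb = σ.arr .nb := by rw [hf.arr _ (by decide)]; simp
    have heo : τ.arr .eo = σ.arr .eo := by rw [hf.arr _ (by decide)]; simp
    have hel : τ.arr .el = σ.arr .el := by rw [hf.arr _ (by decide)]; simp
    have hla : τ.arr .lab = σ.arr .lab := by rw [hf.arr _ (by decide)]; simp
    have ht : t < (nbr P p).length := by omega
    have hzt := hL.seg p hp t ht
    have hlt := hlab t (by simpa using ht)
    rw [List.getElem_map] at hlt
    set z := (nbr P p)[t] with hz
    have hzp : z ∈ nbr P p := List.getElem_mem ht
    have hzn : z < n := by have := (mem_nbr.1 hzp).1; omega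
    have hlenz := hL.el z hzn
    have hltz := hL.lt z hzn
    have hDz := hD z hzn
    have htake : (nbr P p).take (t + 1) = (nbr P p).take t ++ [z] := by
      rw [List.take_succ_eq_append_getElem ht]
    have hmul : (t + 1) * (D + 1) = t * (D + 1) + (D + 1) := by ring
    -- `nbr` is sorted, so the elements of `X` that are adjacent to `z` are in the list of `z`.
    have hxz : ∀ x ∈ X, x < z := fun x hx => by
      obtain ⟨i, hi, hxi⟩ := List.getElem_of_mem (x1 x hx).1
      rw [List.getElem_take] at hxi
      rw [List.length_take] at hi
      rw [← hxi, hz]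
      exact (List.pairwise_iff_getElem.1 (nbr_sorted P p)) _ _ _ _ (by omega)
    have hXn : X.card ≤ n := by
      have : X ⊆ Finset.range n := fun x hx => Finset.mem_range.2 ((hxz x hx).trans hzn)
      simpa using Finset.card_le_card this
    simp only [wp_eqs, reduceCtorEq, if_true, if_false, true_and, and_true, hnb, heo, hel, hla, e0,
      hzt, hlt]
    refine ⟨by omega, by omega, fun hz0 => ?_, fun hz0 => ?_⟩
    · refine ⟨by omega, by omega, by omega, ?_⟩
      refine wp_upto (fun a υ => ∃ s, a = σ.arr .eo z + s ∧ s ≤ σ.arr .el z ∧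
          υ.reg .s = (X.filter (· ∈ (nbr P z).take s)).card ∧ υ.clk = τ.clk + 1 + s)
          (σ.arr .eo z + σ.arr .el z) (by decide) (by omega) ?_ ?_ ?_ ?_ ?_
      · simp
      · simp only [wp_eqs, reduceCtorEq, if_true, if_false, true_and, and_true]
        exact ⟨0, by omega, by omega, by simp, by omega⟩
      · rintro υ hfu - -
        refine ⟨trivial, ?_⟩
        simp only [Ex.eval]
        rw [hfu.reg _ (by decide)]
        simp
      · rintro υ hfu ha1 ha2 ⟨s, u0, u1, u2, u3⟩
        have hnbu : υ.arr .nb = σ.arr .nb := by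
          rw [hfu.arr _ (by decide)]; simpa using hnb
        have hXu : υ.arr .inX = τ.arr .inX := by rw [hfu.arr _ (by decide)]; simp
        have hs : s < (nbr P z).length := by omega
        have hys := hL.seg z hzn s hs
        have hyz := mem_nbr.1 (List.getElem_mem hs)
        have htk : (nbr P z).take (s + 1) = (nbr P z).take s ++ [(nbr P z)[s]] :=
          List.take_succ_eq_append_getElem hs
        have hynot : (nbr P z)[s] ∉ (nbr P z).take s := fun hmem => by
          have hnd := (nodup_nbr P z).sublist (List.take_sublist (s + 1) _)
          rw [htk] at hnd
          exact (List.nodup_append.1 hnd).2.2 _ hmem _ (by simp) rfl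
        set y := (nbr P z)[s] with hy
        have hcard : (X.filter (· ∈ (nbr P z).take (s + 1))).card =
            (X.filter (· ∈ (nbr P z).take s)).card + if y ∈ X then 1 else 0 := by
          rw [htk]
          split_ifs with hyX
          · rw [← Finset.card_insert_of_notMem (a := y) (by simp [hynot])]
            congr 1
            ext x
            simp only [Finset.mem_filter, List.mem_append, List.mem_singleton, Finset.mem_insert]
            constructor
            · rintro ⟨h1, h2 | h2⟩
              · exact Or.inr ⟨h1, h2⟩
              · exact Or.inl h2
            · rintro (rfl | ⟨h1, h2⟩)
              · exact ⟨hyX, Or.inr rfl⟩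
              · exact ⟨h1, Or.inl h2⟩
          · rw [add_zero]
            congr 1
            ext x
            simp only [Finset.mem_filter, List.mem_append, List.mem_singleton]
            refine and_congr_right fun hx => or_iff_left ?_
            rintro rfl
            exact hyX hx
        have hle := Finset.card_le_card (Finset.filter_subset (· ∈ (nbr P z).take (s + 1)) X)
        simp only [wp_eqs, reduceCtorEq, if_true, if_false, true_and, and_true, hnbu, hXu, u0, u2,
          hys, x4]
        refine ⟨by omega, s + 1, by omega, by omega, hcard.symm, by omega⟩
      · rintro υ hfu - ⟨s, u0, u1, u2, u3⟩
        obtain rfl : s = σ.arr .el z := by omega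
        rw [take_nbr P z hlenz] at u2
        have hXu : υ.arr .inX = τ.arr .inX := by rw [hfu.arr _ (by decide)]; simp
        have hxnu : υ.reg .xn = τ.reg .xn := by
          rw [hfu.reg _ (by decide)]; simp
        have hzu : υ.reg .z = z := by rw [hfu.reg _ (by decide)]; simp
        have hiff : (X.filter (· ∈ earlier P z z)).card = X.card ↔ ∀ x ∈ X, P.Adj x z := by
          rw [Finset.card_filter_eq_iff]
          exact forall₂_congr fun x hx => by
            rw [mem_earlier]; exact and_iff_right (hxz x hx)
        simp only [wp_eqs, reduceCtorEq, if_true, if_false, true_and, and_true, hxnu, hzu, x5, u2,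
          hiff]
        refine ⟨fun hadj => ⟨by omega, by omega, by omega, t + 1, by omega, by omega, insert z X,
          ?_⟩,
          fun hadj => ⟨t + 1, by omega, by omega, X, ?_⟩⟩
        · have hzX : z ∉ X := fun h => (hxz z h).ne rfl
          refine ⟨?_, ?_, ?_, ?_, ?_, by omega⟩
          · intro x hx
            rw [htake, List.mem_append, List.mem_singleton]
            rcases Finset.mem_insert.1 hx with rfl | hx
            · exact ⟨Or.inr rfl, hz0⟩
            · exact ⟨Or.inl (x1 x hx).1, (x1 x hx).2⟩
          · intro x hx y hy
            rcases Finset.mem_insert.1 hx with rfl | hx <;>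
              rcases Finset.mem_insert.1 hy with rfl | hy
            · exact Near.refl _ _
            · exact Or.inr (hadj y hy).symm
            · exact Or.inr (hadj x hx)
            · exact x2 x hx y hy
          · intro w hw hw0 hwX
            rw [Finset.mem_insert, not_or] at hwX
            rw [htake, List.mem_append, List.mem_singleton] at hw
            obtain ⟨x, hx, hxw⟩ := x3 w (hw.resolve_right hwX.1) hw0 hwX.2
            exact ⟨x, Finset.mem_insert_of_mem hx, hxw⟩
          · intro x
            simp only [hXu, Function.update_apply, Finset.mem_insert, x4]
            by_cases h : x = z <;> simp [h]
          · rw [Finset.card_insert_of_notMem hzX]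
        · refine ⟨?_, x2, ?_, by rw [hXu]; exact x4, rfl, by omega⟩
          · intro x hx
            rw [htake, List.mem_append]
            exact ⟨Or.inl (x1 x hx).1, (x1 x hx).2⟩
          · intro w hw hw0 hwX
            rw [htake, List.mem_append, List.mem_singleton] at hw
            rcases hw with hw | rfl
            · exact x3 w hw hw0 hwX
            · simp only [not_forall] at hadj
              obtain ⟨x, hx, hxz'⟩ := hadj
              exact ⟨x, hx, fun h => h.elim (fun h => hwX (h ▸ hx)) hxz'⟩
    · refine ⟨t + 1, by omega, by omega, X, ?_, x2, ?_, x4, x5, by omega⟩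
      · intro x hx
        rw [htake, List.mem_append]
        exact ⟨Or.inl (x1 x hx).1, (x1 x hx).2⟩
      · intro w hw hw0 hwX
        rw [htake, List.mem_append, List.mem_singleton] at hw
        rcases hw with hw | rfl
        · exact x3 w hw hw0 hwX
        · exact absurd hw0 hz0
  · rintro τ hf - ⟨t, e0, e1, X, x1, x2, x3, x4, x5, x6⟩
    obtain rfl : t = σ.arr .el p := by omega
    rw [take_nbr P p hlenp] at x1 x3
    exact ⟨X, x1, x2, x3, x4, x5, x6⟩

/-! ### Searching a clique that is compatible with the new one -/

/-- Let `g z` be the number of elements of `X` equal or adjacent to `z`. A pair counts for both of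
its entries, but only once if they are equal. -/
def countX : Com := scan (
  .put .g (.v .z) (.plus (.rd .g (.v .z)) (.rd .inX (.v .y))) ;;
  .ite (.eq (.v .y) (.v .z)) .nop
    (.put .g (.v .y) (.plus (.rd .g (.v .y)) (.rd .inX (.v .z)))))

open Classical in
theorem countX_spec {n M W D p : ℕ} {P : SimpleGraph ℕ} {σ : HState} {X : Finset ℕ}
    (hM : 4 * (1 + n + edgeCount n P) ≤ M) (hW : 8 * M ≤ W) (hL : Layout n M P σ) (hp : p < n)
    (hpσ : σ.reg .p = p) (hmk : ∀ y, σ.arr .mk y ≠ 0 ↔ y ∈ nbr P p)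
    (hD : ∀ z < n, σ.arr .el z ≤ D) (hX : ∀ x, σ.arr .inX x = if x ∈ X then 1 else 0)
    (hXp : ∀ x ∈ X, x ∈ nbr P p) (hg : ∀ x, σ.arr .g x = 0) :
    wp M W countX (fun τ => (∀ w, w ∉ nbr P p → τ.arr .g w = 0) ∧
      (∀ w ∈ nbr P p, τ.arr .g w = (X.filter fun x => Near P x w).card) ∧
      τ.clk ≤ σ.clk + (σ.arr .el p + 1) * (D + 2)) σ := by
  refine wp_mono (scan_spec hM hW hL hp hpσ hmk hD (by decide) (by decide)
    (fun l τ => ∀ w, τ.arr .g w = l.countP (fun e => e.2 = w ∧ e.1 ∈ X) +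
      l.countP (fun e => e.1 = w ∧ e.2 ∈ X ∧ e.1 ≠ e.2))
    (fun l τ x _ v h => h) (fun l τ h => h) (by simpa using hg) ?_) ?_
  · intro l y z i τ hpre hz hi hiy hf hy hzτ ha hI
    have hinX : τ.arr .inX = σ.arr .inX := hf.arr _ (by decide)
    have hlen := hpre.length_le
    have hlen' := length_scanPairs_le P hp
    rw [List.length_append, List.length_singleton] at hlen
    have hyn : y ≤ z := by
      rw [← hiy]; exact (mem_nbr.1 (List.getElem_mem hi)).1
    have b1 : ∀ w, τ.arr .g w + 2 < W := fun w => by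
      have h1 := List.countP_le_length (p := fun e : ℕ × ℕ => e.2 = w ∧ e.1 ∈ X) (l := l)
      have h2 := List.countP_le_length (p := fun e : ℕ × ℕ => e.1 = w ∧ e.2 ∈ X ∧ e.1 ≠ e.2)
        (l := l)
      have := hI w
      omega
    have b2 := b1 z
    have b3 := b1 y
    have hgoal : ∀ w, (l ++ [(y, z)]).countP (fun e => e.2 = w ∧ e.1 ∈ X) +
        (l ++ [(y, z)]).countP (fun e => e.1 = w ∧ e.2 ∈ X ∧ e.1 ≠ e.2) =
        τ.arr .g w + (if z = w ∧ y ∈ X then 1 else 0) +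
          if y = w ∧ z ∈ X ∧ y ≠ z then 1 else 0 := by
      intro w
      rw [hI w, List.countP_append, List.countP_append, List.countP_singleton,
        List.countP_singleton]
      simp only [decide_eq_true_eq]
      ring
    simp only [hgoal]
    simp only [wp_eqs, reduceCtorEq, if_true, if_false, true_and, and_true, hy, hzτ, hinX, hX]
    have c1 : ∀ x, (if x ∈ X then 1 else 0) ≤ 1 := fun x => by split_ifs <;> omega
    have c2 := c1 y
    have c3 := c1 z
    refine ⟨by omega, by omega, fun hyz w => ?_, fun hyz => ⟨?_, by omega, fun w => ?_⟩⟩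
    · simp only [hyz, Function.update_apply, eq_comm (a := w), ne_eq, not_true_eq_false, and_false,
        if_false, add_zero]
      by_cases h : z = w
      · subst h; simp
      · simp [h]
    · rw [Function.update_of_ne hyz]
      omega
    · simp only [Function.update_of_ne hyz]
      simp only [Function.update_apply, eq_comm (a := w), ne_eq, hyz, not_false_eq_true, and_true]
      by_cases h1 : y = w
      · subst h1
        simp [Ne.symm hyz]
      · by_cases h2 : z = w
        · subst h2; simp [h1]
        · simp [h1, h2]
  · rintro τ ⟨h1, h2⟩
    have key : ∀ (w : ℕ) (q : ℕ × ℕ → Prop) [DecidablePred q],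
        (scanPairs P p).countP (fun e => q e) = ((scanPairs P p).toFinset.filter q).card := by
      intro w q _
      rw [List.countP_eq_length_filter,
        ← List.toFinset_card_of_nodup ((nodup_scanPairs P p).filter _),
        List.toFinset_filter]
      simp
    refine ⟨fun w hw => ?_, fun w hw => ?_, h2⟩
    · rw [h1 w, Nat.add_eq_zero_iff, List.countP_eq_zero, List.countP_eq_zero]
      constructor
      · rintro ⟨y, z⟩ he
        simp only [decide_eq_true_eq]
        rintro ⟨rfl, -⟩
        exact hw (mem_scanPairs.1 he).1
      · rintro ⟨y, z⟩ he
        simp only [decide_eq_true_eq]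
        rintro ⟨rfl, -⟩
        exact hw (mem_scanPairs.1 he).2.1
    · rw [h1 w, key w, key w]
      have e1 : ((scanPairs P p).toFinset.filter fun e => e.2 = w ∧ e.1 ∈ X).card =
          (X.filter fun x => Near P x w ∧ x ≤ w).card := by
        refine Finset.card_nbij' (fun e => e.1) (fun x => (x, w)) ?_ ?_ ?_ ?_
        · rintro ⟨y, z⟩ he
          simp only [Finset.coe_filter, List.mem_toFinset, Set.mem_ofPred_eq] at he ⊢
          obtain ⟨he, rfl, hy⟩ := he
          have := mem_scanPairs.1 he
          exact ⟨hy, this.2.2.2, this.2.2.1⟩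
        · intro x hx
          simp only [Finset.coe_filter, List.mem_toFinset, Set.mem_ofPred_eq] at hx ⊢
          exact ⟨mem_scanPairs.2 ⟨hw, hXp x hx.1, hx.2.2, hx.2.1⟩, trivial, hx.1⟩
        · rintro ⟨y, z⟩ he
          simp only [Finset.coe_filter, List.mem_toFinset, Set.mem_ofPred_eq] at he ⊢
          rw [he.2.1]
        · intro x _
          rfl
      have e2 : ((scanPairs P p).toFinset.filter fun e => e.1 = w ∧ e.2 ∈ X ∧ e.1 ≠ e.2).card =
          (X.filter fun x => Near P x w ∧ ¬ x ≤ w).card := by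
        refine Finset.card_nbij' (fun e => e.2) (fun x => (w, x)) ?_ ?_ ?_ ?_
        · rintro ⟨y, z⟩ he
          simp only [Finset.coe_filter, List.mem_toFinset, Set.mem_ofPred_eq] at he ⊢
          obtain ⟨he, rfl, hz, hne⟩ := he
          have := mem_scanPairs.1 he
          exact ⟨hz, this.2.2.2.symm, by omega⟩
        · intro x hx
          simp only [Finset.coe_filter, List.mem_toFinset, Set.mem_ofPred_eq] at hx ⊢
          exact ⟨mem_scanPairs.2 ⟨hXp x hx.1, hw, by omega, hx.2.1.symm⟩, trivial, hx.1, by omega⟩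
        · rintro ⟨y, z⟩ he
          simp only [Finset.coe_filter, List.mem_toFinset, Set.mem_ofPred_eq] at he ⊢
          rw [he.2.1]
        · intro x _
          rfl
      rw [e1, e2, ← Finset.filter_filter, ← Finset.filter_filter,
        Finset.card_filter_add_card_filter_not]

/-- The array `lab` holds the labels of the edges, in the slots of `nbr`. -/
def Labels (n : ℕ) (P : SimpleGraph ℕ) (eo lab : ℕ → ℕ) (lam : ℕ → ℕ → ℕ) : Prop :=
  ∀ z < n, ∀ (i : ℕ) (h : i < (nbr P z).length), lab (eo z + i) = lam (nbr P z)[i] z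

/-- Let `cnt c` be the number of edges with label `c` among the positions whose value of `g` is
`xn`. -/
def countLab : Com := scan (
  .ite (.eq (.rd .g (.v .z)) (.v .xn)) (
    .ite (.eq (.rd .g (.v .y)) (.v .xn)) (
      .put .cnt (.rd .lab (.v .a)) (.plus (.rd .cnt (.rd .lab (.v .a))) (.c 1))) .nop) .nop)

/-- Let `sel` be a label all of whose edges have been counted by `countLab`, if there is one that is
met in the scan, and `0` otherwise. It is enough to look there, because a clique that is near all of
`p` and `X` lies in the closed earlier neighbourhood of `p`. -/
def select : Com := scan (
  .ite (.eq (.rd .g (.v .z)) (.v .xn)) (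
    .ite (.eq (.rd .g (.v .y)) (.v .xn)) (
      .ite (.eq (.rd .cnt (.rd .lab (.v .a))) (.rd .tot (.rd .lab (.v .a)))) (
        .set .sel (.rd .lab (.v .a))) .nop) .nop) .nop)

/-- Clear the counters, at the places where they have been used. -/
def reset : Com := scan (
  .put .cnt (.rd .lab (.v .a)) (.c 0) ;;
  .put .g (.v .y) (.c 0))

section Passes

variable {n M W D p : ℕ} {P : SimpleGraph ℕ} {σ : HState} {lam : ℕ → ℕ → ℕ}

open Classical in
/-- The pairs of `scanPairs` with label `c` all of whose entries satisfy `G`. -/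
noncomputable def goodPairs (P : SimpleGraph ℕ) (lam : ℕ → ℕ → ℕ) (p : ℕ) (G : ℕ → Prop) (c : ℕ) :
    Finset (ℕ × ℕ) :=
  (scanPairs P p).toFinset.filter fun e => lam e.1 e.2 = c ∧ G e.1 ∧ G e.2

open Classical in
theorem countLab_spec (hM : 4 * (1 + n + edgeCount n P) ≤ M) (hW : 8 * M ≤ W)
    (hL : Layout n M P σ) (hp : p < n) (hpσ : σ.reg .p = p)
    (hmk : ∀ y, σ.arr .mk y ≠ 0 ↔ y ∈ nbr P p) (hD : ∀ z < n, σ.arr .el z ≤ D)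
    (hlab : Labels n P (σ.arr .eo) (σ.arr .lab) lam) (hlam : ∀ y z, lam y z < M)
    (hcnt : ∀ c, σ.arr .cnt c = 0) :
    wp M W countLab (fun τ => (∀ c, τ.arr .cnt c =
        (goodPairs P lam p (fun w => σ.arr .g w = σ.reg .xn) c).card) ∧
      τ.clk ≤ σ.clk + (σ.arr .el p + 1) * (D + 2)) σ := by
  refine wp_mono (scan_spec hM hW hL hp hpσ hmk hD (by decide) (by decide)
    (fun l τ => ∀ c, τ.arr .cnt c = l.countP (fun e => lam e.1 e.2 = c ∧
      σ.arr .g e.1 = σ.reg .xn ∧ σ.arr .g e.2 = σ.reg .xn))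
    (fun l τ x _ v h => h) (fun l τ h => h) (by simpa using hcnt) ?_) ?_
  · intro l y z i τ hpre hz hi hiy hf hy hzτ ha hI
    have hg : τ.arr .g = σ.arr .g := hf.arr _ (by decide)
    have hla : τ.arr .lab = σ.arr .lab := hf.arr _ (by decide)
    have hxn : τ.reg .xn = σ.reg .xn := hf.reg _ (by decide)
    have hlen := hpre.length_le
    have hlen' := length_scanPairs_le P hp
    rw [List.length_append, List.length_singleton] at hlen
    have hyn : y ≤ z := by
      rw [← hiy]; exact (mem_nbr.1 (List.getElem_mem hi)).1
    have hle := hL.lt z hz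
    have hel := hL.el z hz
    have hl := hlab z hz i hi
    rw [hiy] at hl
    have hlM := hlam y z
    have b1 : ∀ c, τ.arr .cnt c + 1 < W := fun c => by
      have h1 := List.countP_le_length (p := fun e : ℕ × ℕ => lam e.1 e.2 = c ∧
        σ.arr .g e.1 = σ.reg .xn ∧ σ.arr .g e.2 = σ.reg .xn) (l := l)
      have := hI c
      omega
    have b2 := b1 (lam y z)
    simp only [List.countP_append, List.countP_singleton, ← hI]
    simp only [wp_eqs, reduceCtorEq, if_true, if_false, true_and, and_true, hy, hzτ, hg, hla, hxn,
      ha, hl, decide_eq_true_eq]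
    refine ⟨by omega, fun h1 => ⟨by omega, fun h2 => ⟨by omega, by omega, by omega, fun c => ?_⟩,
      fun h2 => ?_⟩, fun h1 => ?_⟩
    · simp only [Function.update_apply, h1, h2, and_true, eq_comm (a := c)]
      by_cases h : lam y z = c
      · subst h; simp
      · simp [h]
    · simp [h2]
    · simp [h1]
  · rintro τ ⟨h1, h2⟩
    refine ⟨fun c => ?_, h2⟩
    rw [h1, List.countP_eq_length_filter,
      ← List.toFinset_card_of_nodup ((nodup_scanPairs P p).filter _), List.toFinset_filter,
      goodPairs]
    congr 1
    ext e
    simp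

theorem select_spec (hM : 4 * (1 + n + edgeCount n P) ≤ M) (hW : 8 * M ≤ W)
    (hL : Layout n M P σ) (hp : p < n) (hpσ : σ.reg .p = p)
    (hmk : ∀ y, σ.arr .mk y ≠ 0 ↔ y ∈ nbr P p) (hD : ∀ z < n, σ.arr .el z ≤ D)
    (hlab : Labels n P (σ.arr .eo) (σ.arr .lab) lam) (hlam : ∀ y z, lam y z < M)
    (hsel : σ.reg .sel = 0) :
    wp M W select (fun τ => ((τ.reg .sel = 0 ∧ ∀ e ∈ scanPairs P p,
        σ.arr .g e.1 = σ.reg .xn → σ.arr .g e.2 = σ.reg .xn →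
          σ.arr .cnt (lam e.1 e.2) ≠ σ.arr .tot (lam e.1 e.2)) ∨
      ∃ e ∈ scanPairs P p, σ.arr .g e.1 = σ.reg .xn ∧ σ.arr .g e.2 = σ.reg .xn ∧
          σ.arr .cnt (lam e.1 e.2) = σ.arr .tot (lam e.1 e.2) ∧ τ.reg .sel = lam e.1 e.2) ∧
      τ.clk ≤ σ.clk + (σ.arr .el p + 1) * (D + 2)) σ := by
  refine scan_spec hM hW hL hp hpσ hmk hD (by decide) (by decide)
    (fun l τ => (τ.reg .sel = 0 ∧ ∀ e ∈ l,
        σ.arr .g e.1 = σ.reg .xn → σ.arr .g e.2 = σ.reg .xn →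
          σ.arr .cnt (lam e.1 e.2) ≠ σ.arr .tot (lam e.1 e.2)) ∨
      ∃ e ∈ l, σ.arr .g e.1 = σ.reg .xn ∧ σ.arr .g e.2 = σ.reg .xn ∧
          σ.arr .cnt (lam e.1 e.2) = σ.arr .tot (lam e.1 e.2) ∧ τ.reg .sel = lam e.1 e.2)
    (fun l τ x hx v h => ?_) (fun l τ h => h) (Or.inl ⟨hsel, by simp⟩) ?_
  · have : Var.sel ≠ x := by rintro rfl; exact absurd hx (by decide)
    simpa [this] using h
  · intro l y z i τ hpre hz hi hiy hf hy hzτ ha hI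
    have hg : τ.arr .g = σ.arr .g := hf.arr _ (by decide)
    have hla : τ.arr .lab = σ.arr .lab := hf.arr _ (by decide)
    have hcn : τ.arr .cnt = σ.arr .cnt := hf.arr _ (by decide)
    have hto : τ.arr .tot = σ.arr .tot := hf.arr _ (by decide)
    have hxn : τ.reg .xn = σ.reg .xn := hf.reg _ (by decide)
    have hyn : y ≤ z := by
      rw [← hiy]; exact (mem_nbr.1 (List.getElem_mem hi)).1
    have hle := hL.lt z hz
    have hel := hL.el z hz
    have hl := hlab z hz i hi
    rw [hiy] at hl
    have hlM := hlam y z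
    have hskip : (σ.arr .g y = σ.reg .xn → σ.arr .g z = σ.reg .xn →
        σ.arr .cnt (lam y z) ≠ σ.arr .tot (lam y z)) →
        ((τ.reg .sel = 0 ∧ ∀ e ∈ l ++ [(y, z)],
          σ.arr .g e.1 = σ.reg .xn → σ.arr .g e.2 = σ.reg .xn →
            σ.arr .cnt (lam e.1 e.2) ≠ σ.arr .tot (lam e.1 e.2)) ∨
        ∃ e ∈ l ++ [(y, z)], σ.arr .g e.1 = σ.reg .xn ∧ σ.arr .g e.2 = σ.reg .xn ∧
            σ.arr .cnt (lam e.1 e.2) = σ.arr .tot (lam e.1 e.2) ∧ τ.reg .sel = lam e.1 e.2) := by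
      intro hno
      rcases hI with ⟨h1, h2⟩ | ⟨e, he, h⟩
      · refine Or.inl ⟨h1, fun e he => ?_⟩
        rcases List.mem_append.1 he with he | he
        · exact h2 e he
        · rw [List.mem_singleton.1 he]; exact hno
      · exact Or.inr ⟨e, List.mem_append_left _ he, h⟩
    simp only [wp_eqs, reduceCtorEq, if_true, if_false, true_and, and_true, hy, hzτ, hg, hla, hxn,
      hcn, hto, ha, hl]
    refine ⟨by omega, fun h1 => ⟨by omega, fun h2 => ⟨by omega, fun h3 => ⟨by omega, ?_⟩,
      fun h3 => hskip fun _ _ => h3⟩, fun h2 => hskip fun h => absurd h h2⟩,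
      fun h1 => hskip fun _ h => absurd h h1⟩
    exact Or.inr ⟨(y, z), by simp, h2, h1, h3, rfl⟩

theorem reset_spec (hM : 4 * (1 + n + edgeCount n P) ≤ M) (hW : 8 * M ≤ W)
    (hL : Layout n M P σ) (hp : p < n) (hpσ : σ.reg .p = p)
    (hmk : ∀ y, σ.arr .mk y ≠ 0 ↔ y ∈ nbr P p) (hD : ∀ z < n, σ.arr .el z ≤ D)
    (hlab : Labels n P (σ.arr .eo) (σ.arr .lab) lam) (hlam : ∀ y z, lam y z < M)
    (hg : ∀ w, w ∉ nbr P p → σ.arr .g w = 0) {G : ℕ → Prop}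
    (hcnt : ∀ c, σ.arr .cnt c = (goodPairs P lam p G c).card) :
    wp M W reset (fun τ => (∀ c, τ.arr .cnt c = 0) ∧ (∀ w, τ.arr .g w = 0) ∧
      τ.clk ≤ σ.clk + (σ.arr .el p + 1) * (D + 2)) σ := by
  classical
  refine wp_mono (scan_spec hM hW hL hp hpσ hmk hD (by decide) (by decide)
    (fun l τ => (∀ c, τ.arr .cnt c = 0 ∨ τ.arr .cnt c = σ.arr .cnt c ∧ ∀ e ∈ l, lam e.1 e.2 ≠ c) ∧
      ∀ w, τ.arr .g w = 0 ∨ τ.arr .g w = σ.arr .g w ∧ ∀ e ∈ l, e.1 ≠ w)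
    (fun l τ x _ v h => h) (fun l τ h => h) (by simp) ?_) ?_
  · intro l y z i τ hpre hz hi hiy hf hy hzτ ha ⟨hI1, hI2⟩
    have hla : τ.arr .lab = σ.arr .lab := hf.arr _ (by decide)
    have hyn : y ≤ z := by
      rw [← hiy]; exact (mem_nbr.1 (List.getElem_mem hi)).1
    have hle := hL.lt z hz
    have hel := hL.el z hz
    have hl := hlab z hz i hi
    rw [hiy] at hl
    have hlM := hlam y z
    simp only [wp_eqs, reduceCtorEq, if_true, if_false, true_and, and_true, hy, hzτ, hla, ha, hl]
    refine ⟨by omega, by omega, by omega, by omega, by omega, fun c => ?_, fun w => ?_⟩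
    · by_cases h : c = lam y z
      · subst h; simp
      · rw [Function.update_of_ne h]
        refine (hI1 c).imp_right fun h' => ⟨h'.1, fun e he => ?_⟩
        rcases List.mem_append.1 he with he | he
        · exact h'.2 e he
        · rw [List.mem_singleton.1 he]; exact Ne.symm h
    · by_cases h : w = y
      · subst h; simp
      · rw [Function.update_of_ne h]
        refine (hI2 w).imp_right fun h' => ⟨h'.1, fun e he => ?_⟩
        rcases List.mem_append.1 he with he | he
        · exact h'.2 e he
        · rw [List.mem_singleton.1 he]; exact Ne.symm h
  · rintro τ ⟨⟨h1, h2⟩, h3⟩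
    refine ⟨fun c => ?_, fun w => ?_, h3⟩
    · rcases h1 c with h | ⟨h, hno⟩
      · exact h
      · rw [h, hcnt, Finset.card_eq_zero, goodPairs, Finset.filter_eq_empty_iff]
        intro e he he'
        exact hno e (List.mem_toFinset.1 he) he'.1
    · rcases h2 w with h | ⟨h, hno⟩
      · exact h
      · rw [h]
        refine hg w fun hw => hno (w, w) (mem_scanPairs.2 ⟨hw, hw, le_rfl, Near.refl _ _⟩) rfl

/-- A counter of `countLab` reaches the total number of edges with this label if and only if all
endpoints of these edges are in the closed earlier neighbourhood of `p` and satisfy `G`. -/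
theorem card_goodPairs {k : ℕ} (h : IsCover P lam k) (hn : ∀ y z, P.Adj y z → y < n)
    {G : ℕ → Prop} {c : ℕ} (hc : c ≠ 0) :
    (goodPairs P lam p G c).card = (labelled n lam c).card ↔
      ∀ x, Inc lam c x → x ∈ nbr P p ∧ G x := by
  have hsub : goodPairs P lam p G c ⊆ labelled n lam c := by
    rintro ⟨y, z⟩ he
    simp only [goodPairs, Finset.mem_filter, List.mem_toFinset] at he
    have hs := h.supp (he.2.1 ▸ hc)
    exact mem_labelled.2 ⟨hn y z hs.2, hn z y hs.2.symm, he.2.1⟩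
  have hmem : ∀ y z, lam y z = c → (y, z) ∈ labelled n lam c := fun y z hyz => by
    have hs := h.supp (hyz ▸ hc)
    exact mem_labelled.2 ⟨hn y z hs.2, hn z y hs.2.symm, hyz⟩
  have key : ∀ y z, (y, z) ∈ goodPairs P lam p G c → (y ∈ nbr P p ∧ G y) ∧ z ∈ nbr P p ∧ G z := by
    intro y z he
    simp only [goodPairs, Finset.mem_filter, List.mem_toFinset] at he
    have := mem_scanPairs.1 he.1
    exact ⟨⟨this.2.1, he.2.2.1⟩, this.1, he.2.2.2⟩
  constructor
  · intro hcard x hx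
    have heq := Finset.eq_of_subset_of_card_le hsub hcard.ge
    obtain ⟨y, hy | hy⟩ := hx
    · exact (key x y (heq ▸ hmem _ _ hy)).1
    · exact (key y x (heq ▸ hmem _ _ hy)).2
  · intro hall
    congr 1
    refine Finset.Subset.antisymm hsub ?_
    rintro ⟨y, z⟩ he
    have hyz := (mem_labelled.1 he).2.2
    have hs := h.supp (hyz ▸ hc)
    have hy := hall y ⟨z, Or.inl hyz⟩
    have hz := hall z ⟨y, Or.inr hyz⟩
    simp only [goodPairs, Finset.mem_filter, List.mem_toFinset]
    exact ⟨mem_scanPairs.2 ⟨hz.1, hy.1, hs.1.le, Or.inr hs.2⟩, hyz, hy.2, hz.2⟩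

/-- Label the edges between `p` and `X` with `sel`. -/
def assign : Com :=
  .set .j (.rd .eo (.v .p)) ;;
  .set .je (.plus (.v .j) (.rd .el (.v .p))) ;;
  .upto .j (.v .je) (
    .set .z (.rd .nb (.v .j)) ;;
    .ite (.eq (.rd .inX (.v .z)) (.c 0)) .nop (
      .put .lab (.v .j) (.v .sel) ;;
      .put .inX (.v .z) (.c 0) ;;
      .put .tot (.v .sel) (.plus (.rd .tot (.v .sel)) (.c 1)) ;;
      .set .c (.minus (.v .c) (.c 1))))

theorem assign_spec {s : ℕ} {X : Finset ℕ} (hM : 4 * (1 + n) ≤ M) (hW : 8 * M ≤ W)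
    (hL : Layout n M P σ) (hp : p < n) (hpσ : σ.reg .p = p) (hs : σ.reg .sel = s) (hsM : s < M)
    (hlab : Labels n P (σ.arr .eo) (σ.arr .lab) lam)
    (hX : ∀ x, σ.arr .inX x = if x ∈ X then 1 else 0) (hXp : ∀ x ∈ X, x ∈ earlier P p p)
    (htot : σ.arr .tot s + n + 1 < W) :
    wp M W assign (fun τ => Labels n P (σ.arr .eo) (τ.arr .lab) (relabel lam p X s) ∧
      (∀ x, τ.arr .inX x = 0) ∧
      τ.arr .tot = Function.update (σ.arr .tot) s (σ.arr .tot s + X.card) ∧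
      τ.reg .c = σ.reg .c - X.card ∧ τ.clk = σ.clk + σ.arr .el p) σ := by
  classical
  have hlenp := hL.el p hp
  have hltp := hL.lt p hp
  have hfull : X.filter (· ∈ earlier P p p) = X := Finset.filter_true_of_mem hXp
  simp only [assign, wp_eqs, reduceCtorEq, if_true, if_false, true_and, and_true, hpσ]
  refine ⟨by omega, by omega, ?_⟩
  refine wp_upto (fun j τ => ∃ t, j = σ.arr .eo p + t ∧ t ≤ σ.arr .el p ∧
      Labels n P (σ.arr .eo) (τ.arr .lab) (relabel lam p (X.filter (· ∈ (nbr P p).take t)) s) ∧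
      (∀ x, τ.arr .inX x = if x ∈ X ∧ x ∉ (nbr P p).take t then 1 else 0) ∧
      τ.arr .tot = Function.update (σ.arr .tot) s
        (σ.arr .tot s + (X.filter (· ∈ (nbr P p).take t)).card) ∧
      τ.reg .c = σ.reg .c - (X.filter (· ∈ (nbr P p).take t)).card ∧ τ.clk = σ.clk + t)
      (σ.arr .eo p + σ.arr .el p) (by decide) (by omega) ?_ ?_ ?_ ?_ ?_
  · simp
  · simp only [wp_eqs, reduceCtorEq, if_true, if_false, true_and, and_true]
    refine ⟨0, by omega, by omega, ?_⟩
    simp only [List.take_zero, List.not_mem_nil, not_false_eq_true, and_true, Finset.filter_false,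
      Finset.card_empty, add_zero, Nat.sub_zero, Function.update_eq_self]
    refine ⟨fun z hz i hi => ?_, hX⟩
    rw [hlab z hz i hi]
    simp [relabel]
  · rintro τ hf - -
    refine ⟨trivial, ?_⟩
    simp only [Ex.eval]
    rw [hf.reg _ (by decide)]
    simp
  · rintro τ hf hj1 hj2 ⟨t, e0, e1, h1, h2, h3, h4, h5⟩
    have hnb : τ.arr .nb = σ.arr .nb := by rw [hf.arr _ (by decide)]; simp
    have hsτ : τ.reg .sel = s := by rw [hf.reg _ (by decide)]; simpa using hs
    have ht : t < (nbr P p).length := by omega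
    have hzt := hL.seg p hp t ht
    have htk : (nbr P p).take (t + 1) = (nbr P p).take t ++ [(nbr P p)[t]] :=
      List.take_succ_eq_append_getElem ht
    have hznot : (nbr P p)[t] ∉ (nbr P p).take t := fun hmem => by
      have hnd := (nodup_nbr P p).sublist (List.take_sublist (t + 1) _)
      rw [htk] at hnd
      exact (List.nodup_append.1 hnd).2.2 _ hmem _ (by simp) rfl
    have hget : ∀ i (hi : i < (nbr P p).length), (nbr P p)[i] = (nbr P p)[t] → i = t :=
      fun i hi h => (nodup_nbr P p).getElem_inj_iff.1 h
    have hcle : (X.filter (· ∈ (nbr P p).take t)).card ≤ n := by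
      have : X.filter (· ∈ (nbr P p).take t) ⊆ Finset.range n := fun x hx => by
        have := (mem_earlier.1 (hXp x (Finset.mem_filter.1 hx).1)).1
        exact Finset.mem_range.2 (by omega)
      simpa using Finset.card_le_card this
    have hzp : (nbr P p)[t] ∈ nbr P p := List.getElem_mem ht
    set z := (nbr P p)[t] with hz
    have hzn : z < n := by have := (mem_nbr.1 hzp).1; omega
    have hmem : ∀ x, x ∈ (nbr P p).take (t + 1) ↔ x ∈ (nbr P p).take t ∨ x = z := by
      intro x; rw [htk, List.mem_append, List.mem_singleton]
    simp only [wp_eqs, reduceCtorEq, if_true, if_false, true_and, and_true, hnb, e0, hzt, hsτ, h2 z,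
      hznot, not_false_eq_true]
    refine ⟨by omega, by omega, fun hzX => ?_, fun hzX => ?_⟩
    · have hzX : z ∉ X := fun h => by simp [h] at hzX
      have heq : X.filter (· ∈ (nbr P p).take (t + 1)) = X.filter (· ∈ (nbr P p).take t) := by
        refine Finset.filter_congr fun x hx => ?_
        rw [hmem]
        exact or_iff_left fun h => hzX (h ▸ hx)
      refine ⟨t + 1, by omega, by omega, by rwa [heq], fun x => ?_, by rwa [heq], by rwa [heq],
        by omega⟩
      rw [h2 x]
      refine if_congr (and_congr_right fun hx => ?_) rfl rfl
      rw [hmem, not_or]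
      exact (and_iff_left (show x ≠ z from fun h => hzX (h ▸ hx))).symm
    · have hzX : z ∈ X := by by_contra h; simp [h] at hzX
      have heq : X.filter (· ∈ (nbr P p).take (t + 1)) =
          insert z (X.filter (· ∈ (nbr P p).take t)) := by
        ext x
        simp only [Finset.mem_filter, Finset.mem_insert, hmem]
        constructor
        · rintro ⟨ha, hb | hb⟩
          · exact Or.inr ⟨ha, hb⟩
          · exact Or.inl hb
        · rintro (rfl | ⟨ha, hb⟩)
          · exact ⟨hzX, Or.inr rfl⟩
          · exact ⟨ha, Or.inl hb⟩
      have hcard : (X.filter (· ∈ (nbr P p).take (t + 1))).card =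
          (X.filter (· ∈ (nbr P p).take t)).card + 1 := by
        rw [heq, Finset.card_insert_of_notMem (by simp [hznot])]
      simp only [h3, Function.update_self, Function.update_idem]
      refine ⟨by omega, by omega, by omega, by omega, by omega, by omega, t + 1,
        by omega, by omega, ?_, ?_, by rw [hcard, add_assoc], by rw [hcard]; omega, by omega⟩
      · intro w hw i hi
        by_cases hwp : w = p
        · subst hwp
          by_cases hit : i = t
          · subst hit
            rw [Function.update_self, relabel_of_mem]
            rw [heq]; exact Finset.mem_insert_self _ _
          · rw [Function.update_of_ne (by omega), h1 w hw i hi]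
            unfold relabel
            refine if_congr (and_congr_right fun _ => ?_) rfl rfl
            rw [heq, Finset.mem_insert]
            exact (or_iff_right fun h => hit (hget i hi h)).symm
        · rw [Function.update_of_ne, h1 w hw i hi]
          · simp [relabel, hwp]
          · intro h
            have := hL.el w hw
            exact hwp (hL.inj w hw p hp i (by omega) t (by omega) h).1
      · intro x
        simp only [Function.update_apply, hmem, h2]
        by_cases hxz : x = z <;> simp [hxz]
  · rintro τ hf - ⟨t, e0, e1, h1, h2, h3, h4, h5⟩
    obtain rfl : t = σ.arr .el p := by omega
    rw [take_nbr P p hlenp, hfull] at h1 h3 h4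
    refine ⟨h1, fun x => ?_, h3, h4, h5⟩
    rw [h2, take_nbr P p hlenp, if_neg]
    rintro ⟨hx, hx'⟩
    exact hx' (hXp x hx)

end Passes

/-- There are at most as many edges with a given label as there are edges. -/
theorem card_labelled_le {n : ℕ} {P : SimpleGraph ℕ} {lam : ℕ → ℕ → ℕ} {c : ℕ}
    (h : ∀ {y z}, lam y z ≠ 0 → y < z ∧ P.Adj y z) (hc : c ≠ 0) :
    (labelled n lam c).card ≤ edgeCount n P := by
  let S : Finset (Σ _ : ℕ, ℕ) := (Finset.range n).sigma fun z => (earlier P z z).toFinset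
  have hS : S.card = edgeCount n P := by
    rw [Finset.card_sigma]
    exact Finset.sum_congr rfl fun z _ => List.toFinset_card_of_nodup (nodup_earlier P z z)
  rw [← hS]
  refine Finset.card_le_card_of_injOn (fun e => ⟨e.2, e.1⟩) (fun e he => ?_) (fun e _ f _ hef => ?_)
  · have he := mem_labelled.1 he
    have hs := h (y := e.1) (z := e.2) (by omega)
    simp only [S, Finset.coe_sigma, Set.mem_sigma_iff, Finset.coe_range, Set.mem_Iio,
      Finset.mem_coe, List.mem_toFinset, mem_earlier]
    exact ⟨he.2.1, hs⟩
  · simp only [Sigma.mk.injEq, heq_eq_eq] at hef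
    exact Prod.ext hef.2 hef.1

open Classical in
/-- The earlier neighbours of `p` whose edge to `p` has no label. -/
noncomputable def unlabelled (P : SimpleGraph ℕ) (lam : ℕ → ℕ → ℕ) (p : ℕ) : Finset ℕ :=
  (earlier P p p).toFinset.filter fun y => lam y p = 0

theorem mem_unlabelled {P : SimpleGraph ℕ} {lam : ℕ → ℕ → ℕ} {p y : ℕ} :
    y ∈ unlabelled P lam p ↔ (y < p ∧ P.Adj y p) ∧ lam y p = 0 := by
  simp [unlabelled, mem_earlier]

theorem card_unlabelled_relabel {P : SimpleGraph ℕ} {lam : ℕ → ℕ → ℕ} {p s : ℕ} {X : Finset ℕ}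
    (hs : s ≠ 0) (hX : X ⊆ unlabelled P lam p) :
    (unlabelled P (relabel lam p X s) p).card = (unlabelled P lam p).card - X.card := by
  rw [← Finset.card_sdiff_of_subset hX]
  congr 1
  ext y
  simp only [mem_unlabelled, Finset.mem_sdiff, relabel, true_and]
  by_cases hy : y ∈ X <;> simp [hy, hs]

/-- The state of the computation between two rounds: the labelling `lam` is a cover by `k` cliques,
`tot` counts its edges by labels, and the scratch arrays are cleared. -/
structure CoverInv (n M : ℕ) (P : SimpleGraph ℕ) (lam : ℕ → ℕ → ℕ) (k : ℕ) (τ : HState) :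
    Prop where
  layout : Layout n M P τ
  lab : Labels n P (τ.arr .eo) (τ.arr .lab) lam
  tot : ∀ c, c ≠ 0 → τ.arr .tot c = (labelled n lam c).card
  tot_zero : τ.arr .tot 0 = 0
  inX : ∀ x, τ.arr .inX x = 0
  g : ∀ x, τ.arr .g x = 0
  cnt : ∀ c, τ.arr .cnt c = 0
  reg_k : τ.reg .k = k
  cover : IsCover P lam k

/-- Label some of the unlabelled edges between `p` and earlier positions: find a clique, find an old
clique to which it can be added, or else take a new label. -/
def round : Com :=
  buildX ;; countX ;; countLab ;; .set .sel (.c 0) ;; select ;; reset ;;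
  .ite (.eq (.v .sel) (.c 0)) (
    .set .k (.plus (.v .k) (.c 1)) ;;
    .set .sel (.v .k)) .nop ;;
  assign

theorem Layout.frame {n M : ℕ} {P : SimpleGraph ℕ} {p : Com} {σ τ : HState} (h : Layout n M P σ)
    (hf : Frame p σ τ) (hn : Var.n ∉ p.vars) (ha : ∀ b ∈ [Arr.nb, .eo, .el], b ∉ p.arrs) :
    Layout n M P τ := by
  have h1 := hf.arr _ (ha .nb (by decide))
  have h2 := hf.arr _ (ha .eo (by decide))
  have h3 := hf.arr _ (ha .el (by decide))
  have h4 := hf.reg _ hn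
  exact ⟨h4.trans h.reg_n, h3 ▸ h.el, h3 ▸ h.el_top, h1 ▸ h2 ▸ h.seg, h2 ▸ h3 ▸ h.inj,
    h2 ▸ h3 ▸ h.lt⟩

/-- A round labels the edges to a maximal clique `X`, uses at most one new label, and preserves the
invariant. -/
theorem round_spec {n M W D p k : ℕ} {P : SimpleGraph ℕ} {σ : HState} {lam : ℕ → ℕ → ℕ}
    (hM : 4 * (1 + n + edgeCount n P) ≤ M) (hW : 8 * M ≤ W)
    (hn : ∀ y z, P.Adj y z → y < n) (hI : CoverInv n M P lam k σ) (hp : p < n)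
    (hpσ : σ.reg .p = p) (hmk : ∀ y, σ.arr .mk y ≠ 0 ↔ y ∈ nbr P p)
    (hD : ∀ z < n, σ.arr .el z ≤ D) (hundone : ∀ y z, p < z → lam y z = 0)
    (hc : σ.reg .c = (unlabelled P lam p).card) (hne : (unlabelled P lam p).Nonempty) :
    wp M W round (fun τ => ∃ X k' s, X ⊆ unlabelled P lam p ∧ X.Nonempty ∧
      (∀ w ∈ unlabelled P lam p, w ∉ X → ∃ x ∈ X, ¬ Near P x w) ∧ k ≤ k' ∧ k' ≤ k + 1 ∧ s ≠ 0 ∧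
      CoverInv n M P (relabel lam p X s) k' τ ∧
      τ.reg .c = (unlabelled P (relabel lam p X s) p).card ∧
      τ.clk ≤ σ.clk + 6 * ((σ.arr .el p + 1) * (D + 2))) σ := by
  classical
  have hL := hI.layout
  have hcov := hI.cover
  have hk := hcov.le_edgeCount hn
  have hlam : ∀ y z, lam y z < M := fun y z => by have := hcov.le y z; omega
  have hlenp := hL.el p hp
  unfold round
  rw [wp_seq]
  refine wp_mono (wp_frame (buildX_spec (lam := lam) (by omega) hW hL hp hpσ hD ?_ hI.inX)) ?_
  · intro i hi
    rw [List.length_map] at hi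
    rw [List.getElem_map]
    exact hI.lab p hp i hi
  rintro τ1 ⟨⟨X, hX1, hX2, hX3, hX4, hX5, hX6⟩, f1⟩
  have hXsub : X ⊆ unlabelled P lam p := fun x hx => by
    have := hX1 x hx
    exact mem_unlabelled.2 ⟨mem_earlier.1 this.1, this.2⟩
  have hXmax : ∀ w ∈ unlabelled P lam p, w ∉ X → ∃ x ∈ X, ¬ Near P x w := fun w hw hwX => by
    have := mem_unlabelled.1 hw
    exact hX3 w (mem_earlier.2 this.1) this.2 hwX
  have hXne : X.Nonempty := by
    obtain ⟨w, hw⟩ := hne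
    by_cases hwX : w ∈ X
    · exact ⟨w, hwX⟩
    · obtain ⟨x, hx, -⟩ := hXmax w hw hwX
      exact ⟨x, hx⟩
  have hXn : X.card ≤ n := by
    have : X ⊆ Finset.range n := fun x hx => by
      have := (mem_unlabelled.1 (hXsub hx)).1.1
      exact Finset.mem_range.2 (by omega)
    simpa using Finset.card_le_card this
  have hXp : ∀ x ∈ X, x < p ∧ P.Adj x p ∧ lam x p = 0 := fun x hx => by
    have := mem_unlabelled.1 (hXsub hx)
    exact ⟨this.1.1, this.1.2, this.2⟩
  have hel1 : τ1.arr .el = σ.arr .el := f1.arr _ (by decide)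
  have heo1 : τ1.arr .eo = σ.arr .eo := f1.arr _ (by decide)
  have hmk1 : τ1.arr .mk = σ.arr .mk := f1.arr _ (by decide)
  have hp1 : τ1.reg .p = p := (f1.reg _ (by decide)).trans hpσ
  have hg1 : τ1.arr .g = σ.arr .g := f1.arr _ (by decide)
  have hcnt1 : τ1.arr .cnt = σ.arr .cnt := f1.arr _ (by decide)
  have hlab1 : τ1.arr .lab = σ.arr .lab := f1.arr _ (by decide)
  have htot1 : τ1.arr .tot = σ.arr .tot := f1.arr _ (by decide)
  have hk1 : τ1.reg .k = σ.reg .k := f1.reg _ (by decide)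
  have hc1 : τ1.reg .c = σ.reg .c := f1.reg _ (by decide)
  have hL1 : Layout n M P τ1 := hL.frame f1 (by decide) (by decide)
  rw [wp_seq]
  refine wp_mono (wp_frame (countX_spec (X := X) hM hW hL1 hp hp1 (by rwa [hmk1]) (by rwa [hel1])
    hX4 (fun x hx => mem_nbr.2 ⟨(hXp x hx).1.le, Or.inr (hXp x hx).2.1⟩)
    (by rw [hg1]; exact hI.g))) ?_
  rintro τ2 ⟨⟨hgo, hgi, hclk2⟩, f2⟩
  have hel2 : τ2.arr .el = σ.arr .el := (f2.arr _ (by decide)).trans hel1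
  have heo2 : τ2.arr .eo = σ.arr .eo := (f2.arr _ (by decide)).trans heo1
  have hmk2 : τ2.arr .mk = σ.arr .mk := (f2.arr _ (by decide)).trans hmk1
  have hp2 : τ2.reg .p = p := (f2.reg _ (by decide)).trans hp1
  have hcnt2 : τ2.arr .cnt = σ.arr .cnt := (f2.arr _ (by decide)).trans hcnt1
  have hlab2 : τ2.arr .lab = σ.arr .lab := (f2.arr _ (by decide)).trans hlab1
  have htot2 : τ2.arr .tot = σ.arr .tot := (f2.arr _ (by decide)).trans htot1
  have hk2 : τ2.reg .k = σ.reg .k := (f2.reg _ (by decide)).trans hk1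
  have hc2 : τ2.reg .c = σ.reg .c := (f2.reg _ (by decide)).trans hc1
  have hxn2 : τ2.reg .xn = X.card := (f2.reg _ (by decide)).trans hX5
  have hinX2 : τ2.arr .inX = τ1.arr .inX := f2.arr _ (by decide)
  have hL2 : Layout n M P τ2 := hL1.frame f2 (by decide) (by decide)
  -- The count `g w` is `|X|` if and only if `w` is near all of `X`.
  have hgood : ∀ w ∈ nbr P p, τ2.arr .g w = τ2.reg .xn → ∀ x ∈ X, Near P x w := by
    intro w hw h x hx
    rw [hgi w hw, hxn2, Finset.card_filter_eq_iff] at h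
    exact h x hx
  have hgood' : ∀ w ∈ nbr P p, (∀ x ∈ X, Near P x w) → τ2.arr .g w = τ2.reg .xn := by
    intro w hw h
    rw [hgi w hw, hxn2, Finset.card_filter_eq_iff]
    exact h
  rw [wp_seq]
  refine wp_mono (wp_frame (countLab_spec (lam := lam) hM hW hL2 hp hp2 (by rwa [hmk2])
    (by rwa [hel2]) (by rw [hlab2, heo2]; exact hI.lab) hlam (by rw [hcnt2]; exact hI.cnt))) ?_
  rintro τ3 ⟨⟨hcnt3, hclk3⟩, f3⟩
  have hel3 : τ3.arr .el = σ.arr .el := (f3.arr _ (by decide)).trans hel2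
  have heo3 : τ3.arr .eo = σ.arr .eo := (f3.arr _ (by decide)).trans heo2
  have hmk3 : τ3.arr .mk = σ.arr .mk := (f3.arr _ (by decide)).trans hmk2
  have hp3 : τ3.reg .p = p := (f3.reg _ (by decide)).trans hp2
  have hlab3 : τ3.arr .lab = σ.arr .lab := (f3.arr _ (by decide)).trans hlab2
  have htot3 : τ3.arr .tot = σ.arr .tot := (f3.arr _ (by decide)).trans htot2
  have hk3 : τ3.reg .k = σ.reg .k := (f3.reg _ (by decide)).trans hk2
  have hc3 : τ3.reg .c = σ.reg .c := (f3.reg _ (by decide)).trans hc2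
  have hxn3 : τ3.reg .xn = τ2.reg .xn := f3.reg _ (by decide)
  have hg3 : τ3.arr .g = τ2.arr .g := f3.arr _ (by decide)
  have hinX3 : τ3.arr .inX = τ1.arr .inX := (f3.arr _ (by decide)).trans hinX2
  have hL3 : Layout n M P τ3 := hL2.frame f3 (by decide) (by decide)
  rw [wp_seq, wp_set]
  refine ⟨by simp only [Ex.ok]; omega, ?_⟩
  simp only [Ex.eval]
  have hL3' : Layout n M P (τ3.set .sel 0) := ⟨by simpa using hL3.reg_n, hL3.el, hL3.el_top,
    hL3.seg, hL3.inj, hL3.lt⟩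
  rw [wp_seq]
  refine wp_mono (wp_frame (select_spec (lam := lam) hM hW hL3' hp (by simpa using hp3)
    (by simpa [hmk3] using hmk) (by simpa [hel3] using hD) (by simpa [hlab3, heo3] using hI.lab)
    hlam (by simp))) ?_
  simp only [HState.reg_set, HState.arr_set, HState.clk_set, reduceCtorEq, if_false]
  rintro τ4 ⟨⟨hsel4, hclk4⟩, f4⟩
  have hel4 : τ4.arr .el = σ.arr .el := (f4.arr _ (by decide)).trans hel3
  have heo4 : τ4.arr .eo = σ.arr .eo := (f4.arr _ (by decide)).trans heo3
  have hmk4 : τ4.arr .mk = σ.arr .mk := (f4.arr _ (by decide)).trans hmk3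
  have hp4 : τ4.reg .p = p := (f4.reg _ (by decide)).trans (by simpa using hp3)
  have hlab4 : τ4.arr .lab = σ.arr .lab := (f4.arr _ (by decide)).trans hlab3
  have htot4 : τ4.arr .tot = σ.arr .tot := (f4.arr _ (by decide)).trans htot3
  have hcnt4 : τ4.arr .cnt = τ3.arr .cnt := f4.arr _ (by decide)
  have hk4 : τ4.reg .k = σ.reg .k := (f4.reg _ (by decide)).trans (by simpa using hk3)
  have hc4 : τ4.reg .c = σ.reg .c := (f4.reg _ (by decide)).trans (by simpa using hc3)
  have hg4 : τ4.arr .g = τ2.arr .g := (f4.arr _ (by decide)).trans hg3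
  have hinX4 : τ4.arr .inX = τ1.arr .inX := (f4.arr _ (by decide)).trans hinX3
  have hL4 : Layout n M P τ4 := hL3'.frame f4 (by decide) (by decide)
  rw [wp_seq]
  refine wp_mono (wp_frame (reset_spec (lam := lam) hM hW hL4 hp hp4 (by rwa [hmk4])
    (by rwa [hel4]) (by rw [hlab4, heo4]; exact hI.lab) hlam (by rw [hg4]; exact hgo)
    (by rw [hcnt4]; exact hcnt3))) ?_
  rintro τ5 ⟨⟨hcnt5, hg5, hclk5⟩, f5⟩
  have hel5 : τ5.arr .el = σ.arr .el := (f5.arr _ (by decide)).trans hel4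
  have heo5 : τ5.arr .eo = σ.arr .eo := (f5.arr _ (by decide)).trans heo4
  have hp5 : τ5.reg .p = p := (f5.reg _ (by decide)).trans hp4
  have hlab5 : τ5.arr .lab = σ.arr .lab := (f5.arr _ (by decide)).trans hlab4
  have htot5 : τ5.arr .tot = σ.arr .tot := (f5.arr _ (by decide)).trans htot4
  have hk5 : τ5.reg .k = k := ((f5.reg _ (by decide)).trans hk4).trans hI.reg_k
  have hc5 : τ5.reg .c = σ.reg .c := (f5.reg _ (by decide)).trans hc4
  have hsel5 : τ5.reg .sel = τ4.reg .sel := f5.reg _ (by decide)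
  have hinX5 : τ5.arr .inX = τ1.arr .inX := (f5.arr _ (by decide)).trans hinX4
  have hL5 : Layout n M P τ5 := hL4.frame f5 (by decide) (by decide)
  rw [hel1] at hclk2
  rw [hel2] at hclk3
  rw [hel3] at hclk4
  rw [hel4] at hclk5
  -- The last command, for any label `s` that keeps the labelling a cover.
  have hfin : ∀ s k' υ, s ≠ 0 → s ≤ k + 1 → k ≤ k' → k' ≤ k + 1 →
      IsCover P (relabel lam p X s) k' → υ.arr = τ5.arr → υ.clk = τ5.clk →
      (∀ x, x ≠ .sel → x ≠ .k → υ.reg x = τ5.reg x) → υ.reg .k = k' → υ.reg .sel = s →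
      wp M W assign (fun τ => ∃ X k' s, X ⊆ unlabelled P lam p ∧ X.Nonempty ∧
      (∀ w ∈ unlabelled P lam p, w ∉ X → ∃ x ∈ X, ¬ Near P x w) ∧ k ≤ k' ∧ k' ≤ k + 1 ∧ s ≠ 0 ∧
      CoverInv n M P (relabel lam p X s) k' τ ∧
      τ.reg .c = (unlabelled P (relabel lam p X s) p).card ∧
      τ.clk ≤ σ.clk + 6 * ((σ.arr .el p + 1) * (D + 2))) υ := by
    intro s k' υ hs0 hsk hkk' hk'k hcov' harr hclk hreg hk' hs
    have hL6 : Layout n M P υ := ⟨(hreg _ (by decide) (by decide)).trans hL5.reg_n,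
      harr ▸ hL5.el, harr ▸ hL5.el_top, harr ▸ hL5.seg, harr ▸ hL5.inj, harr ▸ hL5.lt⟩
    have htots := card_labelled_le (n := n) (lam := lam) hcov.supp hs0
    have hts := hI.tot s hs0
    refine wp_mono (wp_frame (assign_spec (s := s) (X := X) (lam := lam) (by omega) hW hL6 hp
      ((hreg _ (by decide) (by decide)).trans hp5) hs (by omega)
      (by rw [harr, hlab5, heo5]; exact hI.lab) (by rw [harr, hinX5]; exact hX4)
      (fun x hx => (hX1 x hx).1) (by rw [harr, htot5]; omega))) ?_
    rintro τ ⟨⟨a1, a2, a3, a4, a5⟩, f⟩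
    have heo' : τ.arr .eo = υ.arr .eo := f.arr _ (by decide)
    refine ⟨X, k', s, hXsub, hXne, hXmax, hkk', hk'k, hs0,
      ⟨hL6.frame f (by decide) (by decide), heo' ▸ a1, fun c hc0 => ?_, ?_, a2, fun x => ?_,
        fun x => ?_, (f.reg _ (by decide)).trans hk', hcov'⟩, ?_, ?_⟩
    · rw [a3, harr, htot5, card_labelled_relabel hp
        (fun x hx => ⟨(hXp x hx).1.trans hp, (hXp x hx).2.2⟩) hc0, Function.update_apply]
      split_ifs with hcs
      · rw [hcs, hts]
      · exact hI.tot c hc0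
    · rw [a3, harr, htot5, Function.update_of_ne hs0.symm, hI.tot_zero]
    · rw [f.arr _ (by decide), harr, hg5]
    · rw [f.arr _ (by decide), harr, hcnt5]
    · rw [a4, card_unlabelled_relabel hs0 hXsub, ← hc, hreg _ (by decide) (by decide), hc5]
    · have e1 : σ.arr .el p * (D + 1) ≤ (σ.arr .el p + 1) * (D + 2) :=
        Nat.mul_le_mul (by omega) (by omega)
      have e2 : σ.arr .el p ≤ (σ.arr .el p + 1) * (D + 2) :=
        (Nat.le_succ _).trans (Nat.le_mul_of_pos_right _ (by omega))
      rw [harr, hel5] at a5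
      omega
  have hnX := fun h => hcov.new hXne hXp hX2 h
  generalize assign = A at hfin ⊢
  rw [wp_seq, wp_ite]
  simp only [wp_eqs, reduceCtorEq, if_true, if_false, true_and, and_true]
  refine ⟨by omega, fun hs0 => ⟨by omega, ?_⟩, fun hs0 => ?_⟩
  · rw [hsel5] at hs0
    -- No label was selected, so no old clique is compatible with `X ∪ {p}`, and a new label is
    -- used.
    have hno := (hsel4.resolve_right ?_).2
    · rw [hk5]
      refine hfin (k + 1) (k + 1) ((τ5.set .k (k + 1)).set .sel (k + 1)) (by omega) le_rfl
        (by omega) le_rfl (hnX fun b hb hbk => ?_)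
        rfl rfl (fun x h1 h2 => by simp [h1, h2]) (by simp) (by simp)
      obtain ⟨y, z, hyz⟩ := hcov.used b hb hbk
      by_contra! hall
      have hmem : ∀ x, Inc lam b x → x ∈ nbr P p ∧ τ2.arr .g x = τ2.reg .xn := by
        intro x hx
        have hxp : x ≤ p := by
          obtain ⟨y, hy | hy⟩ := hx
          · have h1 := hcov.supp (hy.symm ▸ hb)
            by_contra hlt
            exact hb (hy ▸ hundone x y (by omega))
          · by_contra hlt
            exact hb (hy ▸ hundone y x (by omega))
        have hxm : x ∈ nbr P p := mem_nbr.2 ⟨hxp, (hall x hx).1⟩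
        exact ⟨hxm, hgood' x hxm fun y hy => ((hall x hx).2 y hy).symm⟩
      have hcard := (card_goodPairs hcov hn (G := fun w => τ2.arr .g w = τ2.reg .xn) hb).2 hmem
      have hs := hcov.supp (hyz.symm ▸ hb)
      have hy := hmem y ⟨z, Or.inl hyz⟩
      have hz := hmem z ⟨y, Or.inr hyz⟩
      refine hno (y, z) (mem_scanPairs.2 ⟨hz.1, hy.1, hs.1.le, Or.inr hs.2⟩) ?_ ?_ ?_
      · rw [hg3, hxn3]; exact hy.2
      · rw [hg3, hxn3]; exact hz.2
      · simp only [hyz]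
        rw [hcnt3, hcard, htot3, hI.tot b hb]
    · rintro ⟨e, he, h1, h2, h3, h4⟩
      rw [hs0] at h4
      -- The label `0` cannot have been selected, because `tot 0 = 0` while `cnt 0` is positive.
      rw [← h4, htot3, hI.tot_zero, hcnt3, Finset.card_eq_zero] at h3
      have : e ∈ goodPairs P lam p (fun w => τ2.arr .g w = τ2.reg .xn) 0 := by
        simp only [goodPairs, Finset.mem_filter, List.mem_toFinset]
        rw [hg3, hxn3] at h1 h2
        exact ⟨he, h4.symm, h1, h2⟩
      rw [h3] at this
      exact absurd this (Finset.notMem_empty _)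
  · rw [hsel5] at hs0
    -- All edges with the selected label have been counted, so its clique is compatible.
    obtain ⟨e, he, h1, h2, h3, h4⟩ := hsel4.resolve_left fun h => hs0 h.1
    have hb : lam e.1 e.2 ≠ 0 := h4 ▸ hs0
    have hle := hcov.le e.1 e.2
    rw [hcnt3, htot3, hI.tot _ hb, card_goodPairs hcov hn hb] at h3
    refine hfin (lam e.1 e.2) k _ hb (by omega) le_rfl (by omega)
      (hcov.extend hXp hX2 hb hle (fun x hx => (mem_nbr.1 (h3 x hx).1).2)
        fun x hx y hy => (hgood x (h3 x hx).1 (h3 x hx).2 y hy).symm)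
      rfl rfl (fun x h1 h2 => rfl) hk5 (hsel5.trans h4)

/-! ### Covering the edges position by position -/

/-- The positions before `p` that are neither equal nor adjacent to `w`. -/
noncomputable def nonNear (P : SimpleGraph ℕ) (p w : ℕ) : Finset ℕ := by
  classical exact (Finset.range p).filter fun y => ¬ Near P y w

theorem mem_nonNear {P : SimpleGraph ℕ} {p w y : ℕ} :
    y ∈ nonNear P p w ↔ y < p ∧ ¬ Near P y w := by
  simp [nonNear]

theorem CoverInv.frame {n M : ℕ} {P : SimpleGraph ℕ} {lam : ℕ → ℕ → ℕ} {k : ℕ} {p : Com}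
    {σ τ : HState} (h : CoverInv n M P lam k σ) (hf : Frame p σ τ)
    (hv : ∀ x ∈ [Var.n, .k], x ∉ p.vars)
    (ha : ∀ b ∈ [Arr.nb, .eo, .el, .lab, .tot, .inX, .g, .cnt], b ∉ p.arrs) :
    CoverInv n M P lam k τ := by
  have h1 := hf.arr _ (ha .eo (by decide))
  have h2 := hf.arr _ (ha .lab (by decide))
  have h3 := hf.arr _ (ha .tot (by decide))
  have h4 := hf.arr _ (ha .inX (by decide))
  have h5 := hf.arr _ (ha .g (by decide))
  have h6 := hf.arr _ (ha .cnt (by decide))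
  exact ⟨h.layout.frame hf (hv .n (by decide)) fun b hb => ha b (by simp at hb ⊢; tauto),
    h1 ▸ h2 ▸ h.lab, h3 ▸ h.tot, h3 ▸ h.tot_zero, h4 ▸ h.inX, h5 ▸ h.g, h6 ▸ h.cnt,
    (hf.reg _ (hv .k (by decide))).trans h.reg_k, h.cover⟩

/-- Set `mk` to `b` on `p` and its earlier neighbours. -/
def mark (b : ℕ) : Com :=
  .set .j (.rd .eo (.v .p)) ;;
  .set .je (.plus (.v .j) (.plus (.rd .el (.v .p)) (.c 1))) ;;
  .upto .j (.v .je) (.put .mk (.rd .nb (.v .j)) (.c b))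

theorem mark_spec {n M W p b : ℕ} {P : SimpleGraph ℕ} {σ : HState} (hM : 4 * (1 + n) ≤ M)
    (hW : 8 * M ≤ W) (hL : Layout n M P σ) (hp : p < n) (hpσ : σ.reg .p = p) (hb : b ≤ 1) :
    wp M W (mark b) (fun τ => (∀ y ∈ nbr P p, τ.arr .mk y = b) ∧
      (∀ y, y ∉ nbr P p → τ.arr .mk y = σ.arr .mk y) ∧ τ.clk = σ.clk + (σ.arr .el p + 1)) σ := by
  have hlenp := hL.el p hp
  have hltp := hL.lt p hp
  simp only [mark, wp_eqs, reduceCtorEq, if_true, if_false, true_and, and_true, hpσ]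
  refine ⟨by omega, by omega, ?_⟩
  refine wp_upto (fun j τ => ∃ t, j = σ.arr .eo p + t ∧ t ≤ (nbr P p).length ∧
      (∀ y ∈ (nbr P p).take t, τ.arr .mk y = b) ∧
      (∀ y, y ∉ (nbr P p).take t → τ.arr .mk y = σ.arr .mk y) ∧ τ.clk = σ.clk + t)
      (σ.arr .eo p + (nbr P p).length) (by simp) (by omega) ?_ ?_ ?_ ?_ ?_
  · simp
  · simp only [wp_eqs, reduceCtorEq, if_true, if_false, true_and, and_true]
    exact ⟨0, by simp⟩
  · rintro τ hf - -
    refine ⟨trivial, ?_⟩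
    simp only [Ex.eval]
    rw [hf.reg _ (by simp)]
    simp [hlenp]
  · rintro τ hf hj1 hj2 ⟨t, e0, e1, h1, h2, h3⟩
    have hnb : τ.arr .nb = σ.arr .nb := by rw [hf.arr _ (by simp)]; simp
    have ht : t < (nbr P p).length := by omega
    have hzt := hL.seg p hp t ht
    have htk : (nbr P p).take (t + 1) = (nbr P p).take t ++ [(nbr P p)[t]] :=
      List.take_succ_eq_append_getElem ht
    have hz := (mem_nbr.1 (List.getElem_mem ht)).1
    simp only [wp_eqs, reduceCtorEq, if_true, if_false, true_and, and_true, hnb, e0, hzt]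
    refine ⟨by omega, by omega, by omega, t + 1, by omega, by omega, fun y hy => ?_, fun y hy => ?_,
      by omega⟩
    · rw [Function.update_apply]
      split_ifs with h
      · rfl
      · rw [htk, List.mem_append, List.mem_singleton] at hy
        exact h1 y (hy.resolve_right h)
    · rw [htk, List.mem_append, List.mem_singleton, not_or] at hy
      rw [Function.update_of_ne hy.2]
      exact h2 y hy.1
  · rintro τ hf - ⟨t, e0, e1, h1, h2, h3⟩
    obtain rfl : t = (nbr P p).length := by omega
    rw [List.take_length] at h1 h2
    exact ⟨h1, h2, by omega⟩

/-- Label all edges between `p` and earlier positions. The variable `c` holds the number of edges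
that remain to be labelled. -/
def step : Com :=
  mark 1 ;;
  .set .c (.rd .el (.v .p)) ;;
  .loop (.lt (.c 0) (.v .c)) round ;;
  mark 0

/-- The number `r` of rounds for the position `p` is at most `d + 1`, if every earlier position has
at most `d` non-neighbours before `p`. -/
theorem step_spec {n M W D p k : ℕ} {P : SimpleGraph ℕ} {σ : HState} {lam : ℕ → ℕ → ℕ}
    (hM : 4 * (1 + n + edgeCount n P) ≤ M) (hW : 8 * M ≤ W)
    (hn : ∀ y z, P.Adj y z → y < n) (hI : CoverInv n M P lam k σ) (hp : p < n)
    (hpσ : σ.reg .p = p) (hmk : ∀ y, σ.arr .mk y = 0) (hD : ∀ z < n, σ.arr .el z ≤ D)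
    (hundone : ∀ y z, p ≤ z → lam y z = 0) {d : ℕ} (hd : ∀ w < p, (nonNear P p w).card ≤ d) :
    wp M W step (fun τ => ∃ lam' k' r, CoverInv n M P lam' k' τ ∧ (∀ y, τ.arr .mk y = 0) ∧
      (∀ y z, z ≠ p → lam' y z = lam y z) ∧ (∀ y < p, P.Adj y p → lam' y p ≠ 0) ∧
      k ≤ k' ∧ k' ≤ k + r ∧ r ≤ σ.arr .el p ∧ r ≤ d + 1 ∧
      τ.clk ≤ σ.clk + 2 * (σ.arr .el p + 1) + r * (6 * ((σ.arr .el p + 1) * (D + 2)) + 1)) σ := by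
  classical
  have hL := hI.layout
  have hlenp := hL.el p hp
  have hltp := hL.lt p hp
  have hlen : (nbr P p).length = (earlier P p p).length + 1 := by simp [nbr]
  set E := σ.arr .el p with hE
  unfold step
  rw [wp_seq]
  refine wp_mono (wp_frame (mark_spec (by omega) hW hL hp hpσ le_rfl)) ?_
  rintro τ1 ⟨⟨hm1, hm2, hclk1⟩, f1⟩
  have hI1 := hI.frame f1 (by decide) (by decide)
  have hel1 : τ1.arr .el = σ.arr .el := f1.arr _ (by decide)
  have hp1 : τ1.reg .p = p := (f1.reg _ (by decide)).trans hpσ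
  have hmk1 : ∀ y, τ1.arr .mk y ≠ 0 ↔ y ∈ nbr P p := by
    intro y
    by_cases hy : y ∈ nbr P p
    · simp [hm1 y hy, hy]
    · simp [hm2 y hy, hy, hmk y]
  rw [wp_seq, wp_set, wp_seq]
  refine ⟨by simp only [Ex.ok, Ex.eval, hp1, hel1]; exact ⟨trivial, by omega⟩, ?_⟩
  simp only [Ex.eval, hp1, hel1]
  rw [← hE]
  -- After `r` rounds, every unlabelled `w` has `r` non-neighbours `B` among the labelled positions,
  -- one for each of the cliques `X` of the previous rounds.
  refine wp_loop (fun τ => ∃ lam' k' r, CoverInv n M P lam' k' τ ∧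
      τ.reg .c = (unlabelled P lam' p).card ∧
      (∀ y z, z ≠ p → lam' y z = lam y z) ∧ k ≤ k' ∧ k' ≤ k + r ∧
      r + (unlabelled P lam' p).card ≤ E ∧ r ≤ d + 1 ∧
      (∀ w ∈ unlabelled P lam' p, ∃ B ⊆ nonNear P p w, (∀ y ∈ B, P.Adj y p ∧ lam' y p ≠ 0) ∧
        B.card = r) ∧
      τ.clk ≤ σ.clk + (E + 1) + r * (6 * ((E + 1) * (D + 2)) + 1))
      (fun τ => τ.reg .c) ?_ ?_ ?_ ?_
  · have hall : (unlabelled P lam p).card = E := by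
      rw [unlabelled, Finset.filter_true_of_mem fun y _ => hundone y p le_rfl,
        List.toFinset_card_of_nodup (nodup_earlier P p p)]
      omega
    refine ⟨lam, k, 0, ?_, by simp [hall], fun _ _ _ => rfl, le_rfl, le_rfl, by omega, by omega,
      fun w _ => ⟨∅, by simp⟩, ?_⟩
    · obtain ⟨a1, a2, a3, a4, a5, a6, a7, a8, a9⟩ := hI1
      exact ⟨⟨by simpa using a1.reg_n, a1.el, a1.el_top, a1.seg, a1.inj, a1.lt⟩, a2, a3, a4, a5, a6,
        a7, by simpa using a8, a9⟩
    · simp only [HState.clk_set]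
      omega
  · rintro τ - -
    simp only [Bx.ok, Ex.ok, and_true]
    omega
  · rintro τ ⟨lam', k', r, b1, b2, b3, b4, b5, b6, b7, b8, b9⟩ f hb
    have hb : 0 < τ.reg .c := hb
    have hel' : τ.arr .el = σ.arr .el := (f.arr _ (by decide)).trans (by simpa using hel1)
    have hmk' : τ.arr .mk = τ1.arr .mk := (f.arr _ (by decide)).trans (by simp)
    have hp' : τ.reg .p = p := (f.reg _ (by decide)).trans (by simpa using hp1)
    have hne : (unlabelled P lam' p).Nonempty := Finset.card_pos.1 (by omega)
    have hIt : CoverInv n M P lam' k' τ.tick := by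
      obtain ⟨a1, a2, a3, a4, a5, a6, a7, a8, a9⟩ := b1
      exact ⟨⟨a1.reg_n, a1.el, a1.el_top, a1.seg, a1.inj, a1.lt⟩, a2, a3, a4, a5, a6, a7, a8, a9⟩
    have hr : r ≤ d := by
      obtain ⟨w, hw⟩ := hne
      obtain ⟨B, hB1, hB2, hB3⟩ := b8 w hw
      rw [← hB3]
      exact (Finset.card_le_card hB1).trans (hd w (mem_unlabelled.1 hw).1.1)
    refine wp_mono (round_spec (D := D) hM hW hn hIt hp hp'
      (by rw [HState.arr_tick, hmk']; exact hmk1)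
      (by rw [HState.arr_tick, hel']; exact hD) (fun y z hz => ?_) b2 hne) ?_
    · rw [b3 y z (by omega)]; exact hundone y z hz.le
    rintro υ ⟨X, k'', s, c1, c2, c3, c4, c5, c6, c7, c8, c9⟩
    have hcard := card_unlabelled_relabel c6 c1
    have hXpos := Finset.card_pos.2 c2
    have hXle := Finset.card_le_card c1
    simp only [HState.clk_tick, HState.arr_tick, hel'] at c9
    rw [← hE] at c9
    have hX0 : ∀ x ∈ X, lam' x p = 0 := fun x hx => (mem_unlabelled.1 (c1 hx)).2
    have hmul : (r + 1) * (6 * ((E + 1) * (D + 2)) + 1) =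
        r * (6 * ((E + 1) * (D + 2)) + 1) + (6 * ((E + 1) * (D + 2)) + 1) := by ring
    refine ⟨⟨relabel lam' p X s, k'', r + 1, c7, c8, fun y z hz => ?_, by omega, by omega, by omega,
      by omega, fun w hw => ?_, by omega⟩, by omega⟩
    · rw [← b3 y z hz]; exact if_neg fun h => hz h.1
    · have hwX : w ∉ X := fun hwX => by
        have := (mem_unlabelled.1 hw).2
        rw [relabel_of_mem hwX] at this
        exact c6 this
      have hw' : w ∈ unlabelled P lam' p := by
        have := mem_unlabelled.1 hw
        refine mem_unlabelled.2 ⟨this.1, ?_⟩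
        have h2 := this.2
        rwa [relabel, if_neg fun h => hwX h.2] at h2
      obtain ⟨B, hB1, hB2, hB3⟩ := b8 w hw'
      -- `w` survived the round, and `X` is maximal, so `w` has a non-neighbour in `X`.
      obtain ⟨x, hx, hxw⟩ := c3 w hw' hwX
      have hxB : x ∉ B := fun h => (hB2 x h).2 (hX0 x hx)
      have hxu := mem_unlabelled.1 (c1 hx)
      refine ⟨insert x B, ?_, ?_, by rw [Finset.card_insert_of_notMem hxB, hB3]⟩
      · rw [Finset.insert_subset_iff]
        exact ⟨mem_nonNear.2 ⟨hxu.1.1, hxw⟩, hB1⟩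
      · intro y hy
        rcases Finset.mem_insert.1 hy with rfl | hy
        · exact ⟨hxu.1.2, by rw [relabel_of_mem hx]; exact c6⟩
        · exact ⟨(hB2 y hy).1, by rw [relabel_of_ne (hB2 y hy).2 hX0]; exact (hB2 y hy).2⟩
  · rintro τ ⟨lam', k', r, b1, b2, b3, b4, b5, b6, b7, b8, b9⟩ f hb
    have hb : ¬ 0 < τ.reg .c := hb
    have hel' : τ.arr .el = σ.arr .el := (f.arr _ (by decide)).trans (by simpa using hel1)
    have hmk' : τ.arr .mk = τ1.arr .mk := (f.arr _ (by decide)).trans (by simp)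
    have hp' : τ.reg .p = p := (f.reg _ (by decide)).trans (by simpa using hp1)
    refine wp_mono (wp_frame (mark_spec (by omega) hW b1.layout hp hp' (Nat.zero_le _))) ?_
    rintro υ ⟨⟨g1, g2, g3⟩, fυ⟩
    rw [hel', ← hE] at g3
    refine ⟨lam', k', r, b1.frame fυ (by decide) (by decide), fun y => ?_, b3,
      fun y hy hyp h0 => ?_,
      b4, b5, by omega, b7, by omega⟩
    · by_cases hy : y ∈ nbr P p
      · exact g1 y hy
      · rw [g2 y hy, hmk', hm2 y hy, hmk]
    · have : unlabelled P lam' p = ∅ := Finset.card_eq_zero.1 (by omega)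
      have hmem := mem_unlabelled.2 ⟨⟨hy, hyp⟩, h0⟩
      rw [this] at hmem
      exact absurd hmem (Finset.notMem_empty _)

/-! ### Properties of smallest-last orders -/

/-- Every position `p < n` has minimum degree among the positions up to `p`. -/
def SmallestLast (n : ℕ) (P : SimpleGraph ℕ) : Prop :=
  ∀ p < n, ∀ y ≤ p, (earlier P p p).length ≤ (earlier P (p + 1) y).length

/-- The number of earlier positions that are not neighbours of `z`. -/
noncomputable def gap (P : SimpleGraph ℕ) (z : ℕ) : ℕ := z - (earlier P z z).length

theorem length_earlier_le_self (P : SimpleGraph ℕ) (k z : ℕ) : (earlier P k z).length ≤ k :=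
  (List.length_filter_le _ _).trans_eq List.length_range

/-- The earlier neighbours of `w`, its earlier non-neighbours and `w` itself are among the `p + 1`
positions up to `p`. -/
theorem card_nonNear_add (P : SimpleGraph ℕ) {p w : ℕ} (hw : w < p) :
    (earlier P (p + 1) w).length + (nonNear P p w).card ≤ p := by
  classical
  have h1 : Disjoint (earlier P (p + 1) w).toFinset (nonNear P p w) := by
    rw [Finset.disjoint_left]
    intro y hy hy'
    exact (mem_nonNear.1 hy').2 (Or.inr (mem_earlier.1 (List.mem_toFinset.1 hy)).2)
  have h2 : w ∉ (earlier P (p + 1) w).toFinset ∪ nonNear P p w := by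
    rw [Finset.mem_union, not_or]
    exact ⟨fun h => P.irrefl (mem_earlier.1 (List.mem_toFinset.1 h)).2,
      fun h => (mem_nonNear.1 h).2 (Near.refl P w)⟩
  have h3 : insert w ((earlier P (p + 1) w).toFinset ∪ nonNear P p w) ⊆ Finset.range (p + 1) := by
    intro y hy
    rw [Finset.mem_insert, Finset.mem_union] at hy
    rw [Finset.mem_range]
    rcases hy with rfl | hy | hy
    · omega
    · exact (mem_earlier.1 (List.mem_toFinset.1 hy)).1
    · have := (mem_nonNear.1 hy).1
      omega
  have h4 := Finset.card_le_card h3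
  rw [Finset.card_insert_of_notMem h2, Finset.card_union_of_disjoint h1, Finset.card_range,
    List.toFinset_card_of_nodup (nodup_earlier P _ _)] at h4
  omega

/-- An earlier position has at most as many non-neighbours as `p`, since its degree among the
positions up to `p` is at least the degree of `p`. -/
theorem SmallestLast.card_nonNear_le {n p w : ℕ} {P : SimpleGraph ℕ} (h : SmallestLast n P)
    (hp : p < n) (hw : w < p) : (nonNear P p w).card ≤ gap P p := by
  have h1 := card_nonNear_add P hw
  have h2 := h p hp w hw.le
  unfold gap
  omega

theorem length_earlier_eq_self {P : SimpleGraph ℕ} {z : ℕ} :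
    (earlier P z z).length = z ↔ ∀ y < z, P.Adj y z := by
  classical
  have := List.length_filter_eq_length_iff (p := fun y => decide (P.Adj y z)) (l := List.range z)
  rw [List.length_range] at this
  simp only [List.mem_range, decide_eq_true_eq] at this
  rw [← this, earlier]

/-- If a position is not adjacent to all earlier ones, then neither is any later position. -/
theorem SmallestLast.gap_pos {n a p : ℕ} {P : SimpleGraph ℕ} (h : SmallestLast n P)
    (ha : (earlier P a a).length ≠ a) (hap : a ≤ p) (hp : p < n) : 0 < gap P p := by
  have hle := length_earlier_le_self P p p
  have hne : (earlier P p p).length ≠ p := by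
    rcases Nat.eq_or_lt_of_le hap with rfl | hap
    · exact ha
    intro heq
    refine ha (length_earlier_eq_self.2 fun y hy => ?_)
    by_contra hya
    -- Otherwise `a`, like `p`, has degree `p` among the positions up to `p`.
    have h1 := card_nonNear_add P hap
    have h2 := h p hp a hap.le
    have h3 : 0 < (nonNear P p a).card := Finset.card_pos.2 ⟨y, mem_nonNear.2 ⟨by omega, ?_⟩⟩
    · omega
    · rintro (h | h)
      · omega
      · exact hya h
  unfold gap
  omega

/-- In a smallest-last order of a graph with at least one edge, the first two vertices are
adjacent. Hence the initial clique has an edge, and its label is used. -/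
theorem SmallestLast.adj_zero_one {n : ℕ} {P : SimpleGraph ℕ} (h : SmallestLast n P)
    (he : ∃ z < n, (earlier P z z).length ≠ 0) : P.Adj 0 1 := by
  classical
  have hmin : ∀ m < Nat.find he, (earlier P m m).length = 0 := fun m hm => by
    have := Nat.find_min he hm
    have hlt := (Nat.find_spec he).1
    by_contra h0
    exact this ⟨by omega, h0⟩
  -- Let `p` be the first position with an earlier neighbour. It has minimum degree, so all earlier
  -- positions are adjacent to it; as they have no other neighbour, `p` has only one.
  obtain ⟨hpn, hp0⟩ := Nat.find_spec he
  set p := Nat.find he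
  have hnone : ∀ y z, y < p → z < p → ¬ P.Adj y z := by
    have : ∀ y z, y < z → z < p → ¬ P.Adj y z := fun y z hyz hz hadj => by
      have := List.length_eq_zero_iff.1 (hmin z hz)
      have h' := mem_earlier.2 ⟨hyz, hadj⟩
      rw [this] at h'
      exact absurd h' List.not_mem_nil
    intro y z hy hz hadj
    rcases lt_trichotomy y z with hlt | rfl | hlt
    · exact this y z hlt hz hadj
    · exact P.irrefl hadj
    · exact this z y hlt hy hadj.symm
  have hsucc : ∀ y < p, earlier P (p + 1) y = if P.Adj p y then [p] else [] := by
    intro y hy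
    have hnil : earlier P p y = [] := List.eq_nil_iff_forall_not_mem.2 fun z hz => by
      have := mem_earlier.1 hz
      exact hnone z y this.1 hy this.2
    rw [earlier_succ, hnil, List.nil_append]
  have hall : ∀ y < p, P.Adj y p := by
    intro y hy
    by_contra hadj
    have h1 := h p hpn y hy.le
    rw [hsucc y hy, if_neg fun h => hadj h.symm, List.length_nil] at h1
    omega
  have hp1 : p = (earlier P p p).length := (length_earlier_eq_self.2 hall).symm
  have hple : p ≤ 1 := by
    have h1 := h p hpn 0 (Nat.zero_le _)
    rw [← hp1] at h1
    refine h1.trans ?_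
    rw [hsucc 0 (by omega)]
    split_ifs <;> simp
  have : p = 1 := by omega
  rw [← this]
  exact hall 0 (by omega)

/-! ### The initial clique, and the loop over the positions -/

/-- The labelling of the edges before position `p` by `1`, when these positions form a clique. -/
def prefixLabels (p y z : ℕ) : ℕ := if y < z ∧ z < p then 1 else 0

/-- Label all edges between the first positions by `1`, as long as these positions form a
clique. The loop stops at position `n` at the latest, as `el n = 0`. -/
def coverPrefix : Com :=
  .set .k (.c 1) ;;
  .set .p (.c 1) ;;
  .loop (.eq (.rd .el (.v .p)) (.v .p)) (
    .set .j (.rd .eo (.v .p)) ;;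
    .set .je (.plus (.v .j) (.v .p)) ;;
    .upto .j (.v .je) (.put .lab (.v .j) (.c 1)) ;;
    .put .tot (.c 1) (.plus (.rd .tot (.c 1)) (.v .p)) ;;
    .set .p (.plus (.v .p) (.c 1)))

theorem isCover_prefixLabels {P : SimpleGraph ℕ} {a : ℕ} (ha : 2 ≤ a)
    (h : ∀ z < a, (earlier P z z).length = z) : IsCover P (prefixLabels a) 1 := by
  have hadj : ∀ y z, y < z → z < a → P.Adj y z := fun y z hyz hz =>
    length_earlier_eq_self.1 (h z hz) y hyz
  have hinc : ∀ c x, c ≠ 0 → Inc (prefixLabels a) c x → x < a := by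
    rintro c x hc ⟨y, hy | hy⟩ <;> unfold prefixLabels at hy <;> split_ifs at hy with h' <;> omega
  refine ⟨fun {y z} hyz => ?_, fun y z => ?_, fun c hc hc1 => ⟨0, 1, ?_⟩, fun c hc x y hx hy => ?_,
    fun b c hb hb1 hc hc1 hbc => by omega⟩
  · unfold prefixLabels at hyz
    split_ifs at hyz with h'
    · exact ⟨h'.1, hadj y z h'.1 h'.2⟩
    · exact absurd rfl hyz
  · unfold prefixLabels
    split_ifs <;> omega
  · have : prefixLabels a 0 1 = 1 := if_pos (by omega)
    omega
  · have hx := hinc c x hc hx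
    have hy := hinc c y hc hy
    rcases lt_trichotomy x y with hlt | rfl | hlt
    · exact Or.inr (hadj x y hlt hy)
    · exact Near.refl P x
    · exact Or.inr (hadj y x hlt hx).symm

theorem card_labelled_prefixLabels_succ {n p : ℕ} (hp : p < n) :
    (labelled n (prefixLabels (p + 1)) 1).card = (labelled n (prefixLabels p) 1).card + p := by
  have : prefixLabels (p + 1) = relabel (prefixLabels p) p (Finset.range p) 1 := by
    funext y z
    simp only [prefixLabels, relabel, Finset.mem_range]
    split_ifs <;> omega
  rw [this, card_labelled_relabel hp (fun x hx => ⟨(Finset.mem_range.1 hx).trans hp, ?_⟩)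
    one_ne_zero, if_pos rfl, Finset.card_range]
  exact if_neg (by omega)

theorem coverPrefix_spec {n M W : ℕ} {P : SimpleGraph ℕ} {σ : HState}
    (hM : 4 * (1 + n + edgeCount n P) ≤ M) (hW : 8 * M ≤ W) (hL : Layout n M P σ)
    (hn : 2 ≤ n) (h01 : P.Adj 0 1)
    (h0 : ∀ b ∈ [Arr.lab, .tot, .inX, .g, .cnt], ∀ x, σ.arr b x = 0) :
    wp M W coverPrefix (fun τ => ∃ a, 2 ≤ a ∧ a ≤ n ∧ (∀ z < a, (earlier P z z).length = z) ∧
      (a < n → (earlier P a a).length ≠ a) ∧ τ.reg .p = a ∧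
      CoverInv n M P (prefixLabels a) 1 τ ∧ τ.clk = σ.clk + ∑ z ∈ Finset.Ico 1 a, (z + 1)) σ := by
  have hlen : ∀ z < n, σ.arr .el z = (earlier P z z).length := fun z hz => by
    have := hL.el z hz
    simp only [nbr, List.length_append, List.length_singleton] at this
    omega
  simp only [coverPrefix, wp_eqs, reduceCtorEq, if_true, if_false, true_and, and_true]
  refine ⟨by omega, by omega, ?_⟩
  refine wp_loop (fun τ => ∃ a, 1 ≤ a ∧ a ≤ n ∧ (∀ z < a, (earlier P z z).length = z) ∧
      τ.reg .p = a ∧ Labels n P (σ.arr .eo) (τ.arr .lab) (prefixLabels a) ∧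
      τ.arr .tot = Function.update (fun _ => 0) 1 (labelled n (prefixLabels a) 1).card ∧
      τ.clk = σ.clk + ∑ z ∈ Finset.Ico 1 a, (z + 1)) (fun τ => n - τ.reg .p) ?_ ?_ ?_ ?_
  · refine ⟨1, le_rfl, by omega, fun z hz => ?_, by simp, fun z hz i hi => ?_, ?_, by simp⟩
    · obtain rfl : z = 0 := by omega
      simp [earlier]
    · rw [prefixLabels, if_neg (by omega)]
      exact h0 .lab (by decide) _
    · have : labelled n (prefixLabels 1) 1 = ∅ := by
        refine Finset.eq_empty_of_forall_notMem fun e he => ?_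
        have := (mem_labelled.1 he).2.2
        rw [prefixLabels, if_neg (by omega)] at this
        omega
      rw [this]
      funext c
      simp [h0 .tot (by decide) c]
  · rintro τ ⟨a, h1, h2, h3, h4, -⟩ -
    simp only [Bx.ok, Ex.ok, Ex.eval, h4, true_and, and_true]
    omega
  · rintro τ ⟨a, h1, h2, h3, h4, h5, h6, h7⟩ f hb
    have hel : τ.arr .el = σ.arr .el := (f.arr _ (by decide)).trans (by simp)
    have heo : τ.arr .eo = σ.arr .eo := (f.arr _ (by decide)).trans (by simp)
    simp only [Bx.holds, Ex.eval, h4, hel] at hb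
    have han : a < n := by
      by_contra h
      rw [hL.el_top a (by omega)] at hb
      omega
    have hlt := hL.lt a han
    have hela := hlen a han
    have htot : (labelled n (prefixLabels a) 1).card ≤ edgeCount n P := by
      refine card_labelled_le (fun {y z} hyz => ?_) one_ne_zero
      unfold prefixLabels at hyz
      split_ifs at hyz with h'
      · exact ⟨h'.1, length_earlier_eq_self.1 (h3 z h'.2) y h'.1⟩
      · exact absurd rfl hyz
    simp only [wp_eqs, reduceCtorEq, if_true, if_false, true_and, and_true, h4, heo]
    refine ⟨by omega, by omega, ?_⟩
    refine wp_upto (fun j υ => ∃ t, j = σ.arr .eo a + t ∧ t ≤ a ∧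
        υ.arr .lab = (fun i => if σ.arr .eo a ≤ i ∧ i < σ.arr .eo a + t then 1 else τ.arr .lab i) ∧
        υ.clk = τ.clk + 1 + t) (σ.arr .eo a + a) (by decide) (by omega) ?_ ?_ ?_ ?_ ?_
    · simp
    · simp only [wp_eqs, reduceCtorEq, if_true, if_false, true_and, and_true]
      refine ⟨0, by omega, by omega, ?_, by omega⟩
      funext i
      rw [if_neg (by omega)]
    · rintro υ hf - -
      refine ⟨trivial, ?_⟩
      simp only [Ex.eval]
      rw [hf.reg _ (by decide)]
      simp
    · rintro υ hf hj1 hj2 ⟨t, e0, e1, u1, u2⟩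
      simp only [wp_eqs, reduceCtorEq, if_true, if_false, true_and, and_true, e0]
      refine ⟨by omega, by omega, t + 1, by omega, by omega, ?_, by omega⟩
      funext i
      simp only [Function.update_apply, u1]
      split_ifs <;> first | rfl | omega
    · rintro υ hf - ⟨t, e0, e1, u1, u2⟩
      obtain rfl : t = a := by omega
      have hpυ : υ.reg .p = t := by rw [hf.reg _ (by decide)]; simpa using h4
      have htυ : υ.arr .tot = τ.arr .tot := by rw [hf.arr _ (by decide)]; simp
      simp only [wp_eqs, reduceCtorEq, if_true, if_false, true_and, and_true, hpυ, htυ, h6,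
        Function.update_self, Function.update_idem]
      refine ⟨by omega, by omega, by omega, by omega, ⟨t + 1, by omega, by omega, fun z hz => ?_,
        by omega, fun z hz i hi => ?_, ?_, ?_⟩, by omega⟩
      · rcases Nat.lt_succ_iff_lt_or_eq.1 hz with hz | rfl
        · exact h3 z hz
        · omega
      · have hiz := hL.el z hz
        rw [u1]
        have hval := h5 z hz i hi
        by_cases hzt : z = t
        · subst hzt
          have hnbr : (nbr P z).length = z + 1 := by omega
          rcases Nat.lt_or_ge i z with hiz' | hiz'
          · have htake : (nbr P z)[i] ∈ earlier P z z := by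
              rw [← take_nbr P z (t := z) (by omega)]
              exact List.mem_take_iff_getElem.2 ⟨i, by omega, rfl⟩
            have := (mem_earlier.1 htake).1
            simp only [prefixLabels]
            rw [if_pos (by omega), if_pos (by omega)]
          · have : (nbr P z)[i] = z := by
              have hi' : i = (earlier P z z).length := by omega
              subst hi'
              simp [nbr]
            simp only [prefixLabels, this] at hval ⊢
            rw [if_neg (by omega), hval]
            simp
        · have : ¬ (σ.arr .eo t ≤ σ.arr .eo z + i ∧ σ.arr .eo z + i < σ.arr .eo t + t) := by
            rintro ⟨g1, g2⟩
            exact hzt (hL.inj z hz t han i (by omega) (σ.arr .eo z + i - σ.arr .eo t) (by omega)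
              (by omega)).1
          simp only [this, if_false, hval, prefixLabels]
          split_ifs <;> omega
      · rw [card_labelled_prefixLabels_succ han]
      · rw [Finset.sum_Ico_succ_top (by omega)]
        omega
  · rintro τ ⟨a, h1, h2, h3, h4, h5, h6, h7⟩ f hb
    have hel : τ.arr .el = σ.arr .el := (f.arr _ (by decide)).trans (by simp)
    have heo : τ.arr .eo = σ.arr .eo := (f.arr _ (by decide)).trans (by simp)
    have hnb : τ.arr .nb = σ.arr .nb := (f.arr _ (by decide)).trans (by simp)
    simp only [Bx.holds, Ex.eval, h4, hel] at hb
    have ha2 : 2 ≤ a := by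
      by_contra h
      obtain rfl : a = 1 := by omega
      refine hb ?_
      rw [hlen 1 (by omega), length_earlier_eq_self]
      intro y hy
      obtain rfl : y = 0 := by omega
      exact h01
    refine ⟨a, ha2, h2, h3, fun ha h => hb ((hlen a ha).trans h), h4,
      ⟨⟨?_, hel ▸ hL.el, hel ▸ hL.el_top, hnb ▸ heo ▸ hL.seg, heo ▸ hel ▸ hL.inj,
        heo ▸ hel ▸ hL.lt⟩, heo ▸ h5, fun c hc => ?_, ?_, fun x => ?_, fun x => ?_, fun x => ?_, ?_,
        isCover_prefixLabels ha2 h3⟩, h7⟩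
    · rw [f.reg _ (by decide)]; simpa using hL.reg_n
    · rw [h6, Function.update_apply]
      split_ifs with h
      · rw [h]
      · rw [eq_comm, Finset.card_eq_zero]
        refine Finset.eq_empty_of_forall_notMem fun e he => ?_
        have := (mem_labelled.1 he).2.2
        unfold prefixLabels at this
        split_ifs at this <;> omega
    · rw [h6]; simp
    · rw [f.arr _ (by decide)]; simpa using h0 .inX (by decide) x
    · rw [f.arr _ (by decide)]; simpa using h0 .g (by decide) x
    · rw [f.arr _ (by decide)]; simpa using h0 .cnt (by decide) x
    · rw [f.reg _ (by decide)]; simp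

/-- Compute a labelling of all edges. -/
def cover : Com :=
  coverPrefix ;;
  .loop (.lt (.v .p) (.v .n)) (
    step ;;
    .set .p (.plus (.v .p) (.c 1)))

/-- A bound for the time that is spent on position `z`, when no position has more than `D` earlier
neighbours. -/
noncomputable def stepCost (P : SimpleGraph ℕ) (D z : ℕ) : ℕ :=
  2 * ((earlier P z z).length + 1) + 1 + min (earlier P z z).length (2 * gap P z) *
    (6 * (((earlier P z z).length + 1) * (D + 2)) + 1)

theorem cover_spec {n M W D : ℕ} {P : SimpleGraph ℕ} {σ : HState}
    (hM : 4 * (1 + n + edgeCount n P) ≤ M) (hW : 8 * M ≤ W) (hL : Layout n M P σ)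
    (hn : 2 ≤ n) (hP : ∀ y z, P.Adj y z → y < n) (hs : SmallestLast n P)
    (he : ∃ z < n, (earlier P z z).length ≠ 0) (hD : ∀ z < n, (earlier P z z).length ≤ D)
    (h0 : ∀ b ∈ [Arr.lab, .tot, .inX, .g, .cnt, .mk], ∀ x, σ.arr b x = 0) :
    wp M W cover (fun τ => ∃ lam k, CoverInv n M P lam k τ ∧
      (∀ y z, y < z → P.Adj y z → lam y z ≠ 0) ∧ k ≤ 1 + 2 * ∑ z ∈ Finset.range n, gap P z ∧
      τ.clk ≤ σ.clk + ∑ z ∈ Finset.range n, stepCost P D z) σ := by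
  have hlen : ∀ z < n, σ.arr .el z = (earlier P z z).length := fun z hz => by
    have := hL.el z hz
    simp only [nbr, List.length_append, List.length_singleton] at this
    omega
  unfold cover
  rw [wp_seq]
  refine wp_mono (wp_frame (coverPrefix_spec hM hW hL hn (hs.adj_zero_one he)
    fun b hb => h0 b (by simp at hb ⊢; tauto))) ?_
  rintro τ ⟨⟨a, a2, an, hlow, hbreak, hpτ, hI, hclk⟩, f⟩
  have hel : τ.arr .el = σ.arr .el := f.arr _ (by decide)
  have hmk : τ.arr .mk = σ.arr .mk := f.arr _ (by decide)
  refine wp_loop (fun υ => ∃ p lam k, a ≤ p ∧ p ≤ n ∧ υ.reg .p = p ∧ CoverInv n M P lam k υ ∧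
      (∀ y, υ.arr .mk y = 0) ∧ (∀ y z, p ≤ z → lam y z = 0) ∧
      (∀ y z, y < z → z < p → P.Adj y z → lam y z ≠ 0) ∧
      k ≤ 1 + 2 * ∑ z ∈ Finset.range p, gap P z ∧
      υ.clk ≤ σ.clk + ∑ z ∈ Finset.range p, stepCost P D z) (fun υ => n - υ.reg .p) ?_ ?_ ?_ ?_
  · refine ⟨a, prefixLabels a, 1, le_rfl, an, hpτ, hI, fun y => ?_, fun y z hz => ?_,
      fun y z hyz hz _ => ?_, by omega, ?_⟩
    · rw [hmk]; exact h0 .mk (by decide) y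
    · exact if_neg (by omega)
    · rw [prefixLabels, if_pos ⟨hyz, hz⟩]; exact one_ne_zero
    · rw [hclk]
      refine Nat.add_le_add_left ?_ _
      refine (Finset.sum_le_sum_of_subset (t := Finset.range a) fun z hz => ?_).trans
        (Finset.sum_le_sum fun z hz => ?_)
      · exact Finset.mem_range.2 (Finset.mem_Ico.1 hz).2
      · have := hlow z (Finset.mem_range.1 hz)
        unfold stepCost
        omega
  · rintro υ - -
    exact ⟨trivial, trivial⟩
  · rintro υ ⟨p, lam, k, hap, hpn, hpυ, hIυ, hmkυ, hlate, hdone, hk, hcl⟩ fυ hb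
    simp only [Bx.holds, Ex.eval, hpυ, hIυ.layout.reg_n] at hb
    have helυ : υ.arr .el = σ.arr .el := (fυ.arr _ (by decide)).trans hel
    have hIt : CoverInv n M P lam k υ.tick := by
      obtain ⟨a1, a2, a3, a4, a5, a6, a7, a8, a9⟩ := hIυ
      exact ⟨⟨a1.reg_n, a1.el, a1.el_top, a1.seg, a1.inj, a1.lt⟩, a2, a3, a4, a5, a6, a7, a8, a9⟩
    -- Here `gap P p + 1 ≤ 2 * gap P p`, which bounds the number of rounds.
    have hgap : 0 < gap P p := hs.gap_pos (hbreak (by omega)) hap hb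
    rw [wp_seq]
    refine wp_mono (wp_frame (step_spec (D := D) hM hW hP hIt hb hpυ hmkυ (fun z hz => ?_) hlate
      fun w hw => hs.card_nonNear_le hb hw)) ?_
    · rw [HState.arr_tick, helυ, hlen z hz]; exact hD z hz
    rintro ω ⟨⟨lam', k', r, c1, c2, c3, c4, c5, c6, c7, c8, c9⟩, fω⟩
    have hpω : ω.reg .p = p := (fω.reg _ (by decide)).trans hpυ
    rw [wp_set, Ex.eval, Ex.eval, Ex.eval, hpω]
    simp only [HState.arr_tick, HState.clk_tick, helυ, hlen p hb] at c7 c9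
    refine ⟨?_, ⟨p + 1, lam', k', by omega, by omega, by simp, ?_, by simpa using c2,
      fun y z hz => ?_, fun y z hyz hz hadj => ?_, ?_, ?_⟩, ?_⟩
    · simp only [Ex.ok, Ex.eval, hpω, true_and]
      omega
    · obtain ⟨a1, a2, a3, a4, a5, a6, a7, a8, a9⟩ := c1
      exact ⟨⟨by simpa using a1.reg_n, a1.el, a1.el_top, a1.seg, a1.inj, a1.lt⟩, a2, a3, a4, a5, a6,
        a7, by simpa using a8, a9⟩
    · rw [c3 y z (by omega)]
      exact hlate y z (by omega)
    · rcases Nat.lt_succ_iff_lt_or_eq.1 hz with hz | rfl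
      · rw [c3 y z (by omega)]
        exact hdone y z hyz hz hadj
      · exact c4 y hyz hadj
    · rw [Finset.sum_range_succ]
      omega
    · rw [Finset.sum_range_succ, HState.clk_set]
      have : r * (6 * (((earlier P p p).length + 1) * (D + 2)) + 1) ≤
          min (earlier P p p).length (2 * gap P p) *
            (6 * (((earlier P p p).length + 1) * (D + 2)) + 1) :=
        Nat.mul_le_mul_right _ (by omega)
      have hcost : stepCost P D p = 2 * ((earlier P p p).length + 1) + 1 +
        min (earlier P p p).length (2 * gap P p) *
          (6 * (((earlier P p p).length + 1) * (D + 2)) + 1) := rfl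
      omega
    · simp only [HState.reg_set, if_true, hpυ]
      omega
  · rintro υ ⟨p, lam, k, hap, hpn, hpυ, hIυ, hmkυ, hlate, hdone, hk, hcl⟩ fυ hb
    simp only [Bx.holds, Ex.eval, hpυ, hIυ.layout.reg_n] at hb
    obtain rfl : p = n := by omega
    exact ⟨lam, k, hIυ, fun y z hyz hadj => hdone y z hyz (hP z y hadj.symm) hadj, hk, hcl⟩

/-! ### Output of the cliques and of their dual -/

/-- Collect the endpoints of the edges with label `c` in a linked list, with repetitions. -/
def bucketLabels : Com :=
  .set .f (.c 0) ;; .set .z (.c 0) ;;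
  .upto .z (.v .n) (
    .set .j (.rd .eo (.v .z)) ;;
    .set .je (.plus (.v .j) (.rd .el (.v .z))) ;;
    .upto .j (.v .je) (
      .set .c (.rd .lab (.v .j)) ;;
      .set .f (.plus (.v .f) (.c 1)) ;;
      .put .vl2 (.v .f) (.rd .ord (.rd .nb (.v .j))) ;;
      .put .nx2 (.v .f) (.rd .hd2 (.v .c)) ;;
      .put .hd2 (.v .c) (.v .f) ;;
      .set .f (.plus (.v .f) (.c 1)) ;;
      .put .vl2 (.v .f) (.rd .ord (.v .z)) ;;
      .put .nx2 (.v .f) (.rd .hd2 (.v .c)) ;;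
      .put .hd2 (.v .c) (.v .f)))

/-- The linked lists with heads `hd2` hold, for every label, the endpoints of those edges with this
label that satisfy `E`; the number of these edges is `s`. -/
def Collected (k : ℕ) (lam : ℕ → ℕ → ℕ) (ord : ℕ → ℕ) (E : ℕ → ℕ → Prop) (s : ℕ) (τ : HState) :
    Prop :=
  ∃ bk, Buckets (τ.arr .nx2) (τ.arr .vl2) (τ.arr .hd2) (τ.reg .f) bk ∧ τ.reg .f = 2 * s ∧
    ∑ c ∈ Finset.range (k + 1), (bk c).length = 2 * s ∧
    ∀ c x, x ∈ bk c ↔ ∃ y z, E y z ∧ lam y z = c ∧ (x = ord y ∨ x = ord z)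

/-- Both endpoints of the edge between `y` and `z` are pushed onto the list of its label. -/
theorem mem_push_endpoints {lam : ℕ → ℕ → ℕ} {ord : ℕ → ℕ} {E E' : ℕ → ℕ → Prop}
    {bk : ℕ → List ℕ} {y z : ℕ}
    (h : ∀ c x, x ∈ bk c ↔ ∃ y z, E y z ∧ lam y z = c ∧ (x = ord y ∨ x = ord z))
    (hE : ∀ y' z', E' y' z' ↔ E y' z' ∨ (y' = y ∧ z' = z)) (c x : ℕ) :
    x ∈ Function.update bk (lam y z) (ord z :: ord y :: bk (lam y z)) c ↔
      ∃ y z, E' y z ∧ lam y z = c ∧ (x = ord y ∨ x = ord z) := by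
  have key : (∃ y z, E' y z ∧ lam y z = c ∧ (x = ord y ∨ x = ord z)) ↔
      x ∈ bk c ∨ (lam y z = c ∧ (x = ord y ∨ x = ord z)) := by
    rw [h]
    constructor
    · rintro ⟨y', z', h', hc, hx⟩
      rcases (hE y' z').1 h' with h' | ⟨rfl, rfl⟩
      · exact Or.inl ⟨y', z', h', hc, hx⟩
      · exact Or.inr ⟨hc, hx⟩
    · rintro (⟨y', z', h', hc, hx⟩ | ⟨hc, hx⟩)
      · exact ⟨y', z', (hE _ _).2 (Or.inl h'), hc, hx⟩
      · exact ⟨y, z, (hE _ _).2 (Or.inr ⟨rfl, rfl⟩), hc, hx⟩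
  rw [key, Function.update_apply]
  split_ifs with h
  · subst h
    simp only [List.mem_cons, true_and]
    tauto
  · rw [or_iff_left fun h' => h h'.1.symm]

theorem sum_length_earlier_le {n : ℕ} (P : SimpleGraph ℕ) {z : ℕ} (hz : z ≤ n) :
    ∑ y ∈ Finset.range z, (earlier P y y).length ≤ edgeCount n P :=
  Finset.sum_le_sum_of_subset (Finset.range_subset_range.2 hz)

theorem bucketLabels_spec {n M W k : ℕ} {P : SimpleGraph ℕ} {lam : ℕ → ℕ → ℕ} {σ : HState}
    (hM : 4 * (1 + n + 2 * edgeCount n P) ≤ M) (hW : 8 * M ≤ W)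
    (hP : ∀ y z, P.Adj y z → y < n) (hI : CoverInv n M P lam k σ)
    (hord : ∀ p < n, σ.arr .ord p < n) (hhd : ∀ c, σ.arr .hd2 c = 0) :
    wp M W bucketLabels (fun τ =>
      Collected k lam (σ.arr .ord) (fun y z => y ∈ earlier P z z ∧ z < n) (edgeCount n P) τ ∧
      τ.clk = σ.clk + n + edgeCount n P) σ := by
  have hL := hI.layout
  have hk := hI.cover.le_edgeCount hP
  have hlen : ∀ z < n, σ.arr .el z = (earlier P z z).length := fun z hz => by
    have := hL.el z hz
    simp only [nbr, List.length_append, List.length_singleton] at this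
    omega
  simp only [bucketLabels, wp_eqs, reduceCtorEq, if_true, if_false, true_and, and_true]
  refine ⟨by omega, by omega, ?_⟩
  refine wp_upto (fun z τ => z ≤ n ∧ Collected k lam (σ.arr .ord)
      (fun y z' => y ∈ earlier P z' z' ∧ z' < z)
      (∑ y ∈ Finset.range z, (earlier P y y).length) τ ∧
      τ.clk = σ.clk + z + ∑ y ∈ Finset.range z, (earlier P y y).length)
      n (by decide) (by omega) (by simp) ?_ ?_ ?_ ?_
  · refine ⟨by simp, ⟨fun _ => [], ?_, by simp, by simp, by simp⟩, by simp⟩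
    intro c
    simp [Chain, hhd]
  · rintro τ hf - -
    refine ⟨trivial, ?_⟩
    simp only [Ex.eval]
    rw [hf.reg _ (by decide)]
    simpa using hL.reg_n
  · rintro τ hf - hzn ⟨-, hC, hclk⟩
    have heo : τ.arr .eo = σ.arr .eo := (hf.arr _ (by decide)).trans (by simp)
    have hel : τ.arr .el = σ.arr .el := (hf.arr _ (by decide)).trans (by simp)
    have hnb : τ.arr .nb = σ.arr .nb := (hf.arr _ (by decide)).trans (by simp)
    have hla : τ.arr .lab = σ.arr .lab := (hf.arr _ (by decide)).trans (by simp)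
    have hor : τ.arr .ord = σ.arr .ord := (hf.arr _ (by decide)).trans (by simp)
    generalize hz : τ.reg .z = z at hzn hC hclk ⊢
    have hlt := hL.lt z hzn
    have hle := hL.el z hzn
    have hEz := hlen z hzn
    have hsum := sum_length_earlier_le P (Nat.succ_le_of_lt hzn)
    rw [Finset.sum_range_succ] at hsum
    rw [Finset.sum_range_succ]
    simp only [wp_eqs, reduceCtorEq, if_true, if_false, true_and, and_true, hz, heo, hel]
    refine ⟨by omega, by omega, ?_⟩
    refine wp_upto (fun j υ => ∃ t, j = σ.arr .eo z + t ∧ t ≤ σ.arr .el z ∧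
        Collected k lam (σ.arr .ord) (fun y z' => (y ∈ earlier P z' z' ∧ z' < z) ∨
          z' = z ∧ y ∈ (nbr P z).take t)
        (∑ y ∈ Finset.range z, (earlier P y y).length + t) υ ∧ υ.clk = τ.clk + 1 + t)
        (σ.arr .eo z + σ.arr .el z) (by decide) (by omega) ?_ ?_ ?_ ?_ ?_
    · simp
    · simp only [wp_eqs, reduceCtorEq, if_true, if_false, true_and, and_true]
      refine ⟨0, by omega, by omega, ?_, by omega⟩
      obtain ⟨bk, h1, h2, h3, h4⟩ := hC
      exact ⟨bk, h1, h2, h3, by simpa using h4⟩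
    · rintro υ hfυ - -
      refine ⟨trivial, ?_⟩
      simp only [Ex.eval]
      rw [hfυ.reg _ (by decide)]
      simp
    · rintro υ hfυ - hj ⟨t, e0, e1, ⟨bk, h1, h2, h3, h4⟩, h5⟩
      have hnbυ : υ.arr .nb = σ.arr .nb := (hfυ.arr _ (by decide)).trans (by simpa using hnb)
      have hlaυ : υ.arr .lab = σ.arr .lab := (hfυ.arr _ (by decide)).trans (by simpa using hla)
      have horυ : υ.arr .ord = σ.arr .ord := (hfυ.arr _ (by decide)).trans (by simpa using hor)
      have hzυ : υ.reg .z = z := (hfυ.reg _ (by decide)).trans (by simpa using hz)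
      have ht : t < (nbr P z).length := by omega
      have hy := hL.seg z hzn t ht
      have hlab := hI.lab z hzn t ht
      have htk : (nbr P z).take (t + 1) = (nbr P z).take t ++ [(nbr P z)[t]] :=
        List.take_succ_eq_append_getElem ht
      have hyz := (mem_nbr.1 (List.getElem_mem ht)).1
      generalize (nbr P z)[t] = y at hy hlab htk hyz
      have hoy := hord y (by omega)
      have hoz := hord z hzn
      have hlk := hI.cover.le y z
      have hhdf := fun h => (h1.eq_cons (k := lam y z) h).1
      have b1 : υ.arr .hd2 (lam y z) < W := by
        by_cases h : υ.arr .hd2 (lam y z) = 0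
        · omega
        · have := hhdf h; omega
      have hpush := (h1.push (lam y z) (σ.arr .ord y)).push (lam y z) (σ.arr .ord z)
      have e2 := sum_length_update bk (n := k + 1) (k := lam y z) (by omega)
        (σ.arr .ord z :: σ.arr .ord y :: bk (lam y z))
      simp only [Function.update_self, Function.update_idem] at hpush
      rw [List.length_cons, List.length_cons] at e2
      simp only [wp_eqs, reduceCtorEq, if_true, if_false, true_and, and_true, e0, hlaυ, hlab, hnbυ,
        hy, horυ, hzυ, Function.update_self,
        Function.update_idem]
      refine ⟨by omega, by omega, by omega, by omega, by omega, by omega, by omega, by omega,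
        by omega, by omega, by omega,
        by omega, by omega,
        t + 1, by omega, by omega, ⟨Function.update bk (lam y z)
        (σ.arr .ord z :: σ.arr .ord y :: bk (lam y z)), ?_, ?_, by omega, fun c x => ?_⟩, by omega⟩
      · simp only [wp_eqs, reduceCtorEq, if_true, if_false, true_and, and_true,
          Function.update_self, Function.update_idem]
        exact hpush
      · simp only [wp_eqs, reduceCtorEq, if_true, if_false, true_and, and_true]
        omega
      · refine mem_push_endpoints h4 (fun y' z' => ?_) c x
        rw [htk, List.mem_append, List.mem_singleton]
        constructor
        · rintro (h | ⟨rfl, h | rfl⟩)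
          · exact Or.inl (Or.inl h)
          · exact Or.inl (Or.inr ⟨rfl, h⟩)
          · exact Or.inr ⟨rfl, rfl⟩
        · rintro ((h | ⟨rfl, h⟩) | ⟨rfl, rfl⟩)
          · exact Or.inl h
          · exact Or.inr ⟨rfl, Or.inl h⟩
          · exact Or.inr ⟨rfl, Or.inr rfl⟩
    · rintro υ hfυ - ⟨t, e0, e1, ⟨bk, h1, h2, h3, h4⟩, h5⟩
      obtain rfl : t = σ.arr .el z := by omega
      have hzυ : υ.reg .z = z := (hfυ.reg _ (by decide)).trans (by simpa using hz)
      rw [hlen z hzn] at h2 h3 h5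
      refine ⟨by omega, ⟨bk, by simpa using h1, by simpa using h2, h3, fun c x => ?_⟩, ?_⟩
      · rw [h4, take_nbr P z hle]
        refine exists_congr fun y => exists_congr fun z' => and_congr_left fun _ => ?_
        constructor
        · rintro (h | ⟨rfl, h⟩)
          · exact ⟨h.1, by omega⟩
          · exact ⟨h, by omega⟩
        · rintro ⟨h, h'⟩
          rcases Nat.lt_succ_iff_lt_or_eq.1 h' with h' | rfl
          · exact Or.inl ⟨h, h'⟩
          · exact Or.inr ⟨rfl, h⟩
      · omega
  · rintro τ hf - ⟨-, h1, h2⟩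
    exact ⟨h1, h2⟩

/-- The list `l` without repetitions: each element is kept at its first occurrence. -/
def firsts (l : List ℕ) : List ℕ := l.reverse.dedup.reverse

@[simp] theorem firsts_nil : firsts [] = [] := rfl

theorem firsts_append_singleton (l : List ℕ) (x : ℕ) :
    firsts (l ++ [x]) = if x ∈ l then firsts l else firsts l ++ [x] := by
  simp only [firsts, List.reverse_append, List.reverse_cons, List.reverse_nil, List.nil_append,
    List.singleton_append]
  split_ifs with h
  · rw [List.dedup_cons_of_mem (List.mem_reverse.2 h)]
  · rw [List.dedup_cons_of_notMem (by simpa using h), List.reverse_cons]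

theorem mem_firsts {l : List ℕ} {x : ℕ} : x ∈ firsts l ↔ x ∈ l := by simp [firsts]

theorem nodup_firsts (l : List ℕ) : (firsts l).Nodup :=
  List.nodup_reverse.2 (List.nodup_dedup _)

theorem length_firsts_le (l : List ℕ) : (firsts l).length ≤ l.length := by
  have := (List.dedup_sublist l.reverse).length_le
  simpa [firsts] using this

/-- The cliques with the labels `1, …, c`, when `bk` lists the endpoints of the edges by labels. -/
def cliqueLists (bk : ℕ → List ℕ) (c : ℕ) : List (List ℕ) :=
  (List.range c).map fun b => firsts (bk (b + 1))

/-- The indices below `c` of the cliques that contain `x`. -/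
def dualList (bk : ℕ → List ℕ) (c x : ℕ) : List ℕ :=
  ((List.range c).filter fun b => x ∈ bk (b + 1)).reverse

theorem cliqueLists_succ (bk : ℕ → List ℕ) (c : ℕ) :
    cliqueLists bk (c + 1) = cliqueLists bk c ++ [firsts (bk (c + 1))] := by
  simp [cliqueLists, List.range_succ]

theorem dualList_succ (bk : ℕ → List ℕ) (c x : ℕ) :
    dualList bk (c + 1) x = (if x ∈ bk (c + 1) then [c] else []) ++ dualList bk c x := by
  by_cases h : x ∈ bk (c + 1) <;> simp [dualList, List.range_succ, h]

theorem length_flatten_cliqueLists_le (bk : ℕ → List ℕ) (c : ℕ) :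
    (cliqueLists bk c).flatten.length ≤ ∑ b ∈ Finset.range c, (bk (b + 1)).length := by
  induction c with
  | zero => simp [cliqueLists]
  | succ c ih =>
    have := length_firsts_le (bk (c + 1))
    rw [cliqueLists_succ, Finset.sum_range_succ, List.flatten_append, List.length_append]
    simp only [List.flatten_cons, List.flatten_nil, List.append_nil]
    omega

/-- The state of the output when the cliques before the one with index `c` have been written, and of
this one the elements of `l`; the dual is kept in linked lists with heads `hd3`. The variable `u`
counts the entries written, and `w` is the next free index of `out`. The entry of `last` for a
vertex is the label of the last clique for which it was written, which detects repetitions. -/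
structure Emitted (n k : ℕ) (bk : ℕ → List ℕ) (c : ℕ) (l : List ℕ) (τ : HState) : Prop where
  head : τ.arr .out 0 = k
  lens : Seg (τ.arr .out) 1 ((cliqueLists bk c).map List.length)
  entries : Seg (τ.arr .out) (1 + k) ((cliqueLists bk c).flatten ++ firsts l)
  reg_u : τ.reg .u = ((cliqueLists bk c).flatten ++ firsts l).length
  reg_w : τ.reg .w = 1 + k + τ.reg .u
  dual : Buckets (τ.arr .nx3) (τ.arr .vl3) (τ.arr .hd3) (τ.reg .u)
    fun x => (if x ∈ l then [c] else []) ++ dualList bk c x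
  sum : ∑ x ∈ Finset.range n, ((if x ∈ l then [c] else []) ++ dualList bk c x).length = τ.reg .u
  last : ∀ x, τ.arr .last x ≤ c + 1 ∧ (τ.arr .last x = c + 1 ↔ x ∈ l)

/-- Write the clique with the index `c`. -/
def emitClique : Com :=
  .set .cur (.plus (.v .c) (.c 1)) ;;
  .set .s (.v .w) ;;
  .set .h (.rd .hd2 (.v .cur)) ;;
  .loop (.lt (.c 0) (.v .h)) (
    .set .x (.rd .vl2 (.v .h)) ;;
    .set .h (.rd .nx2 (.v .h)) ;;
    .ite (.eq (.rd .last (.v .x)) (.v .cur)) .nop (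
      .put .last (.v .x) (.v .cur) ;;
      .put .out (.v .w) (.v .x) ;;
      .set .w (.plus (.v .w) (.c 1)) ;;
      .set .u (.plus (.v .u) (.c 1)) ;;
      .put .vl3 (.v .u) (.v .c) ;;
      .put .nx3 (.v .u) (.rd .hd3 (.v .x)) ;;
      .put .hd3 (.v .x) (.v .u))) ;;
  .put .out (.v .cur) (.minus (.v .w) (.v .s))

theorem emitClique_spec {n M W k c T f : ℕ} {bk : ℕ → List ℕ} {σ : HState}
    (hM : k + n + T + 2 ≤ M) (hW : 8 * M ≤ W) (hf : f < M) (hc : c < k) (hcσ : σ.reg .c = c)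
    (hbk : Buckets (σ.arr .nx2) (σ.arr .vl2) (σ.arr .hd2) f bk)
    (hT : ∑ b ∈ Finset.range k, (bk (b + 1)).length ≤ T) (hn : ∀ c, ∀ x ∈ bk c, x < n)
    (hE : Emitted n k bk c [] σ) :
    wp M W emitClique (fun τ => Emitted n k bk (c + 1) [] τ ∧
      τ.clk = σ.clk + (bk (c + 1)).length) σ := by
  have hF := length_flatten_cliqueLists_le bk c
  have hT' : ∑ b ∈ Finset.range c, (bk (b + 1)).length + (bk (c + 1)).length ≤ T := by
    rw [← Finset.sum_range_succ (fun b => (bk (b + 1)).length)]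
    exact (Finset.sum_le_sum_of_subset (Finset.range_subset_range.2 hc)).trans hT
  have hclen : (cliqueLists bk c).length = c := by simp [cliqueLists]
  have hu := hE.reg_u
  have hw := hE.reg_w
  rw [firsts_nil, List.append_nil] at hu
  have hhd : σ.arr .hd2 (c + 1) ≤ f := by
    by_cases h : σ.arr .hd2 (c + 1) = 0
    · omega
    · exact (hbk.eq_cons h).1
  simp only [emitClique, wp_eqs, reduceCtorEq, if_true, if_false, true_and, and_true, hcσ]
  refine ⟨by omega, by omega, ?_⟩
  refine wp_loop (fun τ => ∃ l l', l ++ l' = bk (c + 1) ∧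
      Chain (σ.arr .nx2) (σ.arr .vl2) f (τ.reg .h) l' ∧ Emitted n k bk c l τ ∧
      τ.clk = σ.clk + l.length) (fun τ => σ.clk + (bk (c + 1)).length - τ.clk) ?_ ?_ ?_ ?_
  · refine ⟨[], bk (c + 1), rfl, by simpa using hbk (c + 1), ?_, by simp⟩
    obtain ⟨h1, h2, h3, h4, h5, h6, h7, h8⟩ := hE
    exact ⟨h1, h2, h3, by simpa using h4, by simpa using h5, by simpa using h6, by simpa using h7,
      h8⟩
  · rintro τ - -
    simp only [Bx.ok, Ex.ok, and_true]
    omega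
  · rintro τ ⟨l, l', hl, hch, hEτ, hclk⟩ fr hb
    have hb : 0 < τ.reg .h := hb
    obtain _ | ⟨x, l'⟩ := l'
    · exact absurd hch hb.ne'
    obtain ⟨-, hhf, hvx, hch⟩ := hch
    have hx : x < n := hn (c + 1) x (by rw [← hl]; simp)
    have hlen := congrArg List.length hl
    rw [List.length_append, List.length_cons] at hlen
    have hlf := length_firsts_le l
    have hnx : τ.arr .nx2 = σ.arr .nx2 := (fr.arr _ (by decide)).trans (by simp)
    have hvl : τ.arr .vl2 = σ.arr .vl2 := (fr.arr _ (by decide)).trans (by simp)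
    have hcτ : τ.reg .c = c := (fr.reg _ (by decide)).trans (by simpa using hcσ)
    have hcur : τ.reg .cur = c + 1 := (fr.reg _ (by decide)).trans (by simp)
    obtain ⟨h1, h2, h3, h4, h5, h6, h7, h8⟩ := hEτ
    have hlast := (h8 x).2
    have hlast' := (h8 x).1
    have h4' := h4
    rw [List.length_append] at h4'
    have hnext : σ.arr .nx2 (τ.reg .h) ≤ f := by
      obtain _ | ⟨y, l'⟩ := l'
      · exact (le_of_eq hch).trans (Nat.zero_le _)
      · exact hch.2.1
    have hhd3 : τ.arr .hd3 x ≤ τ.reg .u := by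
      by_cases h : τ.arr .hd3 x = 0
      · omega
      · exact (h6.eq_cons h).1
    simp only [wp_eqs, reduceCtorEq, if_true, if_false, true_and, and_true, hnx, hvl, hvx, hcτ,
      hcur]
    refine ⟨by omega, by omega, by omega, fun hxl => ?_, fun hxl => ?_⟩
    · have hxl := hlast.1 hxl
      have hmem : ∀ y, y ∈ l ++ [x] ↔ y ∈ l := fun y => by
        rw [List.mem_append, List.mem_singleton]
        exact or_iff_left_of_imp fun h => h ▸ hxl
      have hfi : firsts (l ++ [x]) = firsts l := by rw [firsts_append_singleton, if_pos hxl]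
      refine ⟨⟨l ++ [x], l', by simpa using hl, hch, ⟨h1, h2, ?_, ?_, h5, ?_, ?_, fun y => ?_⟩, ?_⟩,
        by omega⟩
      · rwa [hfi]
      · rwa [hfi]
      · simp only [wp_eqs, reduceCtorEq, if_true, if_false, true_and, and_true, hmem]; exact h6
      · simp only [wp_eqs, reduceCtorEq, if_true, if_false, true_and, and_true, hmem]; exact h7
      · rw [hmem]; exact h8 y
      · rw [List.length_append, List.length_singleton]; omega
    · have hxl : x ∉ l := fun h => hxl (hlast.2 h)
      have hfi : firsts (l ++ [x]) = firsts l ++ [x] := by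
        rw [firsts_append_singleton, if_neg hxl]
      have hmem : ∀ y, y ∈ l ++ [x] ↔ y ∈ l ∨ y = x := fun y => by
        rw [List.mem_append, List.mem_singleton]
      have hbkx : (fun y => (if y ∈ l ++ [x] then [c] else []) ++ dualList bk c y) =
          Function.update (fun y => (if y ∈ l then [c] else []) ++ dualList bk c y) x
            (c :: ((if x ∈ l then [c] else []) ++ dualList bk c x)) := by
        funext y
        by_cases hyx : y = x
        · subst hyx; simp [hxl]
        · simp [hmem, hyx]
      have hsum := sum_length_update
        (fun y => (if y ∈ l then [c] else []) ++ dualList bk c y) hx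
        (c :: ((if x ∈ l then [c] else []) ++ dualList bk c x))
      rw [h7, ← hbkx, List.length_cons] at hsum
      beta_reduce at hsum
      repeat refine ⟨by omega, ?_⟩
      refine ⟨⟨l ++ [x], l', by simpa using hl, ?_, ⟨?_, ?_, ?_, ?_, ?_, ?_, ?_, fun y => ?_⟩, ?_⟩,
        by omega⟩
      · simpa using hch
      · simp only [wp_eqs, reduceCtorEq, if_true, if_false, true_and, and_true]
        rw [Function.update_of_ne (by omega)]; exact h1
      · simp only [wp_eqs, reduceCtorEq, if_true, if_false, true_and, and_true]
        exact h2.update (Or.inr (by rw [List.length_map, hclen]; omega))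
      · simp only [wp_eqs, reduceCtorEq, if_true, if_false, true_and, and_true]
        rw [hfi, ← List.append_assoc]
        exact h3.push (by omega)
      · simp only [wp_eqs, reduceCtorEq, if_true, if_false, true_and, and_true]
        rw [hfi, ← List.append_assoc, List.length_append, ← h4]; rfl
      · simp only [wp_eqs, reduceCtorEq, if_true, if_false, true_and, and_true]; omega
      · simp only [wp_eqs, reduceCtorEq, if_true, if_false, true_and, and_true]
        rw [hbkx]
        exact h6.push x c
      · simp only [wp_eqs, reduceCtorEq, if_true, if_false, true_and, and_true]
        omega
      · simp only [wp_eqs, reduceCtorEq, if_true, if_false, true_and, and_true, hmem,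
          Function.update_apply]
        have := h8 y
        by_cases hyx : y = x
        · simp [hyx]
        · simpa [hyx] using this
      · rw [List.length_append, List.length_singleton]; omega
  · rintro τ ⟨l, l', hl, hch, hEτ, hclk⟩ fr hb
    have hb : ¬ 0 < τ.reg .h := hb
    obtain _ | ⟨x, l'⟩ := l'
    swap
    · exact absurd hch.1 hb
    rw [List.append_nil] at hl
    subst hl
    have hcur : τ.reg .cur = c + 1 := (fr.reg _ (by decide)).trans (by simp)
    have hs : τ.reg .s = σ.reg .w := (fr.reg _ (by decide)).trans (by simp)
    obtain ⟨h1, h2, h3, h4, h5, h6, h7, h8⟩ := hEτ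
    have h4' := h4
    have hlf := length_firsts_le (bk (c + 1))
    rw [List.length_append] at h4'
    have hflat : (cliqueLists bk (c + 1)).flatten =
        (cliqueLists bk c).flatten ++ firsts (bk (c + 1)) := by
      rw [cliqueLists_succ]; simp
    simp only [wp_eqs, reduceCtorEq, if_true, if_false, true_and, and_true, hcur, hs]
    repeat refine ⟨by omega, ?_⟩
    refine ⟨⟨?_, ?_, ?_, ?_, ?_, ?_, ?_, fun x => ?_⟩, by omega⟩
    · simp only [wp_eqs, reduceCtorEq, if_true, if_false, true_and, and_true]
      rw [Function.update_of_ne (by omega)]; exact h1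
    · simp only [wp_eqs, reduceCtorEq, if_true, if_false, true_and, and_true]
      rw [cliqueLists_succ, List.map_append, List.map_singleton,
        show τ.reg .w - σ.reg .w = (firsts (bk (c + 1))).length by omega]
      exact h2.push (by rw [List.length_map, hclen]; omega)
    · simp only [wp_eqs, reduceCtorEq, if_true, if_false, true_and, and_true]
      rw [hflat, firsts_nil, List.append_nil]
      exact h3.update (Or.inl (by omega))
    · simp only [wp_eqs, reduceCtorEq, if_true, if_false, true_and, and_true]
      rw [hflat, firsts_nil, List.append_nil]
      exact h4
    · simpa using h5
    · simpa [dualList_succ] using h6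
    · simpa [dualList_succ] using h7
    · have := (h8 x).1
      simp
      omega

/-- Write the number of cliques, their sizes, and their elements. -/
def emitCliques : Com :=
  .put .out (.c 0) (.v .k) ;;
  .set .w (.plus (.v .k) (.c 1)) ;;
  .set .u (.c 0) ;; .set .c (.c 0) ;;
  .upto .c (.v .k) emitClique

theorem emitCliques_spec {n M W k T f : ℕ} {bk : ℕ → List ℕ} {σ : HState}
    (hM : k + n + T + 2 ≤ M) (hW : 8 * M ≤ W) (hf : f < M) (hk : σ.reg .k = k)
    (hbk : Buckets (σ.arr .nx2) (σ.arr .vl2) (σ.arr .hd2) f bk)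
    (hT : ∑ b ∈ Finset.range k, (bk (b + 1)).length ≤ T) (hn : ∀ c, ∀ x ∈ bk c, x < n)
    (h0 : ∀ x, σ.arr .hd3 x = 0 ∧ σ.arr .last x = 0) :
    wp M W emitCliques (fun τ => Emitted n k bk k [] τ ∧
      τ.clk = σ.clk + k + ∑ b ∈ Finset.range k, (bk (b + 1)).length) σ := by
  simp only [emitCliques, wp_eqs, reduceCtorEq, if_true, if_false, true_and, and_true, hk]
  refine ⟨by omega, by omega, by omega, by omega, by omega, ?_⟩
  refine wp_upto (fun c τ => Emitted n k bk c [] τ ∧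
      τ.clk = σ.clk + c + ∑ b ∈ Finset.range c, (bk (b + 1)).length) k (by decide) (by omega)
      (by simp) ?_ ?_ ?_ ?_
  · refine ⟨⟨by simp, by simp [cliqueLists, Seg.nil], by simp [cliqueLists, Seg.nil],
      by simp [cliqueLists], by simp [add_comm], fun x => ?_, by simp [dualList], fun x => ?_⟩,
      by simp⟩
    · simpa [dualList, Chain] using (h0 x).1
    · have := (h0 x).2
      simp [this]
  · rintro τ hf' - -
    refine ⟨trivial, ?_⟩
    simp only [Ex.eval]
    rw [hf'.reg _ (by decide)]
    simpa using hk
  · rintro τ hf' - hc ⟨h1, h2⟩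
    have e1 : τ.arr .nx2 = σ.arr .nx2 := (hf'.arr _ (by decide)).trans (by simp)
    have e2 : τ.arr .vl2 = σ.arr .vl2 := (hf'.arr _ (by decide)).trans (by simp)
    have e3 : τ.arr .hd2 = σ.arr .hd2 := (hf'.arr _ (by decide)).trans (by simp)
    have hE : Emitted n k bk (τ.reg .c) [] τ.tick := by
      obtain ⟨a1, a2, a3, a4, a5, a6, a7, a8⟩ := h1
      exact ⟨a1, a2, a3, a4, a5, a6, a7, a8⟩
    refine wp_mono (emitClique_spec hM hW hf hc rfl (by
      simpa only [HState.arr_tick, e1, e2, e3] using hbk) hT hn hE) ?_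
    rintro υ ⟨⟨a1, a2, a3, a4, a5, a6, a7, a8⟩, hclk⟩
    refine ⟨⟨a1, a2, a3, by simpa using a4, by simpa using a5, by simpa using a6, by simpa using a7,
      a8⟩, ?_⟩
    rw [Finset.sum_range_succ, HState.clk_set]
    rw [HState.clk_tick] at hclk
    omega
  · rintro τ - - h
    exact h

/-- Write the number of vertices, and then, for each vertex, the number of cliques that contain it,
and these cliques. -/
def emitDual : Com :=
  .put .out (.v .w) (.v .n) ;;
  .set .o (.plus (.v .w) (.c 1)) ;;
  .set .w (.plus (.v .o) (.v .n)) ;;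
  .set .i (.c 0) ;;
  .upto .i (.v .n) (
    .set .s (.v .w) ;;
    .set .h (.rd .hd3 (.v .i)) ;;
    .loop (.lt (.c 0) (.v .h)) (
      .put .out (.v .w) (.rd .vl3 (.v .h)) ;;
      .set .w (.plus (.v .w) (.c 1)) ;;
      .set .h (.rd .nx3 (.v .h))) ;;
    .put .out (.plus (.v .o) (.v .i)) (.minus (.v .w) (.v .s)))

theorem length_flatten_map_range (bk : ℕ → List ℕ) (i : ℕ) :
    ((List.range i).map bk).flatten.length = ∑ j ∈ Finset.range i, (bk j).length := by
  induction i with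
  | zero => simp
  | succ i ih => rw [List.range_succ, Finset.sum_range_succ, ← ih]; simp

theorem emitDual_spec {n M W u : ℕ} {bk : ℕ → List ℕ} {A : List ℕ} {σ : HState}
    (hM : A.length + 1 + n + ∑ j ∈ Finset.range n, (bk j).length ≤ M) (hW : 8 * M ≤ W) (hu : u < M)
    (hnσ : σ.reg .n = n) (hbk : Buckets (σ.arr .nx3) (σ.arr .vl3) (σ.arr .hd3) u bk)
    (hlt : ∀ i, ∀ b ∈ bk i, b < W) (hA : Seg (σ.arr .out) 0 A) (hw : σ.reg .w = A.length) :
    wp M W emitDual (fun τ => Seg (τ.arr .out) 0 (A ++ encodeLists ((List.range n).map bk)) ∧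
      τ.clk = σ.clk + n + ∑ j ∈ Finset.range n, (bk j).length) σ := by
  simp only [emitDual, wp_eqs, reduceCtorEq, if_true, if_false, true_and, and_true, hnσ, hw]
  repeat refine ⟨by omega, ?_⟩
  set B := A.length with hB
  have hle : ∀ i ≤ n, ∑ j ∈ Finset.range i, (bk j).length ≤
      ∑ j ∈ Finset.range n, (bk j).length := fun i hi =>
    Finset.sum_le_sum_of_subset (Finset.range_subset_range.2 hi)
  refine wp_upto (fun i τ => i ≤ n ∧ Seg (τ.arr .out) 0 A ∧ τ.arr .out B = n ∧
      Seg (τ.arr .out) (B + 1) ((List.range i).map fun j => (bk j).length) ∧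
      Seg (τ.arr .out) (B + 1 + n) ((List.range i).map bk).flatten ∧
      τ.reg .w = B + 1 + n + ∑ j ∈ Finset.range i, (bk j).length ∧
      τ.clk = σ.clk + i + ∑ j ∈ Finset.range i, (bk j).length) n (by decide) (by omega)
      (by simp) ?_ ?_ ?_ ?_
  · simp only [wp_eqs, reduceCtorEq, if_true, if_false, true_and, and_true]
    refine ⟨by omega, hA.update (Or.inr (by omega)), by simp, by simp [Seg.nil], by simp [Seg.nil],
      by simp, by simp⟩
  · rintro τ hf - -
    refine ⟨trivial, ?_⟩
    simp only [Ex.eval]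
    rw [hf.reg _ (by decide)]
    simpa using hnσ
  · rintro τ hf - hi ⟨-, h1, h2, h3, h4, h5, h6⟩
    have e1 : τ.arr .nx3 = σ.arr .nx3 := (hf.arr _ (by decide)).trans (by simp)
    have e2 : τ.arr .vl3 = σ.arr .vl3 := (hf.arr _ (by decide)).trans (by simp)
    have e3 : τ.arr .hd3 = σ.arr .hd3 := (hf.arr _ (by decide)).trans (by simp)
    have e4 : τ.reg .o = B + 1 := (hf.reg _ (by decide)).trans (by simp)
    generalize hiτ : τ.reg .i = i at *
    have hsum := hle (i + 1) hi
    rw [Finset.sum_range_succ] at hsum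
    have hfl := length_flatten_map_range bk i
    have hhd : σ.arr .hd3 i ≤ u := by
      by_cases h : σ.arr .hd3 i = 0
      · omega
      · exact (hbk.eq_cons h).1
    simp only [wp_eqs, reduceCtorEq, if_true, if_false, true_and, and_true, hiτ, e3]
    repeat refine ⟨by omega, ?_⟩
    refine wp_loop (fun υ => ∃ l l', l ++ l' = bk i ∧
        Chain (σ.arr .nx3) (σ.arr .vl3) u (υ.reg .h) l' ∧ Seg (υ.arr .out) 0 A ∧
        υ.arr .out B = n ∧
        Seg (υ.arr .out) (B + 1) ((List.range i).map fun j => (bk j).length) ∧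
        Seg (υ.arr .out) (B + 1 + n) (((List.range i).map bk).flatten ++ l) ∧
        υ.reg .w = B + 1 + n + ∑ j ∈ Finset.range i, (bk j).length + l.length ∧
        υ.clk = τ.clk + 1 + l.length) (fun υ => τ.clk + 1 + (bk i).length - υ.clk) ?_ ?_ ?_ ?_
    · exact ⟨[], bk i, rfl, by simpa using hbk i, h1, h2, h3, by simpa using h4, by simpa using h5,
        by simp⟩
    · rintro υ - -
      simp only [Bx.ok, Ex.ok, and_true]
      omega
    · rintro υ ⟨l, l', hl, hch, g1, g2, g3, g4, g5, g6⟩ fr hb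
      have hb : 0 < υ.reg .h := hb
      obtain _ | ⟨x, l'⟩ := l'
      · exact absurd hch hb.ne'
      obtain ⟨-, hhf, hvx, hch⟩ := hch
      have hx := hlt i x (by rw [← hl]; simp)
      have hlen := congrArg List.length hl
      rw [List.length_append, List.length_cons] at hlen
      have hnx : υ.arr .nx3 = σ.arr .nx3 := (fr.arr _ (by decide)).trans (by simpa using e1)
      have hvl : υ.arr .vl3 = σ.arr .vl3 := (fr.arr _ (by decide)).trans (by simpa using e2)
      have hnext : σ.arr .nx3 (υ.reg .h) ≤ u := by
        obtain _ | ⟨y, l'⟩ := l'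
        · exact (le_of_eq hch).trans (Nat.zero_le _)
        · exact hch.2.1
      simp only [wp_eqs, reduceCtorEq, if_true, if_false, true_and, and_true, hnx, hvl, hvx]
      repeat refine ⟨by omega, ?_⟩
      refine ⟨⟨l ++ [x], l', by simpa using hl, by simpa using hch, ?_, ?_, ?_, ?_, ?_, ?_⟩, ?_⟩
      · exact g1.update (Or.inr (by omega))
      · rw [Function.update_of_ne (by omega)]; exact g2
      · exact g3.update (Or.inr (by rw [List.length_map, List.length_range]; omega))
      · rw [← List.append_assoc]
        exact g4.push (by rw [List.length_append]; omega)
      · rw [List.length_append, List.length_singleton]; omega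
      · rw [List.length_append, List.length_singleton]; omega
      · omega
    · rintro υ ⟨l, l', hl, hch, g1, g2, g3, g4, g5, g6⟩ fr hb
      have hb : ¬ 0 < υ.reg .h := hb
      obtain _ | ⟨x, l'⟩ := l'
      swap
      · exact absurd hch.1 hb
      rw [List.append_nil] at hl
      subst hl
      have hi' : υ.reg .i = i := (fr.reg _ (by decide)).trans (by simpa using hiτ)
      have ho' : υ.reg .o = B + 1 := (fr.reg _ (by decide)).trans (by simpa using e4)
      have hs' : υ.reg .s = τ.reg .w := (fr.reg _ (by decide)).trans (by simp)
      simp only [wp_eqs, reduceCtorEq, if_true, if_false, true_and, and_true, hi', ho', hs']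
      repeat refine ⟨by omega, ?_⟩
      refine ⟨g1.update (Or.inr (by omega)), ?_, ?_, ?_, ?_, ?_⟩
      · rw [Function.update_of_ne (by omega)]; exact g2
      · rw [List.range_succ, List.map_append, List.map_singleton,
          show υ.reg .w - τ.reg .w = (bk i).length by omega]
        exact g3.push (by simp)
      · rw [List.range_succ, List.map_append, List.map_singleton, List.flatten_append,
          List.flatten_singleton]
        exact g4.update (Or.inl (by omega))
      · rw [Finset.sum_range_succ]; omega
      · rw [Finset.sum_range_succ]; omega
  · rintro τ - - ⟨-, h1, h2, h3, h4, h5, h6⟩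
    refine ⟨?_, h6⟩
    rw [encodeLists, seg_append, seg_cons, seg_append, List.length_map, List.length_map,
      List.length_range, List.map_map, List.length_map, List.length_range]
    rw [zero_add, ← hB]
    exact ⟨h1, h2, h3, h4⟩

/-- Compute and write the cliques and their dual. -/
def output : Com := bucketLabels ;; emitCliques ;; emitDual

theorem output_spec {n M W k : ℕ} {P : SimpleGraph ℕ} {lam : ℕ → ℕ → ℕ} {σ : HState}
    (hM : 4 * (1 + n + 2 * edgeCount n P) ≤ M) (hW : 8 * M ≤ W)
    (hP : ∀ y z, P.Adj y z → y < n) (hI : CoverInv n M P lam k σ)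
    (hord : ∀ p < n, σ.arr .ord p < n)
    (h0 : ∀ b ∈ [Arr.hd2, .hd3, .last], ∀ x, σ.arr b x = 0) :
    wp M W output (fun τ => ∃ cl dl : ℕ → List ℕ, (∀ c < k, (cl c).Nodup) ∧
      (∀ c < k, ∀ x, x ∈ cl c ↔ ∃ q < n, x = σ.arr .ord q ∧ Inc lam (c + 1) q) ∧
      (∀ x, (dl x).Nodup) ∧ (∀ x c, c ∈ dl x ↔ c < k ∧ x ∈ cl c) ∧
      ∑ c ∈ Finset.range k, (cl c).length ≤ 2 * edgeCount n P ∧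
      Seg (τ.arr .out) 0
        (encodeLists ((List.range k).map cl) ++ encodeLists ((List.range n).map dl)) ∧
      (encodeLists ((List.range k).map cl) ++ encodeLists ((List.range n).map dl)).length ≤ M ∧
      τ.clk ≤ σ.clk + 2 * n + 6 * edgeCount n P) σ := by
  have hk := hI.cover.le_edgeCount hP
  unfold output
  rw [wp_seq]
  refine wp_mono (wp_frame (bucketLabels_spec hM hW hP hI hord (h0 .hd2 (by decide)))) ?_
  rintro τ1 ⟨⟨⟨bk, c1, c2, c3, c4⟩, hclk1⟩, f1⟩
  have hk1 : τ1.reg .k = k := (f1.reg _ (by decide)).trans hI.reg_k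
  have hn1 : τ1.reg .n = n := (f1.reg _ (by decide)).trans hI.layout.reg_n
  have h31 : τ1.arr .hd3 = σ.arr .hd3 := f1.arr _ (by decide)
  have hl1 : τ1.arr .last = σ.arr .last := f1.arr _ (by decide)
  have hT : ∑ b ∈ Finset.range k, (bk (b + 1)).length ≤ 2 * edgeCount n P := by
    rw [← c3, Finset.sum_range_succ']
    omega
  have hbkn : ∀ c, ∀ x ∈ bk c, x < n := by
    intro c x hx
    obtain ⟨y, z, ⟨hy, hz⟩, -, rfl | rfl⟩ := (c4 c x).1 hx
    · exact hord y (by have := (mem_earlier.1 hy).1; omega)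
    · exact hord z hz
  rw [wp_seq]
  refine wp_mono (wp_frame (emitCliques_spec (n := n) (T := 2 * edgeCount n P) (by omega) hW
    (by omega) hk1 c1 hT hbkn fun x => ?_)) ?_
  · rw [h31, hl1]
    exact ⟨h0 .hd3 (by decide) x, h0 .last (by decide) x⟩
  rintro τ2 ⟨⟨hE, hclk2⟩, f2⟩
  have hn2 : τ2.reg .n = n := (f2.reg _ (by decide)).trans hn1
  obtain ⟨e1, e2, e3, e4, e5, e6, e7, -⟩ := hE
  simp only [firsts_nil, List.append_nil, List.not_mem_nil, if_false,
    List.nil_append] at e3 e4 e6 e7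
  have hflat := length_flatten_cliqueLists_le bk k
  have hclen : (cliqueLists bk k).length = k := by simp [cliqueLists]
  have hAlen : (encodeLists (cliqueLists bk k)).length = 1 + k + τ2.reg .u := by
    rw [encodeLists, List.length_cons, List.length_append, List.length_map, e4, hclen]
    ring
  have hdlt : ∀ x, ∀ b ∈ dualList bk k x, b < k := by
    intro x b hb
    simp only [dualList, List.mem_reverse, List.mem_filter, List.mem_range] at hb
    exact hb.1
  refine wp_mono (emitDual_spec (A := encodeLists (cliqueLists bk k)) (bk := dualList bk k)
    (by omega) hW (u := τ2.reg .u) (by omega) hn2 e6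
    (fun x b hb => by have := hdlt x b hb; omega) ?_ (by omega)) ?_
  · rw [encodeLists, seg_cons, seg_append, hclen, List.length_map, hclen]
    exact ⟨e1, by simpa using e2, by simpa [add_comm] using e3⟩
  rintro τ ⟨hseg, hclk⟩
  refine ⟨fun c => firsts (bk (c + 1)), dualList bk k, fun c _ => nodup_firsts _, fun c hc x => ?_,
    fun x => ?_, fun x c => ?_, ?_, hseg, ?_, by omega⟩
  · rw [mem_firsts, c4]
    constructor
    · rintro ⟨y, z, ⟨hy, hz⟩, hyz, rfl | rfl⟩
      · exact ⟨y, by have := (mem_earlier.1 hy).1; omega, rfl, z, Or.inl hyz⟩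
      · exact ⟨z, hz, rfl, y, Or.inr hyz⟩
    · rintro ⟨q, hq, rfl, y, hy | hy⟩
      · have hs := hI.cover.supp (y := q) (z := y) (by omega)
        exact ⟨q, y, ⟨mem_earlier.2 hs, hP y q hs.2.symm⟩, hy, Or.inl rfl⟩
      · have hs := hI.cover.supp (y := y) (z := q) (by omega)
        exact ⟨y, q, ⟨mem_earlier.2 hs, hq⟩, hy, Or.inr rfl⟩
  · exact List.nodup_reverse.2 (List.nodup_range.filter _)
  · simp [dualList, mem_firsts]
  · exact (Finset.sum_le_sum fun c _ => length_firsts_le _).trans hT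
  · rw [List.length_append]
    have : (encodeLists ((List.range k).map fun c => firsts (bk (c + 1)))).length =
        1 + k + τ2.reg .u :=
      hAlen
    rw [this, encodeLists, List.length_cons, List.length_append, List.length_map, List.length_map,
      List.length_range, length_flatten_map_range]
    omega

/-! ### The complete algorithm -/

section Order

variable {n : ℕ} {H : SimpleGraph ℕ} {pos ord : ℕ → ℕ} {N : ℕ → List ℕ}

theorem posGraph_adj {y z : ℕ} :
    (posGraph n H ord).Adj y z ↔ y < n ∧ z < n ∧ H.Adj (ord y) (ord z) :=
  Iff.rfl

/-- The positions up to `p` represent the vertices of `below n pos (p + 1)`. -/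
theorem degIn_below (h : IsOrder n H pos ord 0) {p y : ℕ} (hp : p < n) (hy : y ≤ p) :
    degIn H (below n pos (p + 1)) (ord y) = (earlier (posGraph n H ord) (p + 1) y).length := by
  classical
  rw [← List.toFinset_card_of_nodup (nodup_earlier _ _ _), degIn]
  symm
  refine Finset.card_nbij ord ?_ ?_ ?_
  · intro x hx
    have hx := mem_earlier.1 (List.mem_toFinset.1 hx)
    have hx' := h.pos_ord x (Nat.zero_le _) hx.2.1
    exact Finset.mem_coe.2 (Finset.mem_filter.2 ⟨mem_below.2 ⟨hx'.1, by omega⟩, hx.2.2.2.symm⟩)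
  · intro a ha b hb hab
    have ha := mem_earlier.1 (List.mem_toFinset.1 (Finset.mem_coe.1 ha))
    have hb := mem_earlier.1 (List.mem_toFinset.1 (Finset.mem_coe.1 hb))
    exact h.ord_injOn ha.2.1 hb.2.1 hab
  · intro i hi
    have hi := Finset.mem_filter.1 (Finset.mem_coe.1 hi)
    have hb := mem_below.1 hi.1
    have := h.ord_pos_of_lt hb.1
    refine ⟨pos i - 1, Finset.mem_coe.2 (List.mem_toFinset.2 (mem_earlier.2 ⟨by omega, ?_⟩)),
      this.2.2⟩
    exact ⟨this.2.1, by omega, by rw [this.2.2]; exact hi.2.symm⟩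

theorem IsOrder.smallestLast (h : IsOrder n H pos ord 0) :
    SmallestLast n (posGraph n H ord) := by
  intro p hp y hy
  have hself : earlier (posGraph n H ord) (p + 1) p = earlier (posGraph n H ord) p p := by
    rw [earlier_succ, if_neg (SimpleGraph.irrefl _), List.append_nil]
  have hy' := h.pos_ord y (Nat.zero_le _) (by omega)
  rw [← hself, ← degIn_below h hp le_rfl, ← degIn_below h hp hy]
  exact h.min p (Nat.zero_le _) hp (ord y) (mem_below.2 ⟨hy'.1, by omega⟩)

theorem length_earlier_top (hin : IsInput n H N) (h : IsOrder n H pos ord 0) {z : ℕ} (hz : z < n) :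
    (earlier (posGraph n H ord) n z).length = (N (ord z)).length := by
  classical
  have hn := (h.pos_ord z (Nat.zero_le _) hz).1
  rw [← List.length_map (f := ord), ← List.toFinset_card_of_nodup (hin.nodup _ hn),
    ← List.toFinset_card_of_nodup]
  · congr 1
    ext x
    simp only [List.mem_toFinset, List.mem_map, mem_earlier]
    rw [hin.mem _ hn]
    constructor
    · rintro ⟨y, ⟨-, -, -, hadj⟩, rfl⟩
      exact hadj.symm
    · intro hadj
      have := h.ord_pos_of_lt (hin.lt hadj.symm)
      exact ⟨pos x - 1, ⟨this.2.1, this.2.1, hz, by rw [this.2.2]; exact hadj.symm⟩, this.2.2⟩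
  · refine List.Nodup.map_on (fun a ha b hb hab => ?_) (nodup_earlier _ _ _)
    exact h.ord_injOn (mem_earlier.1 ha).2.1 (mem_earlier.1 hb).2.1 hab

/-- The handshake lemma, for a graph on positions. -/
theorem sum_length_earlier_top (P : SimpleGraph ℕ) (n : ℕ) :
    ∑ z ∈ Finset.range n, (earlier P n z).length = 2 * edgeCount n P := by
  classical
  have hc : ∀ k z, (earlier P k z).length = ∑ y ∈ Finset.range k, if P.Adj y z then 1 else 0 := by
    intro k z
    induction k with
    | zero => simp [earlier]
    | succ k ih =>
      rw [earlier_succ, List.length_append, ih, Finset.sum_range_succ]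
      congr 1
      split_ifs <;> rfl
  induction n with
  | zero => simp [edgeCount]
  | succ n ih =>
    have h1 : edgeCount (n + 1) P = edgeCount n P + (earlier P n n).length :=
      Finset.sum_range_succ _ _
    have h2 : ∀ z, (earlier P (n + 1) z).length =
        (earlier P n z).length + if P.Adj n z then 1 else 0 := fun z => by
      rw [hc, hc, Finset.sum_range_succ]
    have h3 : ∑ z ∈ Finset.range n, (if P.Adj n z then 1 else 0) = (earlier P n n).length := by
      rw [hc]
      simp only [P.adj_comm]
    rw [Finset.sum_range_succ, Finset.sum_congr rfl fun z _ => h2 z, Finset.sum_add_distrib, ih, h1,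
      h2, if_neg (P.irrefl), h3]
    ring

theorem two_mul_edgeCount (hin : IsInput n H N) (h : IsOrder n H pos ord 0) :
    2 * edgeCount n (posGraph n H ord) = ∑ i ∈ Finset.range n, (N i).length := by
  rw [← sum_length_earlier_top, ← h.sum_ord fun i => (N i).length]
  exact Finset.sum_congr rfl fun z hz => length_earlier_top hin h (Finset.mem_range.1 hz)

end Order

/-- The algorithm: it reads the adjacency lists from `inp`, and writes the encoded lists of the
cliques and of their dual to `out`. -/
def algorithm : Com := setup ;; order ;; nbrLists ;; cover ;; output

theorem algorithm_spec {n M W D : ℕ} {H : SimpleGraph ℕ} {N : ℕ → List ℕ} (hin : IsInput n H N)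
    (hM : 4 * start n N n ≤ M) (hW : 8 * M ≤ W) (hn : 2 ≤ n) (he : ∃ i < n, (N i).length ≠ 0)
    (hD : ∀ pos ord, IsOrder n H pos ord 0 →
      ∀ z < n, (earlier (posGraph n H ord) z z).length ≤ D)
    {σ : HState} (h0 : ∀ a, a ≠ .inp → σ.arr a = fun _ => 0) (hc : σ.clk = 0)
    (hinp : Seg (σ.arr .inp) 0 (encodeLists ((List.range n).map N))) :
    wp M W algorithm (fun τ => ∃ (pos ord : ℕ → ℕ) (lam : ℕ → ℕ → ℕ) (k : ℕ) (cl dl : ℕ → List ℕ),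
      IsOrder n H pos ord 0 ∧ IsCover (posGraph n H ord) lam k ∧
      (∀ y z, y < z → (posGraph n H ord).Adj y z → lam y z ≠ 0) ∧
      k ≤ 1 + 2 * ∑ z ∈ Finset.range n, gap (posGraph n H ord) z ∧
      (∀ c < k, (cl c).Nodup) ∧
      (∀ c < k, ∀ x, x ∈ cl c ↔ ∃ q < n, x = ord q ∧ Inc lam (c + 1) q) ∧
      (∀ x, (dl x).Nodup) ∧ (∀ x c, c ∈ dl x ↔ c < k ∧ x ∈ cl c) ∧
      ∑ c ∈ Finset.range k, (cl c).length ≤ 2 * edgeCount n (posGraph n H ord) ∧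
      Seg (τ.arr .out) 0
        (encodeLists ((List.range k).map cl) ++ encodeLists ((List.range n).map dl)) ∧
      (encodeLists ((List.range k).map cl) ++ encodeLists ((List.range n).map dl)).length ≤ M ∧
      τ.clk ≤ 8 * n + 12 * edgeCount n (posGraph n H ord) +
        ∑ z ∈ Finset.range n, stepCost (posGraph n H ord) D z) σ := by
  unfold algorithm
  rw [wp_seq]
  refine wp_mono (wp_frame (setup_spec hin hM hW h0 hc hinp)) ?_
  rintro τ1 ⟨⟨b1, hclk1, hdeg, hf, bk, k1, k2, k3, k4⟩, f1⟩
  have z1 : ∀ b ∈ [Arr.pos, .ord, .eo, .el, .nb, .lab, .tot, .mk, .inX, .g, .cnt, .hd2, .hd3,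
    .last],
      τ1.arr b = fun _ => 0 := by
    intro b hb
    rw [f1.arr b, h0 b]
    · rintro rfl; exact absurd hb (by decide)
    · revert b; decide
  rw [wp_seq]
  refine wp_mono (wp_frame (order_spec hin hM hW b1 hclk1 hdeg hf k1 k2 k3 k4 fun i => by
    rw [z1 .pos (by decide)])) ?_
  rintro τ2 ⟨⟨ho, hclk2⟩, f2⟩
  have z2 : ∀ b ∈ [Arr.eo, .el, .nb, .lab, .tot, .mk, .inX, .g, .cnt, .hd2, .hd3, .last],
      τ2.arr b = fun _ => 0 := by
    intro b hb
    rw [f2.arr b, z1 b (List.mem_cons_of_mem _ (List.mem_cons_of_mem _ hb))]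
    revert b; decide
  have b2 := b1.frame f2 (by decide) (by decide) (by decide)
  have hvol := two_mul_edgeCount hin ho
  have hstn : start n N n = 1 + n + ∑ i ∈ Finset.range n, (N i).length := rfl
  generalize hpos : τ2.arr .pos = pos at ho
  generalize hord : τ2.arr .ord = ord at ho hvol
  have hP : ∀ y z, (posGraph n H ord).Adj y z → y < n := fun y z h => h.1
  have he' : ∃ z < n, (earlier (posGraph n H ord) z z).length ≠ 0 := by
    by_contra! hall
    have h0 : edgeCount n (posGraph n H ord) = 0 :=
      Finset.sum_eq_zero fun z hz => hall z (Finset.mem_range.1 hz)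
    obtain ⟨i, hi, hne⟩ := he
    have := Finset.single_le_sum (f := fun i => (N i).length) (fun _ _ => Nat.zero_le _)
      (Finset.mem_range.2 hi)
    rw [← hvol, h0] at this
    omega
  rw [wp_seq]
  refine wp_mono (wp_frame (nbrLists_spec hin hM hW b2 hpos hord ho fun z => by
    rw [z2 .el (by decide)])) ?_
  rintro τ3 ⟨⟨hL, hclk3⟩, f3⟩
  have z3 : ∀ b ∈ [Arr.lab, .tot, .mk, .inX, .g, .cnt, .hd2, .hd3, .last],
      τ3.arr b = fun _ => 0 := by
    intro b hb
    have hb' := List.mem_cons_of_mem .eo (List.mem_cons_of_mem .el (List.mem_cons_of_mem .nb hb))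
    rw [f3.arr b, z2 b hb']
    revert b; decide
  have hord3 : τ3.arr .ord = ord := (f3.arr _ (by decide)).trans hord
  rw [wp_seq]
  refine wp_mono (wp_frame (cover_spec (by omega) hW hL hn hP ho.smallestLast he' (hD pos ord ho)
    fun b hb x => by rw [z3 b (by revert b; decide)])) ?_
  rintro τ4 ⟨⟨lam, k, hI, hdone, hk, hclk4⟩, f4⟩
  have hord4 : τ4.arr .ord = ord := (f4.arr _ (by decide)).trans hord3
  refine wp_mono (output_spec (by omega) hW hP hI (fun p hp => ?_) fun b hb x => ?_) ?_
  · rw [hord4]; exact (ho.pos_ord p (Nat.zero_le _) hp).1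
  · rw [f4.arr b (by revert b; decide), z3 b (by revert b; decide)]
  rintro τ ⟨cl, dl, d1, d2, d3, d4, d5, d6, d7, d8⟩
  rw [hord4] at d2
  exact ⟨pos, ord, lam, k, cl, dl, ho, hI.cover, hdone, hk, d1, d2, d3, d4, d5, d6, d7, by omega⟩

/-! ### Allocation of the memory -/

/-- More memory does no harm. -/
theorem Exec.mono {S S' W t : ℕ} {P : Prog} {σ τ : State} (hS : S ≤ S') (h : Exec S W P σ t τ) :
    Exec S' W P σ t τ := by
  induction h with
  | skip σ => exact .skip σ
  | const σ r c hW => exact .const σ r c hW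
  | copy σ r s hW => exact .copy σ r s hW
  | add σ r s t hW => exact .add σ r s t hW
  | sub σ r s t hW => exact .sub σ r s t hW
  | load σ r s h hW => exact .load σ r s (h.trans_le hS) hW
  | store σ r s h hW => exact .store σ r s (h.trans_le hS) hW
  | seq p q σ τ υ t u _ _ ihp ihq => exact .seq _ _ _ _ _ _ _ ihp ihq
  | ite_true b p q σ τ t hb _ ih => exact .ite_true _ _ _ _ _ _ hb ih
  | ite_false b p q σ τ t hb _ ih => exact .ite_false _ _ _ _ _ _ hb ih
  | while_false b p σ hb => exact .while_false _ _ _ hb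
  | while_true b p σ τ υ t u hb _ _ ihp ihw => exact .while_true _ _ _ _ _ _ _ hb ihp ihw

/-- Add the contents of the memory cells `1, …, n` to register `8`, where `n` is in register `2`. -/
def sumLengths : Prog :=
  .while (.lt 5 2) (.seq (.add 5 5 11) (.seq (.load 14 5) (.add 8 8 14)))

theorem sumLengths_spec {S W n : ℕ} (hn : n < S) (k i : ℕ) (hi : i + k = n) (l : State)
    (h2 : l.reg 2 = n) (h5 : l.reg 5 = i) (h11 : l.reg 11 = 1) (hnW : n < W)
    (hW : l.reg 8 + ∑ j ∈ Finset.range k, l.mem (i + j + 1) < W) :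
    ∃ l', Exec S W sumLengths l (4 * k + 1) l' ∧ l'.mem = l.mem ∧
      l'.reg 8 = l.reg 8 + ∑ j ∈ Finset.range k, l.mem (i + j + 1) ∧ l'.reg 2 = n ∧ l'.reg 11 = 1 ∧
      ∀ r, r % 3 ≠ 2 → l'.reg r = l.reg r := by
  induction k generalizing i l with
  | zero =>
    refine ⟨l, .while_false _ _ _ ?_, rfl, by simp, h2, h11, fun _ _ => rfl⟩
    simp only [Test.holds, h2, h5]
    omega
  | succ k ih =>
    rw [Finset.sum_range_succ'] at hW
    simp only [add_zero] at hW
    have e1 := Exec.add (S := S) (W := W) l 5 5 11 (by rw [h5, h11]; omega)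
    rw [h5, h11] at e1
    set l1 := l.setReg 5 (i + 1) with hl1
    have m1 : l1.mem = l.mem := rfl
    have r5 : l1.reg 5 = i + 1 := by simp [hl1, State.setReg]
    have e2 := Exec.load (S := S) (W := W) l1 14 5 (by rw [r5]; omega) (by rw [r5, m1]; omega)
    rw [r5, m1] at e2
    set l2 := l1.setReg 14 (l.mem (i + 1)) with hl2
    have r8 : l2.reg 8 = l.reg 8 := by simp [hl2, hl1, State.setReg]
    have r14 : l2.reg 14 = l.mem (i + 1) := by simp [hl2, State.setReg]
    have e3 := Exec.add (S := S) (W := W) l2 8 8 14 (by rw [r8, r14]; omega)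
    rw [r8, r14] at e3
    set l3 := l2.setReg 8 (l.reg 8 + l.mem (i + 1)) with hl3
    have m3 : l3.mem = l.mem := rfl
    have s8 : l3.reg 8 = l.reg 8 + l.mem (i + 1) := by simp [hl3, State.setReg]
    have hsum : ∀ j, l.mem (i + 1 + j + 1) = l.mem (i + (j + 1) + 1) := fun j => by
      rw [show i + 1 + j + 1 = i + (j + 1) + 1 by ring]
    obtain ⟨l', x1, x2, x3, x4, x5, x6⟩ := ih (i + 1) (by omega) l3
      (by simpa [hl3, hl2, hl1, State.setReg] using h2)
      (by simp [hl3, hl2, hl1, State.setReg])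
      (by simpa [hl3, hl2, hl1, State.setReg] using h11)
      (by rw [s8, m3]; simp only [hsum]; omega)
    refine ⟨l', ?_, x2.trans m3, ?_, x4, x5, fun r hr => (x6 r hr).trans ?_⟩
    · have hw := Exec.while_true (.lt 5 2) (.seq (.add 5 5 11) (.seq (.load 14 5) (.add 8 8 14)))
        l l3 l' _ _ (by simp only [Test.holds, h2, h5]; omega)
        (.seq _ _ _ _ _ _ _ e1 (.seq _ _ _ _ _ _ _ e2 e3)) x1
      rw [show 4 * (k + 1) + 1 = 1 + (1 + 1) + (4 * k + 1) + 1 by ring]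
      exact hw
    · rw [x3, s8, m3, Finset.sum_range_succ']
      simp only [hsum, add_zero]
      ring
    · simp only [hl3, hl2, hl1, State.setReg, Function.update_apply]
      rw [if_neg (by omega), if_neg (by omega), if_neg (by omega)]

/-- Compute the addresses of the arrays up to the one with index `a`, where the capacity of the
arrays is in register `8`. -/
def baseRegs : ℕ → Prog
  | 0 => .skip
  | a + 1 => .seq (baseRegs a) (.add (3 * (a + 1) + 1) (3 * a + 1) 8)

theorem baseRegs_spec {S W M : ℕ} (a : ℕ) (l : State) (hW : a * M < W) (h1 : l.reg 1 = 0)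
    (h8 : l.reg 8 = M) :
    ∃ l', Exec S W (baseRegs a) l (a + 1) l' ∧ l'.mem = l.mem ∧
      (∀ b ≤ a, l'.reg (3 * b + 1) = b * M) ∧ ∀ r, r % 3 ≠ 1 → l'.reg r = l.reg r := by
  induction a with
  | zero =>
    refine ⟨l, .skip l, rfl, fun b hb => ?_, fun _ _ => rfl⟩
    obtain rfl : b = 0 := by omega
    simpa using h1
  | succ a ih =>
    have hmul : (a + 1) * M = a * M + M := by ring
    obtain ⟨l1, x1, x2, x3, x4⟩ := ih (by omega)
    have r8 := (x4 8 (by decide)).trans h8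
    have ra := x3 a le_rfl
    have e := Exec.add (S := S) (W := W) l1 (3 * (a + 1) + 1) (3 * a + 1) 8 (by omega)
    rw [ra, r8] at e
    refine ⟨_, .seq _ _ _ _ _ _ _ x1 e, x2, fun b hb => ?_, fun r hr => ?_⟩
    · simp only [State.setReg, Function.update_apply]
      split_ifs with h
      · obtain rfl : b = a + 1 := by omega
        exact hmul.symm
      · exact x3 b (by omega)
    · rw [← x4 r hr]
      exact Function.update_of_ne (by omega) _ _

/-- Compute the capacity of the arrays, which is four times the length of the input, and their
addresses. Registers `2`, `5`, `8`, … are temporaries. The input is at address `0`, so it becomes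
the array `inp` without being moved. -/
def prologue : Prog :=
  .seq (.load 2 2) (.seq (.const 11 1) (.seq sumLengths (.seq (.add 8 8 2) (.seq (.add 8 8 11)
    (.seq (.add 8 8 8) (.seq (.add 8 8 8) (baseRegs 24)))))))

theorem prologue_spec {W n s M : ℕ} (l : State) (hreg : ∀ r, l.reg r = 0) (hn : l.mem 0 = n)
    (hs : s = 1 + n + ∑ j ∈ Finset.range n, l.mem (j + 1)) (hM : M = 4 * s)
    (hW : numArr * M ≤ W) :
    ∃ l', Exec (numArr * M) W prologue l (4 * n + 32) l' ∧ l'.mem = l.mem ∧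
      (∀ a : Arr, l'.reg (3 * a.ctorIdx + 1) = a.ctorIdx * M) ∧
      ∀ r, r % 3 = 0 → l'.reg r = 0 := by
  have hnum : numArr = 25 := rfl
  rw [hnum] at hW ⊢
  have e1 := Exec.load (S := 25 * M) (W := W) l 2 2 (by rw [hreg]; omega) (by rw [hreg]; omega)
  rw [hreg, hn] at e1
  set l1 := l.setReg 2 n with hl1
  have e2 := Exec.const (S := 25 * M) (W := W) l1 11 1 (by omega)
  set l2 := l1.setReg 11 1 with hl2
  have m2 : l2.mem = l.mem := rfl
  have r8 : l2.reg 8 = 0 := by simp [hl2, hl1, State.setReg, hreg]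
  obtain ⟨l3, x1, x2, x3, x4, x5, x6⟩ := sumLengths_spec (S := 25 * M) (W := W) (n := n) (by omega)
    n 0 (by omega) l2 (by simp [hl2, hl1, State.setReg]) (by simp [hl2, hl1, State.setReg, hreg])
    (by simp [hl2, State.setReg]) (by omega) (by rw [r8, m2]; simp only [zero_add]; omega)
  simp only [r8, m2, zero_add] at x3
  have e4 := Exec.add (S := 25 * M) (W := W) l3 8 8 2 (by omega)
  set l4 := l3.setReg 8 (l3.reg 8 + l3.reg 2) with hl4
  have s8 : l4.reg 8 = l3.reg 8 + n := by simp [hl4, State.setReg, x4]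
  have s11 : l4.reg 11 = 1 := by simpa [hl4, State.setReg] using x5
  have e5 := Exec.add (S := 25 * M) (W := W) l4 8 8 11 (by omega)
  set l5 := l4.setReg 8 (l4.reg 8 + l4.reg 11) with hl5
  have t8 : l5.reg 8 = s := by simp [hl5, State.setReg, s8, s11]; omega
  have e6 := Exec.add (S := 25 * M) (W := W) l5 8 8 8 (by omega)
  set l6 := l5.setReg 8 (l5.reg 8 + l5.reg 8) with hl6
  have u8 : l6.reg 8 = 2 * s := by simp [hl6, State.setReg, t8]; omega
  have e7 := Exec.add (S := 25 * M) (W := W) l6 8 8 8 (by omega)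
  set l7 := l6.setReg 8 (l6.reg 8 + l6.reg 8) with hl7
  have v8 : l7.reg 8 = M := by simp [hl7, State.setReg, u8]; omega
  have hrest : ∀ r, r % 3 ≠ 2 → l7.reg r = 0 := fun r hr => by
    rw [← hreg r]
    simp only [hl7, hl6, hl5, hl4, State.setReg, Function.update_apply]
    rw [if_neg (by omega), if_neg (by omega), if_neg (by omega), if_neg (by omega), x6 r hr]
    simp only [hl2, hl1, State.setReg, Function.update_apply]
    rw [if_neg (by omega), if_neg (by omega)]
  obtain ⟨l8, y1, y2, y3, y4⟩ := baseRegs_spec (S := 25 * M) (W := W) (M := M) 24 l7 (by omega)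
    (hrest 1 (by decide)) v8
  refine ⟨l8, ?_, ?_, fun a => y3 _ (Nat.le_of_lt_succ a.ctorIdx_lt), fun r hr => ?_⟩
  · have := Exec.seq _ _ _ _ _ _ _ e1 (.seq _ _ _ _ _ _ _ e2 (.seq _ _ _ _ _ _ _ x1
      (.seq _ _ _ _ _ _ _ e4 (.seq _ _ _ _ _ _ _ e5 (.seq _ _ _ _ _ _ _ e6
      (.seq _ _ _ _ _ _ _ e7 y1))))))
    rw [show 4 * n + 32 = 1 + (1 + (4 * n + 1 + (1 + (1 + (1 + (1 + (24 + 1))))))) by ring]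
    exact this
  · rw [y2]; exact x2.trans m2
  · rw [y4 r (by omega), hrest r (by omega)]

/-- The machine program for a command: allocate the arrays, run the command, and return the address
of the array `out`. -/
def program (p : Com) : Prog :=
  .seq prologue (.seq p.compile (.copy 0 (3 * Arr.out.ctorIdx + 1)))

/-- The state in which the array `inp` holds the input and everything else is `0`. -/
def initial (input : ℕ → ℕ) : HState where
  reg _ := 0
  arr a := if a = .inp then input else fun _ => 0
  clk := 0

/-- A guarantee for `p` carries over to the machine: the other arrays lie beyond the input, so they
are `0` initially, and the memory in use has `numArr * M` words. -/
theorem program_spec {W n s M : ℕ} (p : Com) {Q : HState → Prop} (l : State)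
    (hreg : ∀ r, l.reg r = 0) (hn : l.mem 0 = n)
    (hs : s = 1 + n + ∑ j ∈ Finset.range n, l.mem (j + 1)) (hM : M = 4 * s)
    (hW : numArr * M ≤ W) (hmem : ∀ i, s ≤ i → l.mem i = 0) (hlt : ∀ i, l.mem i < W)
    (h : wp M W p Q (initial l.mem)) :
    ∃ t l' τ, Exec (numArr * M) W (program p) l t l' ∧ Q τ ∧
      l'.reg 0 + M ≤ numArr * M ∧ (∀ i < M, l'.mem (l'.reg 0 + i) = τ.arr .out i) ∧
      t ≤ p.size * (τ.clk + 1) + 4 * n + 33 := by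
  have hW' : 25 * M ≤ W := hW
  have hnum : numArr * M = 25 * M := rfl
  obtain ⟨l1, x1, x2, x3, x4⟩ := prologue_spec l hreg hn hs hM hW
  have hrel : Rel M W l1 (initial l.mem) := by
    refine ⟨fun x => x4 _ (by omega), x3, fun a i hi => ?_, fun x => ?_, fun a i hi => ?_⟩
    · rw [x2]
      by_cases ha : a = .inp
      · subst ha
        simp [initial, show Arr.inp.ctorIdx = 0 from rfl]
      · have hpos : 0 < a.ctorIdx := by
          rw [Nat.pos_iff_ne_zero]
          exact fun h => ha (Arr.ctorIdx_injective h)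
        have : M ≤ a.ctorIdx * M := Nat.le_mul_of_pos_left _ hpos
        rw [hmem (a.ctorIdx * M + i) (by omega)]
        simp [initial, ha]
    · exact (Nat.zero_le _).trans_lt (hlt 0)
    · simp only [initial]
      split_ifs
      · exact hlt i
      · exact (Nat.zero_le _).trans_lt (hlt 0)
  obtain ⟨t, l2, τ, y1, y2, y3, -, y4⟩ := p.compile_spec hW Q l1 _ hrel h
  have hbase := y2.base .out
  have hidx : Arr.out.ctorIdx = 24 := rfl
  have e := Exec.copy (S := numArr * M) (W := W) l2 0 (3 * Arr.out.ctorIdx + 1)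
    (by rw [hbase, hidx]; have := hlt 0; omega)
  refine ⟨_, _, τ, .seq _ _ _ _ _ _ _ x1 (.seq _ _ _ _ _ _ _ y1 e), y3, ?_, fun i hi => ?_, ?_⟩
  · simp only [State.setReg, Function.update_self]
    rw [hbase, hidx]
    omega
  · simp only [State.setReg, Function.update_self]
    rw [hbase]
    exact y2.mem .out i hi
  · simp only [initial, Nat.mul_zero, Nat.add_zero] at y4
    omega

/-! ### Bounds in terms of the graph parameters -/

section Bounds

variable {n D : ℕ} {P : SimpleGraph ℕ}

/-- Every pair of positions below `n` is an edge or is counted by a gap. -/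
theorem edgeCount_add_sum_gap (n : ℕ) (P : SimpleGraph ℕ) :
    edgeCount n P + ∑ z ∈ Finset.range n, gap P z = n.choose 2 := by
  rw [edgeCount, ← Finset.sum_add_distrib, Nat.choose_two_right, ← Finset.sum_range_id]
  refine Finset.sum_congr rfl fun z _ => ?_
  have := length_earlier_le_self P z z
  unfold gap
  omega

/-- The number of edges is at most `d ^ 2 * σ`: the positions without gap form an initial segment,
which is a clique with at most `d + 1` vertices, and each other position has at most `d` earlier
neighbours and at least one gap. -/
theorem SmallestLast.edgeCount_le (h : SmallestLast n P)
    (hD : ∀ z < n, (earlier P z z).length ≤ D) :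
    edgeCount n P ≤ D ^ 2 * (1 + ∑ z ∈ Finset.range n, gap P z) := by
  have key : ∀ k ≤ n, edgeCount k P ≤ D ^ 2 * (1 + ∑ z ∈ Finset.range k, gap P z) := by
    intro k
    induction k with
    | zero => intro _; simp [edgeCount]
    | succ k ih =>
      intro hk
      have hDk := hD k hk
      rcases Nat.eq_zero_or_pos (gap P k) with hg | hg
      · have hL : ∀ j ≤ k, (earlier P j j).length = j := fun j hj => by
          by_contra hne
          exact (h.gap_pos hne hj hk).ne' hg
        have hkD : k ≤ D := by rw [← hL k le_rfl]; exact hDk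
        have h1 : edgeCount (k + 1) P = ∑ z ∈ Finset.range (k + 1), z :=
          Finset.sum_congr rfl fun z hz => hL z (Nat.lt_succ_iff.1 (Finset.mem_range.1 hz))
        have h2 : ∑ z ∈ Finset.range (k + 1), z ≤ k ^ 2 := by
          rw [Finset.sum_range_id, Nat.add_sub_cancel]
          refine Nat.div_le_of_le_mul ?_
          rcases Nat.eq_zero_or_pos k with rfl | hk0
          · simp
          · nlinarith
        calc edgeCount (k + 1) P ≤ k ^ 2 := h1.trans_le h2
          _ ≤ D ^ 2 := Nat.pow_le_pow_left hkD 2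
          _ ≤ _ := Nat.le_mul_of_pos_right _ (by omega)
      · have h1 : edgeCount (k + 1) P = edgeCount k P + (earlier P k k).length :=
          Finset.sum_range_succ _ _
        rw [h1, Finset.sum_range_succ, ← add_assoc, mul_add]
        refine Nat.add_le_add (ih (by omega)) ?_
        calc (earlier P k k).length ≤ D := hDk
          _ ≤ D ^ 2 := Nat.le_self_pow (by decide) D
          _ ≤ D ^ 2 * gap P k := Nat.le_mul_of_pos_right _ hg
  exact key n le_rfl

/-- The positions without earlier neighbours take no round; for the others `d ≥ 1`. -/
theorem sum_stepCost_le (hD : ∀ z < n, (earlier P z z).length ≤ D) :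
    ∑ z ∈ Finset.range n, stepCost P D z ≤ 2 * edgeCount n P + 3 * n +
      74 * (D ^ 2 * min (edgeCount n P) (∑ z ∈ Finset.range n, gap P z)) := by
  set B := ∑ z ∈ Finset.range n, min (earlier P z z).length (2 * gap P z) with hB
  have hstep : ∀ z ∈ Finset.range n, stepCost P D z ≤
      2 * (earlier P z z).length + 3 + 37 * D ^ 2 * min (earlier P z z).length (2 * gap P z) := by
    intro z hz
    have hL := hD z (Finset.mem_range.1 hz)
    unfold stepCost
    set L := (earlier P z z).length
    rcases Nat.eq_zero_or_pos L with h0 | h0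
    · rw [h0]
      simp
    · have h1 : (L + 1) * (D + 2) ≤ (2 * D) * (3 * D) := Nat.mul_le_mul (by omega) (by omega)
      have h2 : 1 ≤ D ^ 2 := Nat.one_le_pow _ _ (by omega)
      -- `37 = 6 * 2 * 3 + 1`
      have h3 : 6 * ((L + 1) * (D + 2)) + 1 ≤ 37 * D ^ 2 := by nlinarith
      have h4 := Nat.mul_le_mul_left (min L (2 * gap P z)) h3
      rw [mul_comm (37 * D ^ 2)]
      omega
  have hB1 : B ≤ edgeCount n P := Finset.sum_le_sum fun z _ => min_le_left _ _
  have hB2 : B ≤ 2 * ∑ z ∈ Finset.range n, gap P z := by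
    rw [Finset.mul_sum]
    exact Finset.sum_le_sum fun z _ => min_le_right _ _
  have hB3 : B ≤ 2 * min (edgeCount n P) (∑ z ∈ Finset.range n, gap P z) := by omega
  have h5 := Finset.sum_le_sum hstep
  rw [Finset.sum_add_distrib, Finset.sum_add_distrib, ← Finset.mul_sum, ← Finset.mul_sum,
    Finset.sum_const, Finset.card_range, ← hB, smul_eq_mul] at h5
  have h6 := Nat.mul_le_mul_left (37 * D ^ 2) hB3
  have h7 : 2 * ∑ z ∈ Finset.range n, (earlier P z z).length = 2 * edgeCount n P := rfl
  nlinarith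

end Bounds

/-! ### Lists and their encoding -/

theorem exists_map_eq {α β : Type*} (g : α → β) (l : List β) (h : ∀ x ∈ l, ∃ a, g a = x) :
    ∃ l' : List α, l'.map g = l := by
  choose f hf using fun x : {x // x ∈ l} => h x.1 x.2
  exact ⟨l.attach.map f, by simp [hf]⟩

theorem map_finRange_eq {α : Type*} (n : ℕ) (f : ℕ → α) :
    (List.finRange n).map (fun i : Fin n => f i.val) = (List.range n).map f := by
  rw [← List.map_coe_finRange_eq_range, List.map_map]
  rfl

theorem seg_getD (l : List ℕ) : Seg (fun a => l.getD a 0) 0 l := fun j hj => by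
  simp [List.getD, hj]

theorem length_encodeLists (n : ℕ) (f : ℕ → List ℕ) :
    (encodeLists ((List.range n).map f)).length = start n f n := by
  simp only [encodeLists, start, List.length_cons, List.length_append, List.length_map,
    List.length_range, List.length_flatten, List.map_map]
  rw [add_comm, ← add_assoc]
  rfl

/-! ### The graph on the numbers of the vertices -/

section Numbering

variable {V : Type*} [Fintype V] {G : SimpleGraph V} (e : V ≃ Fin (Fintype.card V))
  {N : V → List V}

/-- The numbering of the vertices, as an embedding into the natural numbers. -/
def number : V ↪ ℕ := e.toEmbedding.trans Fin.valEmbedding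

/-- The adjacency list of the vertex with number `i`. -/
def numberLists (N : V → List V) (i : ℕ) : List ℕ :=
  if h : i < Fintype.card V then (N (e.symm ⟨i, h⟩)).map (number e) else []

theorem number_lt (v : V) : number e v < Fintype.card V := (e v).2

theorem exists_number {i : ℕ} (hi : i < Fintype.card V) : ∃ v, number e v = i :=
  ⟨e.symm ⟨i, hi⟩, by simp [number]⟩

theorem numberLists_number (v : V) : numberLists e N (number e v) = (N v).map (number e) := by
  simp [numberLists, number]

theorem inOrder_eq {f : ℕ → List ℕ} (A : V → List ℕ) (h : ∀ v, f (number e v) = A v) :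
    inOrder e A = (List.range (Fintype.card V)).map f := by
  rw [inOrder, ← map_finRange_eq]
  refine List.map_congr_left fun i _ => ?_
  rw [← h]
  simp [number]

theorem isInput_number (hN : ∀ v, Enumerates (N v) (G.neighborSet v)) :
    IsInput (Fintype.card V) (G.map (number e)) (numberLists e N) := by
  refine ⟨fun {i j} h => ?_, fun i hi => ?_, fun i hi j => ?_⟩
  · obtain ⟨-, u, v, -, rfl, -⟩ := h
    exact number_lt e u
  · obtain ⟨v, rfl⟩ := exists_number e hi
    rw [numberLists_number]
    exact (hN v).1.map (number e).injective
  · obtain ⟨v, rfl⟩ := exists_number e hi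
    rw [numberLists_number, List.mem_map, SimpleGraph.map_adj]
    constructor
    · rintro ⟨w, hw, rfl⟩
      exact ⟨v, w, ((hN v).2 w).1 hw, rfl, rfl⟩
    · rintro ⟨u, w, huw, hu, rfl⟩
      rw [(number e).injective hu] at huw
      exact ⟨w, ((hN v).2 w).2 huw, rfl⟩

theorem sum_length_numberLists (hN : ∀ v, Enumerates (N v) (G.neighborSet v)) :
    ∑ i ∈ Finset.range (Fintype.card V), (numberLists e N i).length = 2 * numEdges G := by
  classical
  rw [numEdges, ← SimpleGraph.coe_edgeFinset, Set.ncard_coe_finset,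
    ← SimpleGraph.sum_degrees_eq_twice_card_edges, ← Fin.sum_univ_eq_sum_range, ← e.sum_comp]
  refine Finset.sum_congr rfl fun v _ => ?_
  have h1 : (numberLists e N (e v)).length = (N v).length := by
    rw [← List.length_map (f := number e) (as := N v), ← numberLists_number]
    rfl
  rw [h1, ← List.toFinset_card_of_nodup (hN v).1, ← SimpleGraph.card_neighborFinset_eq_degree]
  congr 1
  ext w
  rw [List.mem_toFinset, (hN v).2, SimpleGraph.mem_neighborFinset, SimpleGraph.mem_neighborSet]

/-- In a smallest-last order, each vertex has at most as many earlier neighbours as the degeneracy: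
it has minimum degree in the subgraph induced by itself and the earlier vertices. -/
theorem length_earlier_le_degeneracy {pos ord : ℕ → ℕ}
    (h : IsOrder (Fintype.card V) (G.map (number e)) pos ord 0) {z : ℕ}
    (hz : z < Fintype.card V) :
    (earlier (posGraph (Fintype.card V) (G.map (number e)) ord) z z).length ≤ degeneracy G := by
  classical
  have hself : earlier (posGraph (Fintype.card V) (G.map (number e)) ord) (z + 1) z =
      earlier (posGraph (Fintype.card V) (G.map (number e)) ord) z z := by
    rw [earlier_succ, if_neg (SimpleGraph.irrefl _), List.append_nil]
  rw [← hself, ← degIn_below h hz le_rfl]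
  refine le_csSup ⟨Fintype.card V, ?_⟩
    ⟨(⊤ : G.Subgraph).induce {v | pos (number e v) ≤ z + 1}, ?_, ?_⟩
  · rintro k ⟨H, ⟨v, hv⟩, hk⟩
    refine (hk v hv).trans ?_
    rw [← Nat.card_eq_fintype_card, ← Set.ncard_univ]
    exact Set.ncard_le_ncard (Set.subset_univ _)
  · have hp := h.pos_ord z (Nat.zero_le _) hz
    obtain ⟨v, hv⟩ := exists_number e hp.1
    exact ⟨v, by
      simp only [SimpleGraph.Subgraph.induce_verts, Set.mem_ofPred_eq]
      rw [hv, hp.2]⟩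
  · intro v hv
    simp only [SimpleGraph.Subgraph.induce_verts, Set.mem_ofPred_eq] at hv
    refine (h.min z (Nat.zero_le _) hz _ (mem_below.2 ⟨number_lt e v, hv⟩)).trans ?_
    rw [degIn, ← Set.ncard_coe_finset, ← Set.ncard_image_of_injective _ (number e).injective]
    refine Set.ncard_le_ncard (fun j hj => ?_) (Set.toFinite _)
    simp only [Finset.coe_filter, Set.mem_ofPred_eq] at hj
    have hjb := mem_below.1 hj.1
    obtain ⟨w, rfl⟩ := exists_number e hjb.1
    exact ⟨w, by simpa using ⟨hv, hjb.2, SimpleGraph.map_adj_apply.1 hj.2⟩, rfl⟩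

end Numbering

/-! ### The representation given by a labelling -/

section Representation

/-- Both sizes count the incidences between vertices and cliques. -/
theorem DCC.sizeL_eq {V : Type*} [Fintype V] {G : SimpleGraph V} (D : DCC G) :
    D.sizeL = D.sizeC := by
  classical
  have hL : ∀ v, (D.L v).card = ∑ i, if v ∈ D.C i then 1 else 0 := fun v => by
    rw [← Finset.card_filter]
    congr 1
    ext i
    simp [D.mem_L]
  have hC : ∀ i, (D.C i).card = ∑ v, if v ∈ D.C i then 1 else 0 := fun i => by
    rw [← Finset.card_filter]
    congr 1
    ext v
    simp
  simp only [DCC.sizeL, DCC.sizeC, hL, hC]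
  exact Finset.sum_comm

variable {V : Type*} [Fintype V] {G : SimpleGraph V} {e : V ≃ Fin (Fintype.card V)}
  {pos ord : ℕ → ℕ} {lam : ℕ → ℕ → ℕ} {k : ℕ} {cl : ℕ → List ℕ}

theorem near_ord_iff (ho : IsOrder (Fintype.card V) (G.map (number e)) pos ord 0) {p q : ℕ}
    (hp : p < Fintype.card V) (hq : q < Fintype.card V) {u v : V} (hu : number e u = ord p)
    (hv : number e v = ord q) :
    Near (posGraph (Fintype.card V) (G.map (number e)) ord) p q ↔ u = v ∨ G.Adj u v := by
  rw [Near, posGraph_adj, ← hu, ← hv, SimpleGraph.map_adj_apply]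
  have : p = q ↔ u = v := by
    rw [← (number e).injective.eq_iff, hu, hv]
    exact ⟨fun h => by rw [h], ho.ord_injOn hp hq⟩
  rw [this]
  tauto

/-- The dual clique cover representation given by the cliques `cl 0, …, cl (k - 1)`, where `cl c`
consists of the numbers of the endpoints of the edges with label `c + 1`. -/
noncomputable def labelDCC (ho : IsOrder (Fintype.card V) (G.map (number e)) pos ord 0)
    (hcov : IsCover (posGraph (Fintype.card V) (G.map (number e)) ord) lam k)
    (hall : ∀ y z, y < z → (posGraph (Fintype.card V) (G.map (number e)) ord).Adj y z →
      lam y z ≠ 0)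
    (hcl : ∀ c < k, ∀ x, x ∈ cl c ↔ ∃ q < Fintype.card V, x = ord q ∧ Inc lam (c + 1) q) :
    DCC G where
  k := k
  C i := Finset.univ.filter fun v => number e v ∈ cl i
  L v := Finset.univ.filter fun i => number e v ∈ cl i
  isClique i u hu v hv huv := by
    simp only [Finset.coe_filter, Finset.mem_univ, true_and, Set.mem_ofPred_eq] at hu hv
    obtain ⟨p, hp, hup, hip⟩ := (hcl i i.2 _).1 hu
    obtain ⟨q, hq, hvq, hiq⟩ := (hcl i i.2 _).1 hv
    exact ((near_ord_iff ho hp hq hup hvq).1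
      (hcov.clique _ (Nat.succ_ne_zero _) _ _ hip hiq)).resolve_left huv
  covers u v huv := by
    have hu := ho.ord_pos_of_lt (number_lt e u)
    have hv := ho.ord_pos_of_lt (number_lt e v)
    have key : ∀ y z, (posGraph (Fintype.card V) (G.map (number e)) ord).Adj y z →
        ∃ i : Fin k, ord y ∈ cl i ∧ ord z ∈ cl i := by
      have key' : ∀ y z, y < z → (posGraph (Fintype.card V) (G.map (number e)) ord).Adj y z →
          ∃ i : Fin k, ord y ∈ cl i ∧ ord z ∈ cl i := by
        intro y z hyz hadj
        have h0 := hall y z hyz hadj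
        have hk := hcov.le y z
        have hi : lam y z - 1 < k := by omega
        have heq : lam y z = lam y z - 1 + 1 := by omega
        exact ⟨⟨lam y z - 1, hi⟩, (hcl _ hi _).2 ⟨y, hadj.1, rfl, z, Or.inl heq⟩,
          (hcl _ hi _).2 ⟨z, hadj.2.1, rfl, y, Or.inr heq⟩⟩
      intro y z hadj
      rcases lt_trichotomy y z with h | rfl | h
      · exact key' y z h hadj
      · exact absurd hadj (SimpleGraph.irrefl _)
      · obtain ⟨i, h1, h2⟩ := key' z y h hadj.symm
        exact ⟨i, h2, h1⟩
    obtain ⟨i, h1, h2⟩ := key (pos (number e u) - 1) (pos (number e v) - 1)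
      ⟨hu.2.1, hv.2.1, by rw [hu.2.2, hv.2.2, SimpleGraph.map_adj_apply]; exact huv⟩
    rw [hu.2.2] at h1
    rw [hv.2.2] at h2
    exact ⟨i, by simpa using h1, by simpa using h2⟩
  mem_L v i := by simp
  union_L i := by
    obtain ⟨y, z, hyz⟩ := hcov.used (i + 1) (Nat.succ_ne_zero _) i.2
    have hadj := (hcov.supp (y := y) (z := z) (by omega)).2
    obtain ⟨v, hv⟩ := exists_number e (ho.pos_ord y (Nat.zero_le _) hadj.1).1
    refine ⟨v, ?_⟩
    simp only [Finset.mem_filter, Finset.mem_univ, true_and]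
    exact (hcl i i.2 _).2 ⟨y, hadj.1, hv, z, Or.inl hyz⟩

variable (ho : IsOrder (Fintype.card V) (G.map (number e)) pos ord 0)
  (hcov : IsCover (posGraph (Fintype.card V) (G.map (number e)) ord) lam k)
  (hall : ∀ y z, y < z → (posGraph (Fintype.card V) (G.map (number e)) ord).Adj y z →
    lam y z ≠ 0)
  (hcl : ∀ c < k, ∀ x, x ∈ cl c ↔ ∃ q < Fintype.card V, x = ord q ∧ Inc lam (c + 1) q)

theorem mem_labelDCC_C {v : V} {i : Fin k} :
    v ∈ (labelDCC ho hcov hall hcl).C i ↔ number e v ∈ cl i := by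
  simp [labelDCC]

/-- A union of at least two cliques contains the union of two of them, which is not a clique. -/
theorem labelDCC_compositionMinimal : (labelDCC ho hcov hall hcl).CompositionMinimal := by
  intro S hS hcl'
  obtain ⟨b, hb, c, hc, hbc⟩ := Finset.one_lt_card.1 hS
  have hbk : (b : ℕ) < k := b.2
  have hck : (c : ℕ) < k := c.2
  obtain ⟨x, y, hx, hy, hxy⟩ := hcov.sep (b + 1) (c + 1) (Nat.succ_ne_zero _) hbk
    (Nat.succ_ne_zero _) hck fun h => hbc (Fin.ext (Nat.succ_injective h))
  have hlt : ∀ {a x : ℕ}, Inc lam (a + 1) x → x < Fintype.card V := by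
    rintro a x ⟨w, h | h⟩
    · exact (hcov.supp (y := x) (z := w) (by omega)).2.1
    · exact (hcov.supp (y := w) (z := x) (by omega)).2.2.1
  obtain ⟨u, hu⟩ := exists_number e (ho.pos_ord x (Nat.zero_le _) (hlt hx)).1
  obtain ⟨v, hv⟩ := exists_number e (ho.pos_ord y (Nat.zero_le _) (hlt hy)).1
  refine hxy ((near_ord_iff ho (hlt hx) (hlt hy) hu hv).2 (or_iff_not_imp_left.2 fun huv => ?_))
  refine hcl' ?_ ?_ huv
  · simp only [Set.mem_iUnion, Finset.mem_coe]
    exact ⟨b, hb, (mem_labelDCC_C ho hcov hall hcl).2 ((hcl b hbk _).2 ⟨x, hlt hx, hu, hx⟩)⟩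
  · simp only [Set.mem_iUnion, Finset.mem_coe]
    exact ⟨c, hc, (mem_labelDCC_C ho hcov hall hcl).2 ((hcl c hck _).2 ⟨y, hlt hy, hv, hy⟩)⟩

/-- The lists of numbers in the output are lists of the members of the cliques. -/
theorem exists_lists_labelDCC (hnd : ∀ c < k, (cl c).Nodup) :
    ∃ c : Fin k → List V, ∀ i, (c i).map (number e) = cl i ∧
      Enumerates (c i) ((labelDCC ho hcov hall hcl).C i : Set V) := by
  have : ∀ i : Fin k, ∃ l : List V, l.map (number e) = cl i := fun i =>
    exists_map_eq _ _ fun x hx => by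
      obtain ⟨q, hq, rfl, -⟩ := (hcl i i.2 _).1 hx
      exact exists_number e (ho.pos_ord q (Nat.zero_le _) hq).1
  choose c hc using this
  refine ⟨c, fun i => ⟨hc i, List.Nodup.of_map (number e) ?_, fun v => ?_⟩⟩
  · rw [hc]
    exact hnd i i.2
  rw [Finset.mem_coe, mem_labelDCC_C, ← hc, List.mem_map_of_injective (number e).injective]

/-- The lists of labels in the output are lists of the members of the sets of the dual. -/
theorem exists_lists_labelDCC_dual {dl : ℕ → List ℕ} (hnd : ∀ x, (dl x).Nodup)
    (hdl : ∀ x c, c ∈ dl x ↔ c < k ∧ x ∈ cl c) :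
    ∃ l : V → List (Fin (labelDCC ho hcov hall hcl).k), ∀ v, (l v).map Fin.val = dl (number e v) ∧
      Enumerates (l v)
        ((labelDCC ho hcov hall hcl).L v : Set (Fin (labelDCC ho hcov hall hcl).k)) := by
  have : ∀ v : V, ∃ l : List (Fin (labelDCC ho hcov hall hcl).k), l.map Fin.val = dl (number e v) :=
    fun v => exists_map_eq _ _ fun x hx => ⟨⟨x, ((hdl _ _).1 hx).1⟩, rfl⟩
  choose l hl using this
  refine ⟨l, fun v => ⟨hl v, List.Nodup.of_map Fin.val (by rw [hl]; exact hnd _), fun i => ?_⟩⟩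
  have h1 : v ∈ (labelDCC ho hcov hall hcl).C i ↔ number e v ∈ cl i :=
    mem_labelDCC_C ho hcov hall hcl
  rw [Finset.mem_coe, DCC.mem_L, h1, ← List.mem_map_of_injective Fin.val_injective, hl, hdl]
  exact and_iff_right i.2

theorem sizeC_labelDCC (hnd : ∀ c < k, (cl c).Nodup) :
    (labelDCC ho hcov hall hcl).sizeC = ∑ c ∈ Finset.range k, (cl c).length := by
  obtain ⟨c, hc⟩ := exists_lists_labelDCC ho hcov hall hcl hnd
  classical
  rw [← Fin.sum_univ_eq_sum_range fun c => (cl c).length]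
  refine Finset.sum_congr rfl fun i _ => ?_
  rw [← (hc i).1, List.length_map, ← List.toFinset_card_of_nodup (hc i).2.1]
  congr 1
  ext v
  rw [List.mem_toFinset, (hc i).2.2, Finset.mem_coe]

theorem sizeC_labelDCC_le_mul_cliqueNum :
    (labelDCC ho hcov hall hcl).sizeC ≤ k * G.cliqueNum := by
  refine (Finset.sum_le_card_nsmul _ _ G.cliqueNum fun i _ => ?_).trans_eq ?_
  · exact ((labelDCC ho hcov hall hcl).isClique i).card_le_cliqueNum
  · rw [Finset.card_univ, Fintype.card_fin, smul_eq_mul]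
    rfl

end Representation

/-! ### The contents of the memory at the start -/

section Input

variable {V : Type*} [Fintype V] {G : SimpleGraph V} (e : V ≃ Fin (Fintype.card V))
  {N : V → List V}

theorem inputState_mem (N : V → List V) : (inputState e N).mem = fun a =>
    (encodeLists ((List.range (Fintype.card V)).map (numberLists e N))).getD a 0 := by
  rw [← inOrder_eq e _ fun v => numberLists_number (N := N) e v]
  rfl

/-- The largest number in the input is the number of vertices. -/
theorem inputState_mem_le (hN : ∀ v, Enumerates (N v) (G.neighborSet v)) (i : ℕ) :
    (inputState e N).mem i ≤ Fintype.card V := by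
  classical
  have key : ∀ x ∈ encodeLists (inOrder e fun v => (N v).map (number e)), x ≤ Fintype.card V := by
    intro x hx
    simp only [encodeLists, inOrder, List.mem_cons, List.mem_append, List.mem_flatten,
      List.length_map, List.length_finRange, List.mem_map, List.map_map] at hx
    rcases hx with rfl | ⟨i, -, rfl⟩ | ⟨l, ⟨i, -, rfl⟩, hx⟩
    · exact le_rfl
    · simp only [Function.comp_apply, List.length_map]
      rw [← List.toFinset_card_of_nodup (hN _).1]
      exact Finset.card_le_univ _
    · obtain ⟨v, -, rfl⟩ := List.mem_map.1 hx
      exact (number_lt e v).le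
  change (encodeLists (inOrder e fun v => (N v).map (number e))).getD i 0 ≤ Fintype.card V
  rw [List.getD_eq_getElem?_getD]
  rcases h : (encodeLists (inOrder e fun v => (N v).map (number e)))[i]? with _ | x
  · exact Nat.zero_le _
  · exact key x (List.mem_of_getElem? h)

end Input

end DualCliqueCover

theorem theorem2 :
    ∃ (P : DualCliqueCover.Prog) (K : ℕ),
      ∀ (V : Type*) [Fintype V] [Nonempty V] (G : SimpleGraph V),
        (∀ v, ∃ w, G.Adj v w) →
        ∀ (e : V ≃ Fin (Fintype.card V)) (N : V → List V),
          (∀ v, DualCliqueCover.Enumerates (N v) (G.neighborSet v)) →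
          ∃ D : DualCliqueCover.DCC G,
            D.Succinct K ∧
            D.size ≤ K * min (DualCliqueCover.numEdges G)
              (G.cliqueNum * DualCliqueCover.cliqueDist G) ∧
            ∃ (t : ℕ) (τ : DualCliqueCover.State),
              DualCliqueCover.Exec (K * DualCliqueCover.numEdges G) (Fintype.card V ^ K) P
                (DualCliqueCover.inputState e N) t τ ∧
              DualCliqueCover.Outputs (K * DualCliqueCover.numEdges G) e τ D ∧
              t ≤ K * (DualCliqueCover.degeneracy G ^ 2 *
                min (DualCliqueCover.numEdges G) (DualCliqueCover.cliqueDist G)) := by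
  open DualCliqueCover in
  -- The constant `600` bounds the memory and the word length, and `111` the number of iterations.
  refine ⟨program algorithm, 111 * algorithm.size + 600, fun V _ _ G hiso e N hN => ?_⟩
  have hK : 600 ≤ 111 * algorithm.size + 600 := Nat.le_add_left _ _
  set K := 111 * algorithm.size + 600 with hKdef
  clear_value K
  set m := numEdges G with hm
  have hin := isInput_number e hN
  have hsum := sum_length_numberLists e hN
  -- No vertex is isolated, so every adjacency list is nonempty.
  have hpos : ∀ i < Fintype.card V, 1 ≤ (numberLists e N i).length := by
    intro i hi
    obtain ⟨v, rfl⟩ := exists_number e hi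
    obtain ⟨w, hw⟩ := hiso v
    rw [numberLists_number, List.length_map]
    exact List.length_pos_of_mem (((hN v).2 w).2 hw)
  have hn2 : 2 ≤ Fintype.card V := by
    obtain ⟨v⟩ := ‹Nonempty V›
    obtain ⟨w, hw⟩ := hiso v
    exact Fintype.one_lt_card_iff.2 ⟨v, w, hw.ne⟩
  have hnm : Fintype.card V ≤ 2 * m := by
    rw [← hsum]
    calc Fintype.card V = ∑ i ∈ Finset.range (Fintype.card V), 1 := by simp
      _ ≤ _ := Finset.sum_le_sum fun i hi => hpos i (Finset.mem_range.1 hi)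
  -- `s` is the length of the input.
  obtain ⟨s, hsd⟩ : ∃ s, s = start (Fintype.card V) (numberLists e N) (Fintype.card V) := ⟨_, rfl⟩
  have hs : s = 1 + Fintype.card V + 2 * m := by rw [hsd, start, hsum]
  have hs25 : numArr * (4 * s) = 25 * (4 * (1 + Fintype.card V + 2 * m)) := by rw [hs]; rfl
  have hmn : m ≤ (Fintype.card V).choose 2 := by
    classical
    rw [hm, numEdges, ← SimpleGraph.coe_edgeFinset, Set.ncard_coe_finset]
    exact G.card_edgeFinset_le_card_choose_two
  have hW : numArr * (4 * s) ≤ Fintype.card V ^ K := by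
    have h1 : (Fintype.card V).choose 2 ≤ Fintype.card V ^ 2 := Nat.choose_le_pow _ 2
    rw [hs25]
    calc 25 * (4 * (1 + Fintype.card V + 2 * m))
        ≤ 2 ^ 9 * Fintype.card V ^ 2 := by omega
      _ ≤ Fintype.card V ^ 9 * Fintype.card V ^ 2 :=
        Nat.mul_le_mul_right _ (Nat.pow_le_pow_left hn2 9)
      _ = Fintype.card V ^ 11 := by ring
      _ ≤ Fintype.card V ^ K := Nat.pow_le_pow_right (by omega) (by omega)
  have hS : numArr * (4 * s) ≤ K * m := by
    rw [hs25]
    calc 25 * (4 * (1 + Fintype.card V + 2 * m))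
        ≤ 600 * m := by omega
      _ ≤ K * m := Nat.mul_le_mul_right _ hK
  have hseg := seg_getD (encodeLists ((List.range (Fintype.card V)).map (numberLists e N)))
  rw [← inputState_mem] at hseg
  have hcells := hseg
  simp only [encodeLists, seg_cons, seg_append, List.length_map, List.length_range] at hcells
  have hlen : ∀ j < Fintype.card V, (inputState e N).mem (j + 1) = (numberLists e N j).length := by
    intro j hj
    have := hcells.2.1 j (by simpa using hj)
    simpa [add_comm] using this
  have hlt : ∀ i, (inputState e N).mem i < Fintype.card V ^ K := fun i =>
    (inputState_mem_le e hN i).trans_lt (lt_self_pow₀ (by omega) (by omega))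
  have hwp := algorithm_spec (M := 4 * s) (W := Fintype.card V ^ K) hin
    (by rw [hsd])
    ((Nat.mul_le_mul_right _ (by decide)).trans hW) hn2
    ⟨0, by omega, by have := hpos 0 (by omega); omega⟩
    (fun pos ord ho z hz => length_earlier_le_degeneracy e ho hz)
    (σ := initial (inputState e N).mem) (fun a ha => by simp [initial, ha]) rfl
    (by simpa [initial] using hseg)
  obtain ⟨t, l', τ, hexec, ⟨pos, ord, lam, k, cl, dl, ho, hcov, hall, hk, hclnd, hclmem, hdlnd,
    hdlmem, hsize, hout, houtM, hclk⟩, hreg, hmem, ht⟩ :=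
    program_spec algorithm (inputState e N) (fun _ => rfl) hcells.1
      (s := s)
      (by rw [hsd, start, Finset.sum_congr rfl fun j hj => hlen j (Finset.mem_range.1 hj)]) rfl hW
      (fun i hi => by
        rw [inputState_mem]
        exact List.getD_eq_default _ _ (by rwa [length_encodeLists, ← hsd])) hlt hwp
  set Q := posGraph (Fintype.card V) (G.map (number e)) ord with hQ
  have hec : edgeCount (Fintype.card V) Q = m := by
    have : 2 * edgeCount (Fintype.card V) Q = _ := two_mul_edgeCount hin ho
    rw [hsum] at this
    omega
  have hgap := edgeCount_add_sum_gap (Fintype.card V) Q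
  rw [hec] at hgap hsize hclk
  have hσ : cliqueDist G = 1 + ∑ z ∈ Finset.range (Fintype.card V), gap Q z := by
    unfold cliqueDist
    omega
  set q := cliqueDist G with hq
  set d := degeneracy G with hd
  have hD : ∀ z < Fintype.card V, (earlier Q z z).length ≤ d := fun z hz =>
    length_earlier_le_degeneracy e ho hz
  have hmd := ho.smallestLast.edgeCount_le hD
  have hcost := sum_stepCost_le hD
  rw [hec] at hmd hcost
  rw [← hσ] at hmd
  -- The graph has an edge, so `d` is positive, and linear terms are absorbed by `d ^ 2 * min m σ`.
  have hd1 : 1 ≤ d := by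
    by_contra h0
    have : d = 0 := by omega
    rw [this] at hmd
    simp at hmd
    omega
  have hX : m ≤ d ^ 2 * min m q := by
    rcases min_choice m q with h | h
    · rw [h]
      exact Nat.le_mul_of_pos_left _ (Nat.pow_pos hd1)
    · rw [h]
      exact hmd
  have hX' : d ^ 2 * min m (∑ z ∈ Finset.range (Fintype.card V), gap Q z) ≤ d ^ 2 * min m q :=
    Nat.mul_le_mul_left _ (by omega)
  have hsizeC := sizeC_labelDCC ho hcov hall hclmem hclnd
  have hω := sizeC_labelDCC_le_mul_cliqueNum ho hcov hall hclmem
  obtain ⟨c, hc⟩ := exists_lists_labelDCC ho hcov hall hclmem hclnd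
  obtain ⟨l, hl⟩ := exists_lists_labelDCC_dual ho hcov hall hclmem hdlnd hdlmem
  have hk1 : (List.finRange k).map (fun i => (c i).map fun v => (e v : ℕ)) =
      (List.range k).map cl := by
    rw [← map_finRange_eq]
    exact List.map_congr_left fun i _ => (hc i).1
  have hl1 : inOrder e (fun v => (l v).map fun i => (i : ℕ)) =
      (List.range (Fintype.card V)).map dl :=
    inOrder_eq e _ fun v => by
      rw [← (hl v).1]
      simp [← List.map_eq_flatMap]
  -- There are at most `2 * σ` cliques, because `1 + 2 * ∑ gap ≤ 2 * (1 + ∑ gap)`.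
  have hsizeK : (labelDCC ho hcov hall hclmem).sizeC ≤ 2 * min m (G.cliqueNum * q) := by
    have : k * G.cliqueNum ≤ 2 * (G.cliqueNum * q) := by
      calc k * G.cliqueNum ≤ (2 * q) * G.cliqueNum := Nat.mul_le_mul_right _ (by omega)
        _ = _ := by ring
    omega
  refine ⟨labelDCC ho hcov hall hclmem,
    ⟨labelDCC_compositionMinimal ho hcov hall hclmem, ?_⟩, ?_, t, l', hexec.mono hS,
    ⟨c, l, fun i => (hc i).2, fun v => (hl v).2, _, rfl, ?_, ?_⟩, ?_⟩
  · exact (by omega : _ ≤ 2 * m).trans (Nat.mul_le_mul_right _ (by omega))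
  · rw [DCC.size, DCC.sizeL_eq]
    exact (by omega : _ ≤ 4 * min m (G.cliqueNum * q)).trans (Nat.mul_le_mul_right _ (by omega))
  · refine le_trans (Nat.add_le_add_left ?_ _) (hreg.trans hS)
    rw [hl1]
    exact (congrArg (fun A => (encodeLists A ++
      encodeLists ((List.range (Fintype.card V)).map dl)).length) hk1).trans_le houtM
  · rw [hl1]
    intro j hj
    change j < (encodeLists ((List.finRange k).map (fun i => (c i).map fun v => (e v : ℕ))) ++
      encodeLists ((List.range (Fintype.card V)).map dl)).length at hj
    change _ = (encodeLists ((List.finRange k).map (fun i => (c i).map fun v => (e v : ℕ))) ++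
      encodeLists ((List.range (Fintype.card V)).map dl)).getD j 0
    rw [hk1] at hj ⊢
    rw [hmem j (by omega)]
    have := hout j hj
    rw [zero_add] at this
    rw [this, List.getD_eq_getElem _ _ hj]
  · -- `111 = 11 * 2 + 14 + 74 + 1`, since `n ≤ 2 * m`
    have hclk' : τ.clk + 1 ≤ 111 * (d ^ 2 * min m q) := by omega
    calc t ≤ algorithm.size * (τ.clk + 1) + 4 * Fintype.card V + 33 := ht
      _ ≤ algorithm.size * (111 * (d ^ 2 * min m q)) + 41 * (d ^ 2 * min m q) := by
        have := Nat.mul_le_mul_left algorithm.size hclk'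
        omega
      _ = (111 * algorithm.size + 41) * (d ^ 2 * min m q) := by ring
      _ ≤ K * (d ^ 2 * min m q) := Nat.mul_le_mul_right _ (by omega)
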